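/- Let $\Bbbk$ be a field of characteristic zero and let $k\geqslant 1$ be an integer. Twisted associative algebras are monoids, for the Cauchy product $(\mathcal A\otimes\mathcal B)(I)=\bigoplus_{I=J\sqcup K}\mathcal A(J)\otimes\mathcal B(K)$, in the category of species (functors from finite sets and bijections) in graded $\Bbbk$-vector spaces. *Definitions.* The extended Losev--Manin algebra $\mathrm{tHC}$ is the twisted associative algebra generated by fully symmetric elements $\mathsf m_t^{2p}$ of arity $t\geqslant 1$ and homological degree $2p\geqslant 0$ (write $\mathsf m_I^{2p}$ for the generator with set of arguments $I$), subject to the relations $$\sum_{p+q=D}\ \sum_{\substack{N=I\sqcup J\\ i\in I,\,j\in J}}\bigl(\mathsf m_I^{2p}\mathsf m_J^{2q}-\mathsf m_J^{2q}\mathsf m_I^{2p}\bigr)=0$$ for all finite sets $N$, all $i\ne j$ in $N$ and all $D\geqslant 0$. The algebra $\mathrm{tHyperCom}_k$ is the quotient of $\mathrm{tHC}$ by the ideal generated by all $\mathsf m_t^{2m}$ with $t\neq 1+m(k-1)$. All these algebras carry a weight grading in which the generators have weight $1$. A weight graded algebra $\mathcal A$ with weight zero part equal to the unit is Koszul if the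 homology of its bar construction (the cofree conilpotent comonoid on $s\overline{\mathcal A}$, with the differential multiplying adjacent factors) is concentrated on the diagonal, that is, in syzygy degree (the number of symbols $s$) equal to the weight; the diagonal part of this homology is the Koszul dual comonoid $\mathcal A^{¡}$. Let $(\Bbbk s)^{\otimes I}$ be the twisted associative algebra of tensor powers of a one-dimensional space of degree $1$ under concatenation. For twisted associative algebras $\mathcal B$ let $\Sigma\mathcal B(I)=(\Bbbk s)^{\otimes I}\otimes\mathcal B(I)$, with the factorwise product and Koszul signs, and let $\mathcal A^!=\Sigma\bigl((\mathcal A^{¡})^*\bigr)$ (graded dual) be the Koszul dual twisted associative algebra. *Statement.* 1. For every $k\geqslant 1$ the twisted associative algebra $\mathrm{tHyperCom}_k$ is Koszul. 2. For every $k\geqslant 1$ the suspension $\Sigma(\mathrm{tHyperCom}_k^!)$ is isomorphic, as a twisted associative algebra and compatibly with homological degrees and weights, to the twisted associative algebra generated by elements $\mathsf g^{(m)}$, $m\geqslant 0$, of arity $1+m(k-1)$, homological degree $1+2m(k-2)$ and weight $1$, each generating the trivial representation of its symmetric group, subject to the following relations, in which $\mathsf g^{(m)}_I$ is the generator with set of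 arguments $I$, $|I|=1+m(k-1)$: $$\sum_{i\in I}\mathsf g^{(0)}_{\{i\}}\,\mathsf g^{(m+m')}_{N\setminus\{i\}}=\mathsf g^{(m)}_I\,\mathsf g^{(m')}_J\quad\text{for } N=I\sqcup J,\ |I|=1+m(k-1),\ |J|=1+m'(k-1),\ m>0,\ m'\geqslant 0,$$ $$\sum_{i\in N}\mathsf g^{(0)}_{\{i\}}\,\mathsf g^{(D)}_{N\setminus\{i\}}=0\quad\text{for } |N|=2+D(k-1),\ D\geqslant 0.$$ (For $k>1$ the index $m$ is determined by $|I|$, and $m>0$ means $|I|>1$.) 3. If $k>1$, then for every $n\geqslant 0$ (with $n-1$ replaced by $0$ if $n=0$) the dimension of $\mathrm{tHyperCom}_k^!(\underline n)$ is equal to the number of subsets of $\{1,\dots,n-1\}$ whose cardinality is divisible by $k-1$, that is, to $\sum_{p=0}^{n}\binom{n-1}{p(k-1)}$. -/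

import Mathlib

universe u

namespace Tw

/-- The labels indexing the components of a species: `X.obj ⟨I, d, w⟩` is the component of
homological degree `d` and weight `w` of the value of the species on the finite set `I`.
Finite sets are taken to be finite subsets of `ℕ`. -/
@[ext] structure Lab where
  supp : Finset ℕ
  deg : ℤ
  wt : ℕ
deriving DecidableEq

namespace Lab

/-- The label of the unit. -/
def nil : Lab := ⟨∅, 0, 0⟩

/-- Union of the sets of arguments, sum of the degrees and of the weights. -/
def join (x y : Lab) : Lab := ⟨x.supp ∪ y.supp, x.deg + y.deg, x.wt + y.wt⟩

/-- Relabelling of the arguments. -/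
def move (σ : Equiv.Perm ℕ) (x : Lab) : Lab := ⟨x.supp.map σ.toEmbedding, x.deg, x.wt⟩

end Lab

/-- `z = x ⊔ y`: the set of `z` is the disjoint union of those of `x` and `y`, degrees and
weights add up. -/
structure Splits (z x y : Lab) : Prop where
  disj : Disjoint x.supp y.supp
  supp : x.supp ∪ y.supp = z.supp
  deg : x.deg + y.deg = z.deg
  wt : x.wt + y.wt = z.wt

theorem Splits.eq_join {z x y : Lab} (s : Splits z x y) : z = x.join y := by
  ext1
  · exact s.supp.symm
  · exact s.deg.symm
  · exact s.wt.symm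

theorem Splits.move {z x y : Lab} (s : Splits z x y) (σ : Equiv.Perm ℕ) :
    Splits (z.move σ) (x.move σ) (y.move σ) where
  disj := (Finset.disjoint_map _).2 s.disj
  supp := by
    have := congrArg (Finset.map σ.toEmbedding) s.supp
    rwa [Finset.map_union] at this
  deg := s.deg
  wt := s.wt

theorem Splits.inner {z x y u v : Lab} (s : Splits z x y) (t : Splits y u v) :
    Splits (x.join u) x u where
  disj := s.disj.mono_right (by rw [← t.supp]; exact Finset.subset_union_left)
  supp := rfl
  deg := rfl
  wt := rfl

theorem Splits.outer {z x y u v : Lab} (s : Splits z x y) (t : Splits y u v) :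
    Splits z (x.join u) v where
  disj := by
    have h := s.disj
    rw [← t.supp, Finset.disjoint_union_right] at h
    exact Finset.disjoint_union_left.2 ⟨h.2, t.disj⟩
  supp := by rw [← s.supp, ← t.supp]; exact Finset.union_assoc _ _ _
  deg := by rw [← s.deg, ← t.deg]; exact add_assoc _ _ _
  wt := by rw [← s.wt, ← t.wt]; exact add_assoc _ _ _

theorem Splits.inner' {z x y u v : Lab} (s : Splits z x y) (t : Splits x u v) :
    Splits (v.join y) v y where
  disj := s.disj.mono_left (by rw [← t.supp]; exact Finset.subset_union_right)
  supp := rfl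
  deg := rfl
  wt := rfl

theorem Splits.outer' {z x y u v : Lab} (s : Splits z x y) (t : Splits x u v) :
    Splits z u (v.join y) where
  disj := by
    have h := s.disj
    rw [← t.supp, Finset.disjoint_union_left] at h
    exact Finset.disjoint_union_right.2 ⟨t.disj, h.1⟩
  supp := by rw [← s.supp, ← t.supp]; exact (Finset.union_assoc _ _ _).symm
  deg := by rw [← s.deg, ← t.deg]; exact (add_assoc _ _ _).symm
  wt := by rw [← s.wt, ← t.wt]; exact (add_assoc _ _ _).symm

theorem Splits.join_assoc {t x y z xy yz i j : Lab} (s₁ : Splits xy x y) (s₂ : Splits t xy z)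
    (s₃ : Splits yz y z) (s : Splits x i j) : Splits (j.join yz) (j.join y) z where
  disj := s₂.disj.mono_left (by
    rw [← s₁.supp, ← s.supp]
    exact Finset.union_subset_union_left Finset.subset_union_right)
  supp := by
    simp only [Lab.join]
    rw [← s₃.supp]; exact Finset.union_assoc _ _ _
  deg := by simp only [Lab.join]; rw [← s₃.deg]; exact add_assoc _ _ _
  wt := by simp only [Lab.join]; rw [← s₃.wt]; exact add_assoc _ _ _

theorem Splits.nil_left {z y : Lab} (s : Splits z Lab.nil y) : y = z := by
  ext1
  · simpa [Lab.nil] using s.supp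
  · simpa [Lab.nil] using s.deg
  · simpa [Lab.nil] using s.wt

theorem splits_nil_left (z : Lab) : Splits z Lab.nil z where
  disj := by simp [Lab.nil]
  supp := by simp [Lab.nil]
  deg := by simp [Lab.nil]
  wt := by simp [Lab.nil]

theorem splits_nil_right (z : Lab) : Splits z z Lab.nil where
  disj := by simp [Lab.nil]
  supp := by simp [Lab.nil]
  deg := by simp [Lab.nil]
  wt := by simp [Lab.nil]

/-- A species with values in vector spaces carrying a homological degree and a weight: a functor
on the groupoid of finite subsets of `ℕ` and bijections, which is equivalent to the groupoid of
finite sets. A bijection between finite subsets of `ℕ` is represented by a permutation of `ℕ` extending it: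
by `map_id` and `map_comp` the map `map σ` depends only on the restriction of `σ`. -/
structure Species (k : Type u) [Field k] where
  obj : Lab → Type u
  [acg : ∀ x, AddCommGroup (obj x)]
  [mod : ∀ x, Module k (obj x)]
  map : ∀ (σ : Equiv.Perm ℕ) {x y : Lab}, x.move σ = y → (obj x →ₗ[k] obj y)
  map_id : ∀ (σ : Equiv.Perm ℕ) {x : Lab} (h : x.move σ = x), (∀ i ∈ x.supp, σ i = i) →
    ∀ a, map σ h a = a
  map_comp : ∀ (σ τ : Equiv.Perm ℕ) {x y z : Lab} (h : x.move σ = y) (h' : y.move τ = z)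
    (h'' : x.move (τ * σ) = z) (a : obj x), map τ h' (map σ h a) = map (τ * σ) h'' a

attribute [instance] Species.acg Species.mod

section
variable {k : Type u} [Field k]

theorem move_one {x y : Lab} (h : x = y) : x.move 1 = y := by
  subst h
  ext1
  · ext i; simp only [Lab.move, Finset.mem_map_equiv]; exact Iff.rfl
  · rfl
  · rfl

theorem move_move {x y z : Lab} {σ τ : Equiv.Perm ℕ} (h : x.move σ = y) (h' : y.move τ = z) :
    x.move (τ * σ) = z := by
  subst h; subst h'
  ext1
  · ext i; simp only [Lab.move, Finset.mem_map_equiv]; exact Iff.rfl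
  · rfl
  · rfl

theorem move_symm {x y : Lab} {σ : Equiv.Perm ℕ} (h : x.move σ = y) : y.move σ⁻¹ = x := by
  subst h
  ext1
  · ext i
    simp only [Lab.move, Finset.mem_map_equiv]
    rw [show (Equiv.symm σ⁻¹) i = σ i from rfl, Equiv.symm_apply_apply]
  · rfl
  · rfl

theorem Species.map_one (X : Species k) {x : Lab} (h : x.move 1 = x) (a : X.obj x) :
    X.map 1 h a = a := X.map_id 1 h (fun _ _ => rfl) a

/-- The unit species `𝕂`: the ground field on the empty set, in degree and weight `0`. -/
noncomputable def Species.unit (k : Type u) [Field k] : Species k where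
  obj x := PLift (x = Lab.nil) →₀ k
  map σ x y h := Finsupp.lmapDomain k k (fun hx => ⟨by
    rw [← h, hx.down]; ext1 <;> simp [Lab.nil, Lab.move]⟩)
  map_id σ x h _ a := by
    have : (fun hx : PLift (x = Lab.nil) => hx) = id := rfl
    simp only [Finsupp.lmapDomain_apply]
    exact Finsupp.mapDomain_id
  map_comp σ τ x y z h h' h'' a := by
    simp only [Finsupp.lmapDomain_apply, ← Finsupp.mapDomain_comp]

/-- The counit, which is the identity of the ground field on the component `Lab.nil`. -/
noncomputable def Species.counit {x : Lab} : (Species.unit k).obj x →ₗ[k] k :=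
  Finsupp.linearCombination k (fun _ => (1 : k))

/-- The Cauchy product `(X ⊗ Y)(I) = ⨁_{I = J ⊔ K} X(J) ⊗ Y(K)` (underlying spaces). -/
abbrev CauchyObj (X Y : Species k) (z : Lab) : Type u :=
  DirectSum {p : Lab × Lab // Splits z p.1 p.2}
    (fun p => TensorProduct k (X.obj p.1.1) (Y.obj p.1.2))

/-- The element `a ⊗ b` of the Cauchy product. -/
noncomputable def ten (X Y : Species k) {z x y : Lab} (s : Splits z x y) :
    X.obj x →ₗ[k] Y.obj y →ₗ[k] CauchyObj X Y z :=
  (TensorProduct.mk k (X.obj x) (Y.obj y)).compr₂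
    (DirectSum.lof k {p : Lab × Lab // Splits z p.1 p.2}
      (fun p => TensorProduct k (X.obj p.1.1) (Y.obj p.1.2)) ⟨(x, y), s⟩)

/-- Linear maps out of the Cauchy product, from their bilinear components. -/
noncomputable def clift (X Y : Species k) {z : Lab} {M : Type u} [AddCommGroup M] [Module k M]
    (F : ∀ {x y : Lab}, Splits z x y → X.obj x →ₗ[k] Y.obj y →ₗ[k] M) :
    CauchyObj X Y z →ₗ[k] M :=
  DirectSum.toModule k _ M (fun p => TensorProduct.lift (F p.2))

theorem clift_ten (X Y : Species k) {z : Lab} {M : Type u} [AddCommGroup M] [Module k M]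
    (F : ∀ {x y : Lab}, Splits z x y → X.obj x →ₗ[k] Y.obj y →ₗ[k] M)
    {x y : Lab} (s : Splits z x y) (a : X.obj x) (b : Y.obj y) :
    clift X Y F (ten X Y s a b) = F s a b := by
  simp [clift, ten]

theorem cauchy_ext {X Y : Species k} {z : Lab} {M : Type u} [AddCommGroup M] [Module k M]
    {f g : CauchyObj X Y z →ₗ[k] M}
    (H : ∀ {x y : Lab} (s : Splits z x y) (a : X.obj x) (b : Y.obj y),
      f (ten X Y s a b) = g (ten X Y s a b)) : f = g := by
  apply DirectSum.linearMap_ext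
  rintro ⟨⟨x, y⟩, s⟩
  apply TensorProduct.ext'
  intro a b
  exact H s a b

/-- The Cauchy product of species. -/
noncomputable def Species.cauchy (X Y : Species k) : Species k where
  obj z := CauchyObj X Y z
  map σ z z' h := clift X Y (fun {x y} s =>
    (ten X Y (h ▸ s.move σ : Splits z' (x.move σ) (y.move σ))).compl₁₂
      (X.map σ rfl) (Y.map σ rfl))
  map_id σ z h hs a := by
    have key : clift X Y (fun {x y} s =>
        (ten X Y (h ▸ s.move σ : Splits z (x.move σ) (y.move σ))).compl₁₂
          (X.map σ rfl) (Y.map σ rfl)) = LinearMap.id := by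
      apply cauchy_ext
      intro x y s a b
      rw [clift_ten]
      have aux : ∀ w : Lab, (∀ i ∈ w.supp, σ i = i) → w.move σ = w := by
        intro w hw
        ext1
        · simp only [Lab.move]
          ext i
          simp only [Finset.mem_map, Equiv.coe_toEmbedding]
          constructor
          · rintro ⟨j, hj, rfl⟩; rwa [hw j hj]
          · intro hi; exact ⟨i, hi, hw i hi⟩
        · rfl
        · rfl
      have hx : ∀ i ∈ x.supp, σ i = i := fun i hi =>
        hs i (by rw [← s.supp]; exact Finset.mem_union_left _ hi)
      have hy : ∀ i ∈ y.supp, σ i = i := fun i hi =>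
        hs i (by rw [← s.supp]; exact Finset.mem_union_right _ hi)
      have gen : ∀ (x' y' : Lab) (ex : x.move σ = x') (ey : y.move σ = y')
          (ex' : x' = x) (ey' : y' = y) (t : Splits z x' y'),
          ten X Y t (X.map σ ex a) (Y.map σ ey b) = ten X Y s a b := by
        intro x' y' ex ey ex' ey' t
        subst ex'; subst ey'
        rw [X.map_id σ ex hx, Y.map_id σ ey hy]
      exact gen _ _ rfl rfl (aux x hx) (aux y hy) _
    rw [key]; rfl
  map_comp σ τ x y z h h' h'' a := by
    rw [← LinearMap.comp_apply]
    congr 1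
    apply cauchy_ext
    intro u v s a b
    rw [LinearMap.comp_apply, clift_ten, clift_ten, LinearMap.compl₁₂_apply,
      LinearMap.compl₁₂_apply]
    erw [clift_ten]
    rw [LinearMap.compl₁₂_apply]
    have gen : ∀ (u' v' : Lab) (eu : (u.move σ).move τ = u') (ev : (v.move σ).move τ = v')
        (t : Splits z u' v') (eu' : u.move (τ * σ) = u') (ev' : v.move (τ * σ) = v'),
        ten X Y t (X.map τ eu (X.map σ rfl a)) (Y.map τ ev (Y.map σ rfl b)) =
        ten X Y (h'' ▸ s.move (τ * σ)) (X.map (τ * σ) rfl a) (Y.map (τ * σ) rfl b) := by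
      intro u' v' eu ev t eu' ev'
      subst eu'; subst ev'
      rw [X.map_comp σ τ rfl eu rfl, Y.map_comp σ τ rfl ev rfl]
    exact gen _ _ rfl rfl _ (move_move rfl rfl) (move_move rfl rfl)

end

section
variable {k : Type u} [Field k]

/-- `ten` with values in the Cauchy product as a species. -/
noncomputable def cten (X Y : Species k) {z x y : Lab} (s : Splits z x y) :
    X.obj x →ₗ[k] Y.obj y →ₗ[k] (X.cauchy Y).obj z := ten X Y s

theorem cauchy_map_ten (X Y : Species k) {z z' x y x' y' : Lab} (σ : Equiv.Perm ℕ)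
    (h : z.move σ = z') (s : Splits z x y) (s' : Splits z' x' y') (hx : x.move σ = x')
    (hy : y.move σ = y') (a : X.obj x) (b : Y.obj y) :
    (X.cauchy Y).map σ h (cten X Y s a b) = cten X Y s' (X.map σ hx a) (Y.map σ hy b) := by
  subst hx; subst hy
  exact clift_ten X Y (fun {x y} s =>
    (ten X Y (h ▸ s.move σ : Splits z' (x.move σ) (y.move σ))).compl₁₂
      (X.map σ rfl) (Y.map σ rfl)) s a b

/-- The projection of the Cauchy product on one of its summands. -/
noncomputable def ccomp (X Y : Species k) {z x y : Lab} (s : Splits z x y) :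
    (X.cauchy Y).obj z →ₗ[k] TensorProduct k (X.obj x) (Y.obj y) :=
  DirectSum.component k {p : Lab × Lab // Splits z p.1 p.2}
    (fun p => TensorProduct k (X.obj p.1.1) (Y.obj p.1.2)) ⟨(x, y), s⟩

theorem ccomp_same (X Y : Species k) {z x y : Lab} (s s' : Splits z x y) (a : X.obj x)
    (b : Y.obj y) : ccomp X Y s (cten X Y s' a b) = TensorProduct.mk k _ _ a b :=
  DirectSum.component.lof_self k _ _

theorem ccomp_ne (X Y : Species k) {z x y x' y' : Lab} (s : Splits z x y) (s' : Splits z x' y')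
    (hne : (x', y') ≠ (x, y)) (a : X.obj x') (b : Y.obj y') :
    ccomp X Y s (cten X Y s' a b) = 0 := by
  refine (DirectSum.component.of k _ _ _).trans ?_
  rw [dif_neg]
  intro e
  exact hne (congrArg Subtype.val e)

/-- A twisted associative algebra, i.e. a monoid for the Cauchy product of species, in vector
spaces carrying a homological degree and a weight: the product is given by its components
`A(J) ⊗ A(K) → A(I)` for `I = J ⊔ K`. -/
structure TwAlg (k : Type u) [Field k] extends Species k where
  mul : ∀ {z x y : Lab}, Splits z x y → obj x →ₗ[k] obj y →ₗ[k] obj z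
  one : obj Lab.nil
  one_mul : ∀ {x : Lab} (s : Splits x Lab.nil x) (a : obj x), mul s one a = a
  mul_one : ∀ {x : Lab} (s : Splits x x Lab.nil) (a : obj x), mul s a one = a
  mul_assoc : ∀ {x y z xy yz t : Lab} (s₁ : Splits xy x y) (s₂ : Splits t xy z)
    (s₃ : Splits yz y z) (s₄ : Splits t x yz) (a : obj x) (b : obj y) (c : obj z),
    mul s₂ (mul s₁ a b) c = mul s₄ a (mul s₃ b c)
  map_mul : ∀ (σ : Equiv.Perm ℕ) {x y z x' y' z' : Lab} (s : Splits z x y) (s' : Splits z' x' y')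
    (hx : x.move σ = x') (hy : y.move σ = y') (hz : z.move σ = z') (a : obj x) (b : obj y),
    map σ hz (mul s a b) = mul s' (map σ hx a) (map σ hy b)

/-- Isomorphisms of twisted associative algebras (preserving degree and weight). -/
structure TwAlgIso {k : Type u} [Field k] (A B : TwAlg k) where
  equiv : ∀ x : Lab, A.obj x ≃ₗ[k] B.obj x
  map_equiv : ∀ (σ : Equiv.Perm ℕ) {x y : Lab} (h : x.move σ = y) (a : A.obj x),
    equiv y (A.map σ h a) = B.map σ h (equiv x a)
  equiv_mul : ∀ {z x y : Lab} (s : Splits z x y) (a : A.obj x) (b : A.obj y),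
    equiv z (A.mul s a b) = B.mul s (equiv x a) (equiv y b)
  equiv_one : equiv Lab.nil A.one = B.one

/-! ### The bar construction -/

/-- The unit map `𝕂 → A`. -/
noncomputable def TwAlg.unitMap (A : TwAlg k) (x : Lab) : (Species.unit k).obj x →ₗ[k] A.obj x :=
  Finsupp.linearCombination k
    (fun hx : PLift (x = Lab.nil) => A.map 1 (move_one hx.down.symm) A.one)

/-- The augmentation ideal `Ā` of a non-negatively weighted algebra with `A₀ = 𝕂`: the
components of positive weight. -/
def TwAlg.aug (A : TwAlg k) : Species k where
  obj x := ({ carrier := {a | x.wt = 0 → a = 0}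
              add_mem' := fun {a b} ha hb h => by rw [ha h, hb h, add_zero]
              zero_mem' := fun _ => rfl
              smul_mem' := fun c a ha h => by rw [ha h, smul_zero] } : Submodule k (A.obj x))
  map σ x y h := (A.map σ h).restrict (fun a ha h0 => by
    subst h; rw [ha h0, map_zero])
  map_id σ x h hs a := Subtype.ext (A.map_id σ h hs a.1)
  map_comp σ τ x y z h h' h'' a := Subtype.ext (A.map_comp σ τ h h' h'' a.1)

theorem TwAlg.aug_eq_zero (A : TwAlg k) {x : Lab} (hx : x.wt = 0) (a : A.aug.obj x) : a = 0 :=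
  Subtype.ext (a.2 hx)

/-- The product of `A` restricted to `Ā`. -/
def TwAlg.augMul (A : TwAlg k) {z x y : Lab} (s : Splits z x y) :
    A.aug.obj x →ₗ[k] A.aug.obj y →ₗ[k] A.aug.obj z :=
  LinearMap.mk₂ k (fun a b => ⟨A.mul s a.1 b.1, fun h => by
      rw [a.2 (by have := s.wt; omega), map_zero, LinearMap.zero_apply]⟩)
    (fun a a' b => Subtype.ext (LinearMap.map_add₂ (A.mul s) a.1 a'.1 b.1))
    (fun c a b => Subtype.ext (LinearMap.map_smul₂ (A.mul s) c a.1 b.1))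
    (fun a b b' => Subtype.ext (map_add (A.mul s a.1) b.1 b'.1))
    (fun c a b => Subtype.ext (map_smul (A.mul s a.1) c b.1))

theorem TwAlg.augMul_assoc (A : TwAlg k) {x y z xy yz t : Lab} (s₁ : Splits xy x y)
    (s₂ : Splits t xy z) (s₃ : Splits yz y z) (s₄ : Splits t x yz) (a : A.aug.obj x)
    (b : A.aug.obj y) (c : A.aug.obj z) :
    A.augMul s₂ (A.augMul s₁ a b) c = A.augMul s₄ a (A.augMul s₃ b c) :=
  Subtype.ext (A.mul_assoc s₁ s₂ s₃ s₄ a.1 b.1 c.1)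

/-- The sign attached to a parity. -/
def sg (k : Type u) [Field k] (e : ZMod 2) : k := if e = 0 then 1 else -1

theorem sg_add (e f : ZMod 2) : sg k (e + f) = sg k e * sg k f := by
  have key : ∀ e f : ZMod 2, (e + f = 0 ↔ (e = 0 ↔ f = 0)) := by decide
  unfold sg
  simp only [key]
  by_cases he : e = 0 <;> by_cases hf : f = 0 <;> simp [he, hf]

theorem sg_zero : sg k 0 = 1 := by simp [sg]

/-- The part `(sĀ)^{⊗ n}` of syzygy degree `n` of the bar construction. The degree of a label
is the internal one (induced from `A`), so that the homological degree of an element of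
`(A.bar n).obj x` is `x.deg + n`. -/
noncomputable def TwAlg.bar (A : TwAlg k) : ℕ → Species k
  | 0 => Species.unit k
  | n + 1 => A.aug.cauchy (A.bar n)

/-- `bten s a v` is the element `[a | v]` of the bar construction. -/
noncomputable def TwAlg.bten (A : TwAlg k) (n : ℕ) {z x y : Lab} (s : Splits z x y) :
    A.aug.obj x →ₗ[k] (A.bar n).obj y →ₗ[k] (A.bar (n + 1)).obj z :=
  cten A.aug (A.bar n) s

/-- Linear maps out of the bar construction, from their components. -/
noncomputable def TwAlg.blift (A : TwAlg k) (n : ℕ) {z : Lab} {M : Type u} [AddCommGroup M]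
    [Module k M]
    (F : ∀ {x y : Lab}, Splits z x y → A.aug.obj x →ₗ[k] (A.bar n).obj y →ₗ[k] M) :
    (A.bar (n + 1)).obj z →ₗ[k] M :=
  clift A.aug (A.bar n) F

theorem TwAlg.blift_bten (A : TwAlg k) (n : ℕ) {z : Lab} {M : Type u} [AddCommGroup M]
    [Module k M]
    (F : ∀ {x y : Lab}, Splits z x y → A.aug.obj x →ₗ[k] (A.bar n).obj y →ₗ[k] M)
    {x y : Lab} (s : Splits z x y) (a : A.aug.obj x) (v : (A.bar n).obj y) :
    A.blift n F (A.bten n s a v) = F s a v := clift_ten _ _ F s a v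

theorem TwAlg.bar_ext (A : TwAlg k) {n : ℕ} {z : Lab} {M : Type u} [AddCommGroup M] [Module k M]
    {f g : (A.bar (n + 1)).obj z →ₗ[k] M}
    (H : ∀ {x y : Lab} (s : Splits z x y) (a : A.aug.obj x) (v : (A.bar n).obj y),
      f (A.bten n s a v) = g (A.bten n s a v)) : f = g := cauchy_ext H

theorem TwAlg.bar_map_bten (A : TwAlg k) (n : ℕ) {z z' x y x' y' : Lab} (σ : Equiv.Perm ℕ)
    (h : z.move σ = z') (s : Splits z x y) (s' : Splits z' x' y') (hx : x.move σ = x')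
    (hy : y.move σ = y') (a : A.aug.obj x) (v : (A.bar n).obj y) :
    (A.bar (n + 1)).map σ h (A.bten n s a v) =
      A.bten n s' (A.aug.map σ hx a) ((A.bar n).map σ hy v) :=
  cauchy_map_ten _ _ σ h s s' hx hy a v

/-- `bmerge s a [b | v] = [a b | v]`. -/
noncomputable def TwAlg.bmerge (A : TwAlg k) (n : ℕ) {z x y : Lab} (s : Splits z x y) :
    A.aug.obj x →ₗ[k] (A.bar (n + 1)).obj y →ₗ[k] (A.bar (n + 1)).obj z :=
  { toFun := fun a => A.blift n (fun t =>
      (A.bten n (s.outer t)).comp (A.augMul (s.inner t) a))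
    map_add' := fun a a' => A.bar_ext (fun t b v => by
      simp only [LinearMap.add_apply, A.blift_bten, LinearMap.comp_apply, map_add])
    map_smul' := fun c a => A.bar_ext (fun t b v => by
      simp only [LinearMap.smul_apply, A.blift_bten, LinearMap.comp_apply, map_smul,
        RingHom.id_apply]) }

theorem TwAlg.bmerge_bten (A : TwAlg k) (n : ℕ) {z x y u v : Lab} (s : Splits z x y)
    (t : Splits y u v) (a : A.aug.obj x) (b : A.aug.obj u) (w : (A.bar n).obj v) :
    A.bmerge n s a (A.bten n t b w) = A.bten n (s.outer t) (A.augMul (s.inner t) a b) w :=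
  A.blift_bten n (fun t => (A.bten n (s.outer t)).comp (A.augMul (s.inner t) a)) t b w

/-- The differential `(A.bar (n + 1)).obj z → (A.bar n).obj z` of the bar construction,
`d [a₁ | … | aₙ₊₁] = ∑ᵢ ± [a₁ | … | aᵢ aᵢ₊₁ | … | aₙ₊₁]`, with the signs
dictated by the Koszul rule. -/
noncomputable def TwAlg.bd (A : TwAlg k) :
    ∀ (n : ℕ) (z : Lab), (A.bar (n + 1)).obj z →ₗ[k] (A.bar n).obj z
  | 0, _ => 0
  | n + 1, _ => A.blift (n + 1) (fun {x y} s =>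
      sg k (x.deg : ZMod 2) • (A.bmerge n s - (A.bten n s).compl₂ (A.bd n y)))

theorem TwAlg.bd_bten (A : TwAlg k) (n : ℕ) {z x y : Lab} (s : Splits z x y)
    (a : A.aug.obj x) (v : (A.bar (n + 1)).obj y) :
    A.bd (n + 1) z (A.bten (n + 1) s a v) =
      sg k (x.deg : ZMod 2) • (A.bmerge n s a v - A.bten n s a (A.bd n y v)) :=
  A.blift_bten (n + 1) _ s a v

theorem TwAlg.bmerge_bmerge (A : TwAlg k) (n : ℕ) {z x y u v : Lab} (s : Splits z x y)
    (t : Splits y u v) (a : A.aug.obj x) (b : A.aug.obj u) (w : (A.bar (n + 1)).obj v) :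
    A.bmerge n s a (A.bmerge n t b w) = A.bmerge n (s.outer t) (A.augMul (s.inner t) a b) w := by
  rw [← LinearMap.comp_apply]
  congr 1
  apply A.bar_ext
  intro p q r c w
  rw [LinearMap.comp_apply, A.bmerge_bten, A.bmerge_bten, A.bmerge_bten]
  have e : (x.join (u.join p)) = ((x.join u).join p) := by
    ext1
    · exact (Finset.union_assoc _ _ _).symm
    · exact (add_assoc _ _ _).symm
    · exact (add_assoc _ _ _).symm
  have gen : ∀ (l l' : Lab) (e : l = l') (h₁ : Splits z l q) (h₁' : Splits z l' q)
      (h₂ : Splits l x (u.join p)) (h₂' : Splits l' (x.join u) p),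
      A.bten n h₁ (A.augMul h₂ a (A.augMul (t.inner r) b c)) w =
      A.bten n h₁' (A.augMul h₂' (A.augMul (s.inner t) a b) c) w := by
    intro l l' e h₁ h₁' h₂ h₂'
    subst e
    rw [A.augMul_assoc (s.inner t) h₂' (t.inner r) h₂]
  exact gen _ _ e _ _ _ _

theorem TwAlg.bd_bd (A : TwAlg k) : ∀ (n : ℕ) (z : Lab) (v : (A.bar (n + 2)).obj z),
    A.bd n z (A.bd (n + 1) z v) = 0
  | 0, z, v => rfl
  | n + 1, z, v => by
    have key : (A.bd (n + 1) z).comp (A.bd (n + 2) z) = 0 := by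
      apply A.bar_ext
      intro x y s a v
      have inner : ((A.bd (n + 1) z).comp (A.bd (n + 2) z)).comp (A.bten (n + 2) s a) = 0 := by
        apply A.bar_ext
        intro u w t b v
        simp only [LinearMap.comp_apply, LinearMap.zero_apply]
        rw [A.bd_bten, map_smul, map_sub, A.bmerge_bten, A.bd_bten, A.bd_bten, A.bd_bd n,
          A.bd_bten, map_smul, map_sub, map_zero, A.bmerge_bmerge, A.bmerge_bten,
          show (((x.join u).deg : ℤ) : ZMod 2) = (x.deg : ZMod 2) + (u.deg : ZMod 2) from by
            simp [Lab.join], sg_add, sub_zero, mul_smul, sub_self, smul_zero]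
      exact LinearMap.congr_fun inner v
    exact LinearMap.congr_fun key v

end

/-! ### Deconcatenation -/

section
variable {k : Type u} [Field k]

/-- Linear maps out of the Cauchy product, as a species, from their bilinear components. -/
noncomputable def cclift (X Y : Species k) {z : Lab} {M : Type u} [AddCommGroup M] [Module k M]
    (F : ∀ {x y : Lab}, Splits z x y → X.obj x →ₗ[k] Y.obj y →ₗ[k] M) :
    (X.cauchy Y).obj z →ₗ[k] M := clift X Y F

theorem cclift_cten (X Y : Species k) {z : Lab} {M : Type u} [AddCommGroup M] [Module k M]
    (F : ∀ {x y : Lab}, Splits z x y → X.obj x →ₗ[k] Y.obj y →ₗ[k] M)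
    {x y : Lab} (s : Splits z x y) (a : X.obj x) (b : Y.obj y) :
    cclift X Y F (cten X Y s a b) = F s a b := clift_ten X Y F s a b

theorem ccauchy_ext {X Y : Species k} {z : Lab} {M : Type u} [AddCommGroup M] [Module k M]
    {f g : (X.cauchy Y).obj z →ₗ[k] M}
    (H : ∀ {x y : Lab} (s : Splits z x y) (a : X.obj x) (b : Y.obj y),
      f (cten X Y s a b) = g (cten X Y s a b)) : f = g := cauchy_ext H

/-- The element `1` of the bar construction. -/
noncomputable def TwAlg.bone (A : TwAlg k) : (A.bar 0).obj Lab.nil :=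
  Finsupp.single (PLift.up rfl) (1 : k)

/-- `a ⊗ (v ⊗ w) ↦ [a | v] ⊗ w`. -/
noncomputable def TwAlg.bassoc (A : TwAlg k) (p q : ℕ) {z x y : Lab} (s : Splits z x y) :
    A.aug.obj x →ₗ[k] ((A.bar p).cauchy (A.bar q)).obj y →ₗ[k]
      ((A.bar (p + 1)).cauchy (A.bar q)).obj z :=
  { toFun := fun a => cclift (A.bar p) (A.bar q) (fun t =>
      (cten (A.bar (p + 1)) (A.bar q) (s.outer t)).comp (A.bten p (s.inner t) a))
    map_add' := fun a a' => ccauchy_ext (fun t b v => by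
      simp only [LinearMap.add_apply, cclift_cten, LinearMap.comp_apply, map_add])
    map_smul' := fun c a => ccauchy_ext (fun t b v => by
      simp only [LinearMap.smul_apply, cclift_cten, LinearMap.comp_apply, map_smul,
        RingHom.id_apply]) }

theorem TwAlg.bassoc_cten (A : TwAlg k) (p q : ℕ) {z x y u v : Lab} (s : Splits z x y)
    (t : Splits y u v) (a : A.aug.obj x) (b : (A.bar p).obj u) (c : (A.bar q).obj v) :
    A.bassoc p q s a (cten _ _ t b c) =
      cten (A.bar (p + 1)) (A.bar q) (s.outer t) (A.bten p (s.inner t) a b) c :=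
  cclift_cten (A.bar p) (A.bar q) (fun t =>
      (cten (A.bar (p + 1)) (A.bar q) (s.outer t)).comp (A.bten p (s.inner t) a)) t b c

/-- The component `[a₁ | … | aₚ₊q] ↦ [a₁ | … | aₚ] ⊗ [aₚ₊₁ | … | aₚ₊q]` of the
deconcatenation coproduct of the bar construction. -/
noncomputable def TwAlg.decat (A : TwAlg k) : ∀ (p q : ℕ) (z : Lab),
    (A.bar (q + p)).obj z →ₗ[k] ((A.bar p).cauchy (A.bar q)).obj z
  | 0, q, z => cten (A.bar 0) (A.bar q) (splits_nil_left z) A.bone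
  | p + 1, q, _ => A.blift (q + p) (fun {_ y} s => (A.bassoc p q s).compl₂ (A.decat p q y))

theorem TwAlg.decat_bten (A : TwAlg k) (p q : ℕ) {z x y : Lab} (s : Splits z x y)
    (a : A.aug.obj x) (v : (A.bar (q + p)).obj y) :
    A.decat (p + 1) q z (A.bten (q + p) s a v) = A.bassoc p q s a (A.decat p q y v) :=
  A.blift_bten (q + p) (fun {_ y} s => (A.bassoc p q s).compl₂ (A.decat p q y)) s a v

/-- Concatenation in the bar construction. -/
noncomputable def TwAlg.concat (A : TwAlg k) : ∀ (p q : ℕ) {z x y : Lab}, Splits z x y →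
    ((A.bar p).obj x →ₗ[k] (A.bar q).obj y →ₗ[k] (A.bar (q + p)).obj z)
  | 0, q, _, x, _, s => Finsupp.linearCombination k (fun hx : PLift (x = Lab.nil) =>
      (A.bar q).map 1 (move_one (by have h := hx.down; subst h; exact s.nil_left)))
  | p + 1, q, z, _, y, s => A.blift p (fun t =>
      (LinearMap.llcomp k ((A.bar q).obj y) ((A.bar (q + p)).obj _)
        ((A.bar (q + (p + 1))).obj z)).compl₁₂
        (A.bten (q + p) (s.outer' t)) (A.concat p q (s.inner' t)))

theorem TwAlg.concat_bten (A : TwAlg k) (p q : ℕ) {z x y u v : Lab} (s : Splits z x y)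
    (t : Splits x u v) (a : A.aug.obj u) (b : (A.bar p).obj v) (c : (A.bar q).obj y) :
    A.concat (p + 1) q s (A.bten p t a b) c =
      A.bten (q + p) (s.outer' t) a (A.concat p q (s.inner' t) b c) := by
  have := A.blift_bten p (fun t =>
      (LinearMap.llcomp k ((A.bar q).obj y) ((A.bar (q + p)).obj _)
        ((A.bar (q + (p + 1))).obj z)).compl₁₂
        (A.bten (q + p) (s.outer' t)) (A.concat p q (s.inner' t))) t a b
  exact LinearMap.congr_fun this c

/-- A version of `concat_bten` with arbitrary labels. -/
theorem TwAlg.concat_bten' (A : TwAlg k) (p q : ℕ) {z x y u v w : Lab} (s : Splits z x y)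
    (t : Splits x u v) (s' : Splits z u w) (t' : Splits w v y)
    (a : A.aug.obj u) (b : (A.bar p).obj v) (c : (A.bar q).obj y) :
    A.concat (p + 1) q s (A.bten p t a b) c =
      A.bten (q + p) s' a (A.concat p q t' b c) := by
  have e := t'.eq_join
  subst e
  exact A.concat_bten p q s t a b c

/-- The elements of `(A.bar 0).obj x`. -/
theorem TwAlg.bar_zero_induction (A : TwAlg k) {M : Type u} [AddCommGroup M] [Module k M]
    {x : Lab} {f g : (A.bar 0).obj x →ₗ[k] M}
    (H : ∀ hx : Lab.nil = x, f (hx ▸ A.bone) = g (hx ▸ A.bone)) : f = g := by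
  apply Finsupp.lhom_ext'
  rintro ⟨hx⟩
  apply LinearMap.ext_ring
  have hx' := hx.symm
  subst hx'
  exact H rfl

theorem TwAlg.concat_one (A : TwAlg k) (q : ℕ) {z y : Lab} (s : Splits z Lab.nil y)
    (c : (A.bar q).obj y) :
    A.concat 0 q s A.bone c = (A.bar q).map 1 (move_one s.nil_left) c := by
  have : A.concat 0 q s A.bone = (A.bar q).map 1 (move_one s.nil_left) := by
    refine (Finsupp.linearCombination_single k (1 : k) (PLift.up rfl)).trans ?_
    rw [one_smul]
  rw [this]

theorem TwAlg.concat_one' (A : TwAlg k) (q : ℕ) {z : Lab} (s : Splits z Lab.nil z)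
    (c : (A.bar q).obj z) :
    A.concat 0 q s A.bone c = c := by
  rw [A.concat_one, (A.bar q).map_one]

theorem TwAlg.decat_concat (A : TwAlg k) : ∀ (p q : ℕ) {z x y : Lab} (s : Splits z x y)
    (v : (A.bar p).obj x) (w : (A.bar q).obj y),
    A.decat p q z (A.concat p q s v w) = cten (A.bar p) (A.bar q) s v w
  | 0, q, z, x, y, s, v, w => by
    have key : (A.decat 0 q z).comp ((A.concat 0 q s).flip w) =
        (cten (A.bar 0) (A.bar q) s).flip w := by
      apply A.bar_zero_induction
      intro hx
      cases hx
      have hy := s.nil_left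
      subst hy
      simp only [LinearMap.comp_apply, LinearMap.flip_apply]
      rw [A.concat_one' q s w]
      rfl
    exact LinearMap.congr_fun key v
  | p + 1, q, z, x, y, s, v, w => by
    have key : (A.decat (p + 1) q z).comp ((A.concat (p + 1) q s).flip w) =
        (cten (A.bar (p + 1)) (A.bar q) s).flip w := by
      apply A.bar_ext
      intro u v t a b
      simp only [LinearMap.comp_apply, LinearMap.flip_apply]
      rw [A.concat_bten, A.decat_bten, A.decat_concat p q, A.bassoc_cten]
      have gen : ∀ (l : Lab) (e : l = x) (h₁ : Splits z l y) (h₂ : Splits l u v),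
          cten (A.bar (p + 1)) (A.bar q) h₁ (A.bten p h₂ a b) w =
          cten (A.bar (p + 1)) (A.bar q) s (A.bten p t a b) w := by
        intro l e h₁ h₂; subst e; rfl
      exact gen _ t.eq_join.symm _ _
    exact LinearMap.congr_fun key v

theorem TwAlg.concat_ext (A : TwAlg k) : ∀ (p q : ℕ) {z : Lab} {M : Type u} [AddCommGroup M]
    [Module k M] {f g : (A.bar (q + p)).obj z →ₗ[k] M},
    (∀ {x y : Lab} (s : Splits z x y) (v : (A.bar p).obj x) (w : (A.bar q).obj y),
      f (A.concat p q s v w) = g (A.concat p q s v w)) → f = g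
  | 0, q, z, M, _, _, f, g, H => by
    ext v
    have := H (splits_nil_left z) A.bone v
    rwa [A.concat_one'] at this
  | p + 1, q, z, M, _, _, f, g, H => by
    apply A.bar_ext
    intro x y s a v
    have key : f.comp (A.bten (q + p) s a) = g.comp (A.bten (q + p) s a) := by
      apply A.concat_ext p q
      intro u w t b c
      have := H (s.outer t) (A.bten p (s.inner t) a b) c
      rwa [A.concat_bten' p q (s.outer t) (s.inner t) s t] at this
    exact LinearMap.congr_fun key v

theorem TwAlg.map_concat (A : TwAlg k) (σ : Equiv.Perm ℕ) : ∀ (p q : ℕ)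
    {z x y z' x' y' : Lab} (s : Splits z x y) (s' : Splits z' x' y') (hx : x.move σ = x')
    (hy : y.move σ = y') (hz : z.move σ = z') (v : (A.bar p).obj x) (w : (A.bar q).obj y),
    (A.bar (q + p)).map σ hz (A.concat p q s v w) =
      A.concat p q s' ((A.bar p).map σ hx v) ((A.bar q).map σ hy w)
  | 0, q, z, x, y, z', x', y', s, s', hx, hy, hz, v, w => by
    have key : ((A.bar q).map σ hz).comp ((A.concat 0 q s).flip w) =
        ((A.concat 0 q s').flip ((A.bar q).map σ hy w)).comp ((A.bar 0).map σ hx) := by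
      apply A.bar_zero_induction
      intro h
      cases h
      have h' : x' = Lab.nil := by rw [← hx]; ext1 <;> simp [Lab.nil, Lab.move]
      subst h'
      have e := s.nil_left
      subst e
      have e' := s'.nil_left
      subst e'
      simp only [LinearMap.comp_apply, LinearMap.flip_apply]
      have h1 : (A.bar 0).map σ hx A.bone = A.bone :=
        Finsupp.mapDomain_single
      rw [h1, A.concat_one', A.concat_one']
    exact LinearMap.congr_fun key v
  | p + 1, q, z, x, y, z', x', y', s, s', hx, hy, hz, v, w => by
    have key : ((A.bar (q + (p + 1))).map σ hz).comp ((A.concat (p + 1) q s).flip w) =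
        ((A.concat (p + 1) q s').flip ((A.bar q).map σ hy w)).comp
          ((A.bar (p + 1)).map σ hx) := by
      apply A.bar_ext
      intro u v t a b
      simp only [LinearMap.comp_apply, LinearMap.flip_apply]
      subst hx; subst hy; subst hz
      have t' := t.move σ
      rw [A.concat_bten, A.bar_map_bten p σ rfl t t' rfl rfl,
        A.concat_bten' p q s' t' ((s.outer' t).move σ) ((s.inner' t).move σ)]
      erw [A.bar_map_bten (q + p) σ rfl (s.outer' t) ((s.outer' t).move σ) rfl rfl]
      rw [A.map_concat σ p q (s.inner' t) ((s.inner' t).move σ) rfl rfl rfl]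
    exact LinearMap.congr_fun key v
end

section
variable {k : Type u} [Field k]

/-- Transport along an equality of syzygy degrees. -/
noncomputable def TwAlg.castBar (A : TwAlg k) {m n : ℕ} (h : m = n) (z : Lab) :
    (A.bar m).obj z →ₗ[k] (A.bar n).obj z := by
  subst h; exact LinearMap.id

/-- Concatenation, with arbitrary syzygy degree of the result. -/
noncomputable def TwAlg.conc (A : TwAlg k) {p q n : ℕ} (h : q + p = n) {z x y : Lab}
    (s : Splits z x y) : (A.bar p).obj x →ₗ[k] (A.bar q).obj y →ₗ[k] (A.bar n).obj z :=
  (A.concat p q s).compr₂ (A.castBar h z)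

/-- Deconcatenation, with arbitrary syzygy degree of the argument. -/
noncomputable def TwAlg.deconc (A : TwAlg k) {p q n : ℕ} (h : q + p = n) (z : Lab) :
    (A.bar n).obj z →ₗ[k] ((A.bar p).cauchy (A.bar q)).obj z :=
  (A.decat p q z).comp (A.castBar h.symm z)

theorem TwAlg.conc_bten (A : TwAlg k) {p q n : ℕ} (h : q + (p + 1) = n + 1) (h' : q + p = n)
    {z x y u v w : Lab} (s : Splits z x y)
    (t : Splits x u v) (s' : Splits z u w) (t' : Splits w v y)
    (a : A.aug.obj u) (b : (A.bar p).obj v) (c : (A.bar q).obj y) :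
    A.conc h s (A.bten p t a b) c = A.bten n s' a (A.conc h' t' b c) := by
  subst h'
  exact A.concat_bten' p q s t s' t' a b c

theorem TwAlg.conc_bone (A : TwAlg k) {q : ℕ} (h : q + 0 = q) {z : Lab}
    (s : Splits z Lab.nil z) (c : (A.bar q).obj z) : A.conc h s A.bone c = c :=
  A.concat_one' q s c

theorem TwAlg.deconc_conc (A : TwAlg k) {p q n : ℕ} (h : q + p = n) {z x y : Lab}
    (s : Splits z x y) (v : (A.bar p).obj x) (w : (A.bar q).obj y) :
    A.deconc h z (A.conc h s v w) = cten (A.bar p) (A.bar q) s v w := by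
  subst h
  exact A.decat_concat p q s v w

theorem TwAlg.conc_ext (A : TwAlg k) {p q n : ℕ} (h : q + p = n) {z : Lab} {M : Type u}
    [AddCommGroup M] [Module k M] {f g : (A.bar n).obj z →ₗ[k] M}
    (H : ∀ {x y : Lab} (s : Splits z x y) (v : (A.bar p).obj x) (w : (A.bar q).obj y),
      f (A.conc h s v w) = g (A.conc h s v w)) : f = g := by
  subst h
  exact A.concat_ext p q H

theorem TwAlg.map_conc (A : TwAlg k) (σ : Equiv.Perm ℕ) {p q n : ℕ} (h : q + p = n)
    {z x y z' x' y' : Lab} (s : Splits z x y) (s' : Splits z' x' y') (hx : x.move σ = x')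
    (hy : y.move σ = y') (hz : z.move σ = z') (v : (A.bar p).obj x) (w : (A.bar q).obj y) :
    (A.bar n).map σ hz (A.conc h s v w) =
      A.conc h s' ((A.bar p).map σ hx v) ((A.bar q).map σ hy w) := by
  subst h
  exact A.map_concat σ p q s s' hx hy hz v w

theorem TwAlg.conc_assoc (A : TwAlg k) : ∀ (p : ℕ) {q r pq qr n : ℕ} (h₁ : q + p = pq)
    (h₂ : r + pq = n) (h₃ : r + q = qr) (h₄ : qr + p = n) {x y z xy yz t : Lab}
    (s₁ : Splits xy x y) (s₂ : Splits t xy z) (s₃ : Splits yz y z) (s₄ : Splits t x yz)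
    (u : (A.bar p).obj x) (v : (A.bar q).obj y) (w : (A.bar r).obj z),
    A.conc h₂ s₂ (A.conc h₁ s₁ u v) w = A.conc h₄ s₄ u (A.conc h₃ s₃ v w)
  | 0, q, r, pq, qr, n, h₁, h₂, h₃, h₄, x, y, z, xy, yz, t, s₁, s₂, s₃, s₄, u, v, w => by
    have key : ((A.conc h₂ s₂).flip w).comp ((A.conc h₁ s₁).flip v) =
        (A.conc h₄ s₄).flip (A.conc h₃ s₃ v w) := by
      apply A.bar_zero_induction
      intro hx
      cases hx
      have e := s₁.nil_left
      subst e
      have e := s₄.nil_left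
      subst e
      have e : q = pq := by omega
      subst e
      have e : qr = n := by omega
      subst e
      simp only [LinearMap.comp_apply, LinearMap.flip_apply]
      rw [A.conc_bone, A.conc_bone]
    exact LinearMap.congr_fun key u
  | p + 1, q, r, pq, qr, n, h₁, h₂, h₃, h₄, x, y, z, xy, yz, t, s₁, s₂, s₃, s₄, u, v, w => by
    obtain ⟨pq, rfl⟩ : ∃ m, pq = m + 1 := ⟨q + p, by omega⟩
    obtain ⟨n, rfl⟩ : ∃ m, n = m + 1 := ⟨r + pq, by omega⟩
    have key : ((A.conc h₂ s₂).flip w).comp ((A.conc h₁ s₁).flip v) =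
        (A.conc h₄ s₄).flip (A.conc h₃ s₃ v w) := by
      apply A.bar_ext
      intro i j s a b
      simp only [LinearMap.comp_apply, LinearMap.flip_apply]
      rw [A.conc_bten h₁ (by omega) s₁ s (s₁.outer' s) (s₁.inner' s),
        A.conc_bten h₂ (by omega) s₂ (s₁.outer' s) (s₄.outer' s)
          (s₁.join_assoc s₂ s₃ s),
        A.conc_bten h₄ (by omega) s₄ s (s₄.outer' s) (s₄.inner' s),
        A.conc_assoc p (by omega) (by omega) h₃ (by omega) (s₁.inner' s) _ s₃ (s₄.inner' s)]
    exact LinearMap.congr_fun key u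

theorem TwAlg.conc_right_bone (A : TwAlg k) : ∀ (p : ℕ) (h : 0 + p = p) {z : Lab}
    (s : Splits z z Lab.nil) (v : (A.bar p).obj z), A.conc h s v A.bone = v
  | 0, h, z, s, v => by
    have key : (A.conc h s).flip A.bone = LinearMap.id := by
      apply A.bar_zero_induction
      intro hx
      cases hx
      simp only [LinearMap.flip_apply, LinearMap.id_apply]
      rw [A.conc_bone h s A.bone]
    exact LinearMap.congr_fun key v
  | p + 1, h, z, s, v => by
    have key : (A.conc h s).flip A.bone = LinearMap.id := by
      apply A.bar_ext
      intro x y t a b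
      simp only [LinearMap.flip_apply, LinearMap.id_apply]
      rw [A.conc_bten h (by omega) s t t (splits_nil_right _), A.conc_right_bone p]
    exact LinearMap.congr_fun key v

theorem TwAlg.bmerge_conc (A : TwAlg k) {p q n : ℕ} (h : q + (p + 1) = n + 1)
    {x y z yz xy t : Lab} (s₁ : Splits t x yz) (s₂ : Splits yz y z) (s₃ : Splits t xy z)
    (s₄ : Splits xy x y) (a : A.aug.obj x) (v : (A.bar (p + 1)).obj y) (w : (A.bar q).obj z) :
    A.bmerge n s₁ a (A.conc h s₂ v w) = A.conc h s₃ (A.bmerge p s₄ a v) w := by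
  have key : (A.bmerge n s₁ a).comp ((A.conc h s₂).flip w) =
      ((A.conc h s₃).flip w).comp (A.bmerge p s₄ a) := by
    apply A.bar_ext
    intro i j r b c
    simp only [LinearMap.comp_apply, LinearMap.flip_apply]
    rw [A.conc_bten h (by omega) s₂ r (s₂.outer' r) (s₂.inner' r), A.bmerge_bten, A.bmerge_bten,
      A.conc_bten h (by omega) s₃ (s₄.outer r) (s₁.outer (s₂.outer' r)) (s₂.inner' r)]
  exact LinearMap.congr_fun key v

/-- The differential is a derivation with respect to concatenation up to the merging of the two
middle elements. -/
theorem TwAlg.bd_conc (A : TwAlg k) : ∀ (p : ℕ) {q n : ℕ} (h : q + p = n)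
    (h₁ : 1 + p = p + 1) (h₂ : q + (p + 1) = n + 1) {x y z xy yz t : Lab}
    (s₁ : Splits xy x y) (s₂ : Splits t xy z) (s₃ : Splits yz y z) (s₄ : Splits t x yz)
    (u : (A.bar p).obj x) (a : (A.bar 1).obj y) (w : (A.bar q).obj z),
    A.bd n t (A.conc h₂ s₂ (A.conc h₁ s₁ u a) w) =
      A.conc h s₂ (A.bd p xy (A.conc h₁ s₁ u a)) w +
      sg k ((x.deg : ZMod 2) + (p : ZMod 2)) •
        A.conc h s₄ u (A.bd q yz (A.conc (p := 1) (q := q) rfl s₃ a w))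
  | 0, q, n, h, h₁, h₂, x, y, z, xy, yz, t, s₁, s₂, s₃, s₄, u, a, w => by
    have key : (A.bd n t).comp (((A.conc h₂ s₂).flip w).comp ((A.conc h₁ s₁).flip a)) =
        ((A.conc h s₂).flip w).comp ((A.bd 0 xy).comp ((A.conc h₁ s₁).flip a)) +
        sg k ((x.deg : ZMod 2) + ((0 : ℕ) : ZMod 2)) •
          (A.conc h s₄).flip (A.bd q yz (A.conc (p := 1) (q := q) rfl s₃ a w)) := by
      apply A.bar_zero_induction
      intro hx
      cases hx
      have e := s₁.nil_left
      subst e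
      have e := s₄.nil_left
      subst e
      have e : q = n := by omega
      subst e
      simp only [LinearMap.comp_apply, LinearMap.flip_apply, LinearMap.add_apply,
        LinearMap.smul_apply]
      rw [A.conc_bone, A.conc_bone, show A.bd 0 y a = 0 from rfl, map_zero,
        LinearMap.zero_apply, show sg k ((Lab.nil.deg : ZMod 2) + ((0 : ℕ) : ZMod 2)) = 1 from by
          simp [Lab.nil, sg], one_smul]
      exact (zero_add _).symm
    exact LinearMap.congr_fun key u
  | p + 1, q, n, h, h₁, h₂, x, y, z, xy, yz, t, s₁, s₂, s₃, s₄, u, a, w => by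
    obtain ⟨n, rfl⟩ : ∃ m, n = m + 1 := ⟨q + p, by omega⟩
    have key : (A.bd (n + 1) t).comp (((A.conc h₂ s₂).flip w).comp ((A.conc h₁ s₁).flip a)) =
        ((A.conc h s₂).flip w).comp ((A.bd (p + 1) xy).comp ((A.conc h₁ s₁).flip a)) +
        sg k ((x.deg : ZMod 2) + ((p + 1 : ℕ) : ZMod 2)) •
          (A.conc h s₄).flip (A.bd q yz (A.conc (p := 1) (q := q) rfl s₃ a w)) := by
      apply A.bar_ext
      intro i j s b v
      simp only [LinearMap.comp_apply, LinearMap.flip_apply, LinearMap.add_apply,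
        LinearMap.smul_apply]
      have r := s₁.join_assoc s₂ s₃ s
      rw [A.conc_bten h₁ (by omega) s₁ s (s₁.outer' s) (s₁.inner' s),
        A.conc_bten h₂ (by omega) s₂ (s₁.outer' s) (s₄.outer' s) r,
        A.bd_bten, A.bd_bten, A.bd_conc p (by omega) (by omega) (by omega) (s₁.inner' s) r s₃
          (s₄.inner' s),
        A.bmerge_conc (by omega) (s₄.outer' s) r s₂ (s₁.outer' s),
        A.conc_bten h (by omega) s₄ s (s₄.outer' s) (s₄.inner' s)]
      simp only [map_smul, map_sub, map_add, LinearMap.smul_apply, LinearMap.sub_apply]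
      rw [A.conc_bten h (by omega) s₂ (s₁.outer' s) (s₄.outer' s) r,
        show (x.deg : ZMod 2) + ((p + 1 : ℕ) : ZMod 2) =
          (i.deg : ZMod 2) + (((j.deg : ZMod 2) + (p : ZMod 2)) + 1) from by
            rw [← s.deg]; push_cast; ring,
        sg_add (i.deg : ZMod 2), sg_add _ 1, show sg k 1 = -1 from by simp [sg]]
      simp only [mul_smul, smul_sub, smul_add, neg_smul, smul_neg, one_smul]
      abel
    exact LinearMap.congr_fun key u

/-- Weights are bounded below by syzygy degrees. -/
theorem TwAlg.bar_eq_zero (A : TwAlg k) : ∀ (n : ℕ) {z : Lab}, z.wt < n →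
    ∀ v : (A.bar n).obj z, v = 0
  | 0, z, h, v => absurd h (Nat.not_lt_zero _)
  | n + 1, z, h, v => by
    have key : (LinearMap.id : (A.bar (n + 1)).obj z →ₗ[k] _) = 0 := by
      apply A.bar_ext
      intro x y s a v
      rcases Nat.eq_zero_or_pos x.wt with hx | hx
      · rw [A.aug_eq_zero hx a, map_zero, LinearMap.zero_apply, map_zero, map_zero]
      · have := s.wt
        rw [A.bar_eq_zero n (by omega) v, map_zero, map_zero, map_zero]
    exact LinearMap.congr_fun key v

/-! ### The product of functionals dual to deconcatenation -/

/-- The product of linear functionals dual to the coproduct: `φ ψ = (φ ⊗ ψ) ∘ Δ`. -/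
noncomputable def TwAlg.fprod (A : TwAlg k) {p q n : ℕ} (h : q + p = n) {z x y : Lab}
    (s : Splits z x y) : Module.Dual k ((A.bar p).obj x) →ₗ[k] Module.Dual k ((A.bar q).obj y)
      →ₗ[k] Module.Dual k ((A.bar n).obj z) :=
  ((TensorProduct.mk k _ _).compr₂
    (TensorProduct.dualDistrib k ((A.bar p).obj x) ((A.bar q).obj y))).compr₂
    ((ccomp (A.bar p) (A.bar q) s).comp (A.deconc h z)).dualMap

theorem TwAlg.fprod_same (A : TwAlg k) {p q n : ℕ} (h : q + p = n) {z x y : Lab}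
    (s s' : Splits z x y) (φ : Module.Dual k ((A.bar p).obj x))
    (ψ : Module.Dual k ((A.bar q).obj y)) (v : (A.bar p).obj x) (w : (A.bar q).obj y) :
    A.fprod h s φ ψ (A.conc h s' v w) = φ v * ψ w := by
  unfold TwAlg.fprod
  simp only [LinearMap.compr₂_apply, LinearMap.dualMap_apply, LinearMap.comp_apply,
    TensorProduct.mk_apply]
  rw [A.deconc_conc, ccomp_same]
  simp

theorem TwAlg.fprod_ne (A : TwAlg k) {p q n : ℕ} (h : q + p = n) {z x y x' y' : Lab}
    (s : Splits z x y) (s' : Splits z x' y') (hne : (x', y') ≠ (x, y))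
    (φ : Module.Dual k ((A.bar p).obj x)) (ψ : Module.Dual k ((A.bar q).obj y))
    (v : (A.bar p).obj x') (w : (A.bar q).obj y') :
    A.fprod h s φ ψ (A.conc h s' v w) = 0 := by
  unfold TwAlg.fprod
  simp only [LinearMap.compr₂_apply, LinearMap.dualMap_apply, LinearMap.comp_apply,
    TensorProduct.mk_apply]
  rw [A.deconc_conc, ccomp_ne _ _ s s' hne, map_zero]

theorem TwAlg.fprod_assoc (A : TwAlg k) {p q r pq qr n : ℕ} (h₁ : q + p = pq)
    (h₂ : r + pq = n) (h₃ : r + q = qr) (h₄ : qr + p = n) {x y z xy yz t : Lab}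
    (s₁ : Splits xy x y) (s₂ : Splits t xy z) (s₃ : Splits yz y z) (s₄ : Splits t x yz)
    (φ : Module.Dual k ((A.bar p).obj x)) (ψ : Module.Dual k ((A.bar q).obj y))
    (χ : Module.Dual k ((A.bar r).obj z)) :
    A.fprod h₂ s₂ (A.fprod h₁ s₁ φ ψ) χ = A.fprod h₄ s₄ φ (A.fprod h₃ s₃ ψ χ) := by
  apply A.conc_ext h₂
  intro xy' z' s₂' v w
  have key : (A.fprod h₂ s₂ (A.fprod h₁ s₁ φ ψ) χ).comp ((A.conc h₂ s₂').flip w) =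
      (A.fprod h₄ s₄ φ (A.fprod h₃ s₃ ψ χ)).comp ((A.conc h₂ s₂').flip w) := by
    apply A.conc_ext h₁
    intro x' y' s₁' u v₂
    simp only [LinearMap.comp_apply, LinearMap.flip_apply]
    have e := s₁'.eq_join
    subst e
    rw [A.conc_assoc p h₁ h₂ h₃ h₄ s₁' s₂' (s₂'.inner' s₁') (s₂'.outer' s₁')]
    by_cases hall : x' = x ∧ y' = y ∧ z' = z
    · obtain ⟨rfl, rfl, rfl⟩ := hall
      have e := s₁.eq_join
      subst e
      have e := s₃.eq_join
      subst e
      rw [A.fprod_same, A.fprod_same]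
      rw [← A.conc_assoc p h₁ h₂ h₃ h₄ s₁ s₂ s₃ s₄, A.fprod_same, A.fprod_same, _root_.mul_assoc]
    · have L : A.fprod h₂ s₂ (A.fprod h₁ s₁ φ ψ) χ
          (A.conc h₂ s₂' (A.conc h₁ s₁' u v₂) w) = 0 := by
        by_cases h : (x'.join y', z') = (xy, z)
        · obtain ⟨e₁, e₂⟩ := Prod.mk.inj h
          subst e₁; subst e₂
          rw [A.fprod_same, A.fprod_ne h₁ s₁ s₁', zero_mul]
          intro h'
          obtain ⟨e₁, e₂⟩ := Prod.mk.inj h'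
          exact hall ⟨e₁, e₂, rfl⟩
        · exact A.fprod_ne h₂ s₂ s₂' h _ _ _ _
      have R : A.fprod h₄ s₄ φ (A.fprod h₃ s₃ ψ χ)
          (A.conc h₄ (s₂'.outer' s₁') u (A.conc h₃ (s₂'.inner' s₁') v₂ w)) = 0 := by
        by_cases h : (x', y'.join z') = (x, yz)
        · obtain ⟨e₁, e₂⟩ := Prod.mk.inj h
          subst e₁; subst e₂
          rw [A.fprod_same, A.fprod_ne h₃ s₃ (s₂'.inner' s₁'), mul_zero]
          intro h'
          obtain ⟨e₁, e₂⟩ := Prod.mk.inj h'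
          exact hall ⟨rfl, e₁, e₂⟩
        · exact A.fprod_ne h₄ s₄ (s₂'.outer' s₁') h _ _ _ _
      rw [R, ← A.conc_assoc p h₁ h₂ h₃ h₄ s₁' s₂' (s₂'.inner' s₁') (s₂'.outer' s₁'), L]
  exact LinearMap.congr_fun key v

/-- Compatibility of the product of functionals with the differential. -/
theorem TwAlg.fprod_bd_left (A : TwAlg k) {p q n : ℕ} (h : q + p = n)
    (h' : q + (p + 1) = n + 1) {z x y : Lab} (s : Splits z x y) (hy : y.wt = q)
    (φ : Module.Dual k ((A.bar p).obj x)) (ψ : Module.Dual k ((A.bar q).obj y)) :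
    A.fprod h' s (φ.comp (A.bd p x)) ψ = (A.fprod h s φ ψ).comp (A.bd n z) := by
  apply A.conc_ext h'
  intro xy' z' s₂ v w
  have key : (A.fprod h' s (φ.comp (A.bd p x)) ψ).comp ((A.conc h' s₂).flip w) =
      ((A.fprod h s φ ψ).comp (A.bd n z)).comp ((A.conc h' s₂).flip w) := by
    apply A.conc_ext (Nat.add_comm 1 p)
    intro x' y' s₁ u a
    simp only [LinearMap.comp_apply, LinearMap.flip_apply]
    have s₄ := s₂.outer' s₁
    have s₃ := s₂.inner' s₁
    rw [A.bd_conc p h _ h' s₁ s₂ s₃ s₄ u a w, map_add, map_smul]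
    have van : A.fprod h s φ ψ (A.conc h s₄ u (A.bd q _ (A.conc (p := 1) (q := q) rfl s₃ a w)))
        = 0 := by
      by_cases e : (x', y'.join z') = (x, y)
      · obtain ⟨e₁, e₂⟩ := Prod.mk.inj e
        rw [A.bar_eq_zero (q + 1) (by rw [e₂, hy]; exact Nat.lt_succ_self q)
          (A.conc (p := 1) (q := q) rfl s₃ a w), map_zero, map_zero, map_zero]
      · exact A.fprod_ne h s s₄ e _ _ _ _
    rw [van, smul_zero, add_zero]
    by_cases e : (xy', z') = (x, y)
    · obtain ⟨e₁, e₂⟩ := Prod.mk.inj e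
      subst e₁; subst e₂
      rw [A.fprod_same, A.fprod_same]
      rfl
    · rw [A.fprod_ne h' s s₂ e, A.fprod_ne h s s₂ e]
  exact LinearMap.congr_fun key v

theorem TwAlg.fprod_bd_right (A : TwAlg k) {p q n : ℕ} (h : q + p = n)
    (h' : q + 1 + p = n + 1) {z x y : Lab} (s : Splits z x y) (hx : x.wt = p)
    (φ : Module.Dual k ((A.bar p).obj x)) (ψ : Module.Dual k ((A.bar q).obj y)) :
    A.fprod h' s φ (ψ.comp (A.bd q y)) =
      sg k ((x.deg : ZMod 2) + (p : ZMod 2)) • (A.fprod h s φ ψ).comp (A.bd n z) := by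
  have h'' : q + (p + 1) = n + 1 := by omega
  apply A.conc_ext h''
  intro xy' z' s₂ v w
  have key : (A.fprod h' s φ (ψ.comp (A.bd q y))).comp ((A.conc h'' s₂).flip w) =
      (sg k ((x.deg : ZMod 2) + (p : ZMod 2)) • (A.fprod h s φ ψ).comp (A.bd n z)).comp
        ((A.conc h'' s₂).flip w) := by
    apply A.conc_ext (Nat.add_comm 1 p)
    intro x' y' s₁ u a
    simp only [LinearMap.comp_apply, LinearMap.flip_apply, LinearMap.smul_apply]
    have s₄ := s₂.outer' s₁
    have s₃ := s₂.inner' s₁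
    rw [A.bd_conc p h _ h'' s₁ s₂ s₃ s₄ u a w, map_add, map_smul]
    have van : A.fprod h s φ ψ (A.conc h s₂ (A.bd p xy' (A.conc (Nat.add_comm 1 p) s₁ u a)) w)
        = 0 := by
      by_cases e : (xy', z') = (x, y)
      · obtain ⟨e₁, e₂⟩ := Prod.mk.inj e
        rw [A.bar_eq_zero (p + 1) (by rw [e₁, hx]; exact Nat.lt_succ_self p)
          (A.conc (Nat.add_comm 1 p) s₁ u a), map_zero, map_zero, LinearMap.zero_apply, map_zero]
      · exact A.fprod_ne h s s₂ e _ _ _ _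
    rw [van, zero_add, A.conc_assoc p (Nat.add_comm 1 p) h'' rfl h' s₁ s₂ s₃ s₄]
    have sq : ∀ e : ZMod 2, sg k e * sg k e = 1 := by
      intro e
      rw [← sg_add, show e + e = 0 from by revert e; decide, sg_zero]
    by_cases e : (x', y'.join z') = (x, y)
    · obtain ⟨e₁, e₂⟩ := Prod.mk.inj e
      subst e₁; subst e₂
      rw [A.fprod_same, A.fprod_same, smul_smul, sq, one_smul]
      rfl
    · rw [A.fprod_ne h' s s₄ e, A.fprod_ne h s s₄ e, smul_zero, smul_zero]
  exact LinearMap.congr_fun key v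

end

/-! ### Ideals and quotients -/

section
variable {k : Type u} [Field k]

/-- Two-sided ideals of a twisted associative algebra. -/
structure TwIdeal {k : Type u} [Field k] (A : TwAlg k) where
  carrier : ∀ x : Lab, Submodule k (A.obj x)
  map_mem : ∀ (σ : Equiv.Perm ℕ) {x y : Lab} (h : x.move σ = y) {a : A.obj x},
    a ∈ carrier x → A.map σ h a ∈ carrier y
  mul_mem_left : ∀ {z x y : Lab} (s : Splits z x y) (a : A.obj x) {b : A.obj y},
    b ∈ carrier y → A.mul s a b ∈ carrier z
  mul_mem_right : ∀ {z x y : Lab} (s : Splits z x y) {a : A.obj x} (b : A.obj y),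
    a ∈ carrier x → A.mul s a b ∈ carrier z

/-- The ideal generated by a set of homogeneous elements. -/
def TwIdeal.span (A : TwAlg k) (R : ∀ x : Lab, Set (A.obj x)) : TwIdeal A where
  carrier x := ⨅ (N : TwIdeal A) (_ : ∀ y, R y ⊆ N.carrier y), N.carrier x
  map_mem σ x y h a ha := by
    simp only [Submodule.mem_iInf] at ha ⊢
    exact fun N hN => N.map_mem σ h (ha N hN)
  mul_mem_left s a b hb := by
    simp only [Submodule.mem_iInf] at hb ⊢
    exact fun N hN => N.mul_mem_left s a (hb N hN)
  mul_mem_right s a b ha := by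
    simp only [Submodule.mem_iInf] at ha ⊢
    exact fun N hN => N.mul_mem_right s b (ha N hN)

/-- The product of a quotient algebra. -/
def TwIdeal.quotMul {A : TwAlg k} (N : TwIdeal A) {z x y : Lab} (s : Splits z x y) :
    (A.obj x ⧸ N.carrier x) →ₗ[k] (A.obj y ⧸ N.carrier y) →ₗ[k] (A.obj z ⧸ N.carrier z) :=
  (N.carrier x).liftQ
    { toFun := fun a => (N.carrier y).mapQ (N.carrier z) (A.mul s a)
        (fun _ hb => N.mul_mem_left s a hb)
      map_add' := fun a a' => by
        apply Submodule.linearMap_qext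
        ext b
        simp
      map_smul' := fun c a => by
        apply Submodule.linearMap_qext
        ext b
        simp }
    (fun a ha => by
      apply Submodule.linearMap_qext
      ext b
      simpa using N.mul_mem_right s b ha)

theorem TwIdeal.quotMul_mk {A : TwAlg k} (N : TwIdeal A) {z x y : Lab} (s : Splits z x y)
    (a : A.obj x) (b : A.obj y) :
    N.quotMul s (Submodule.Quotient.mk a) (Submodule.Quotient.mk b) =
      Submodule.Quotient.mk (A.mul s a b) := rfl

/-- The quotient of a twisted associative algebra by an ideal. -/
def TwAlg.quot (A : TwAlg k) (N : TwIdeal A) : TwAlg k where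
  obj x := A.obj x ⧸ N.carrier x
  map σ x y h := (N.carrier x).mapQ (N.carrier y) (A.map σ h) (fun _ ha => N.map_mem σ h ha)
  map_id σ x h hs a := by
    obtain ⟨a, rfl⟩ := Submodule.Quotient.mk_surjective _ a
    rw [Submodule.mapQ_apply, A.map_id σ h hs]
  map_comp σ τ x y z h h' h'' a := by
    obtain ⟨a, rfl⟩ := Submodule.Quotient.mk_surjective _ a
    rw [Submodule.mapQ_apply, Submodule.mapQ_apply, Submodule.mapQ_apply, A.map_comp σ τ h h' h'']
  mul s := N.quotMul s
  one := Submodule.Quotient.mk A.one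
  one_mul s a := by
    obtain ⟨a, rfl⟩ := Submodule.Quotient.mk_surjective _ a
    rw [N.quotMul_mk, A.one_mul]
  mul_one s a := by
    obtain ⟨a, rfl⟩ := Submodule.Quotient.mk_surjective _ a
    rw [N.quotMul_mk, A.mul_one]
  mul_assoc s₁ s₂ s₃ s₄ a b c := by
    obtain ⟨a, rfl⟩ := Submodule.Quotient.mk_surjective _ a
    obtain ⟨b, rfl⟩ := Submodule.Quotient.mk_surjective _ b
    obtain ⟨c, rfl⟩ := Submodule.Quotient.mk_surjective _ c
    rw [N.quotMul_mk, N.quotMul_mk, N.quotMul_mk, N.quotMul_mk, A.mul_assoc s₁ s₂ s₃ s₄]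
  map_mul σ x y z x' y' z' s s' hx hy hz a b := by
    obtain ⟨a, rfl⟩ := Submodule.Quotient.mk_surjective _ a
    obtain ⟨b, rfl⟩ := Submodule.Quotient.mk_surjective _ b
    rw [N.quotMul_mk, Submodule.mapQ_apply, Submodule.mapQ_apply, Submodule.mapQ_apply,
      N.quotMul_mk, A.map_mul σ s s' hx hy hz]

/-- The projection on the quotient. -/
def TwAlg.toQuot (A : TwAlg k) (N : TwIdeal A) (x : Lab) : A.obj x →ₗ[k] (A.quot N).obj x :=
  (N.carrier x).mkQ

/-! ### Homology of the bar construction, Koszul algebras and Koszul duals -/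

/-- Cycles of the bar construction. -/
noncomputable def TwAlg.cycles (A : TwAlg k) : ∀ (n : ℕ) (z : Lab), Submodule k ((A.bar n).obj z)
  | 0, _ => ⊤
  | n + 1, z => LinearMap.ker (A.bd n z)

/-- Boundaries of the bar construction. -/
noncomputable def TwAlg.boundaries (A : TwAlg k) (n : ℕ) (z : Lab) :
    Submodule k ((A.bar n).obj z) := LinearMap.range (A.bd n z)

theorem TwAlg.boundaries_le_cycles (A : TwAlg k) (n : ℕ) (z : Lab) :
    A.boundaries n z ≤ A.cycles n z := by
  cases n with
  | zero => exact le_top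
  | succ n =>
    rintro _ ⟨v, rfl⟩
    exact A.bd_bd n z v

/-- The component of syzygy degree `n` and label `z` of the homology of the bar construction. -/
abbrev TwAlg.barHomology (A : TwAlg k) (n : ℕ) (z : Lab) : Type u :=
  A.cycles n z ⧸ (A.boundaries n z).submoduleOf (A.cycles n z)

/-- The weight zero part of the algebra is spanned by the unit. -/
def TwAlg.IsConnected (A : TwAlg k) : Prop :=
  ∀ x : Lab, x.wt = 0 → Function.Bijective (A.unitMap x)

/-- Koszul algebras: the weight zero part is the unit species and the homology of the bar
construction is concentrated on the diagonal, i.e. in syzygy degree equal to the weight. -/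
def TwAlg.IsKoszul (A : TwAlg k) : Prop :=
  A.IsConnected ∧ ∀ (n : ℕ) (z : Lab), z.wt ≠ n → Subsingleton (A.barHomology n z)

namespace Lab

/-- The label, in the bar construction, of the elements of syzygy degree `x.wt` and weight
`x.wt` that are in duality with elements of label `x`: these elements have homological degree
`(-x.deg - x.wt) + x.wt = -x.deg`. -/
def dual (x : Lab) : Lab := ⟨x.supp, -x.deg - x.wt, x.wt⟩

end Lab

theorem Splits.dual {z x y : Lab} (s : Splits z x y) : Splits z.dual x.dual y.dual where
  disj := s.disj
  supp := s.supp
  deg := by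
    have h1 := s.deg
    have h2 := s.wt
    simp only [Lab.dual]
    omega
  wt := s.wt

theorem dual_move {x y : Lab} {σ : Equiv.Perm ℕ} (h : x.move σ = y) :
    x.dual.move σ = y.dual := by
  subst h; rfl

theorem dual_inj {x y : Lab} (h : x.dual = y.dual) : x = y := by
  have h1 := congrArg Lab.supp h
  have h2 := congrArg Lab.deg h
  have h3 := congrArg Lab.wt h
  simp only [Lab.dual] at h1 h2 h3
  ext1
  · exact h1
  · omega
  · exact h3

theorem Splits.wt' {z x y : Lab} (s : Splits z x y) : y.wt + x.wt = z.wt := by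
  have := s.wt
  omega

theorem wt_move {x y : Lab} {σ : Equiv.Perm ℕ} (h : x.move σ = y) : x.wt = y.wt := by
  subst h; rfl

/-- The contragredient action on functionals. -/
noncomputable def TwAlg.fmap (A : TwAlg k) (σ : Equiv.Perm ℕ) {m n : ℕ} (hn : m = n) {x y : Lab}
    (h : x.move σ = y) : Module.Dual k ((A.bar m).obj x) →ₗ[k] Module.Dual k ((A.bar n).obj y) :=
  (((A.bar m).map σ⁻¹ (move_symm h)).comp (A.castBar hn.symm y)).dualMap

theorem TwAlg.fmap_apply (A : TwAlg k) (σ : Equiv.Perm ℕ) {n : ℕ} {x y : Lab}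
    (h : x.move σ = y) (φ : Module.Dual k ((A.bar n).obj x)) (v : (A.bar n).obj y) :
    A.fmap σ rfl h φ v = φ ((A.bar n).map σ⁻¹ (move_symm h) v) := rfl

theorem TwAlg.fmap_id (A : TwAlg k) (σ : Equiv.Perm ℕ) {n : ℕ} {x : Lab}
    (h : x.move σ = x) (hs : ∀ i ∈ x.supp, σ i = i) (φ : Module.Dual k ((A.bar n).obj x)) :
    A.fmap σ rfl h φ = φ := by
  ext v
  rw [A.fmap_apply, (A.bar n).map_id]
  intro i hi
  rw [Equiv.Perm.inv_eq_iff_eq]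
  exact (hs i hi).symm

theorem TwAlg.fmap_comp (A : TwAlg k) (σ τ : Equiv.Perm ℕ) {l m n : ℕ} (hm : l = m) (hn : m = n)
    (hl : l = n) {x y z : Lab} (h : x.move σ = y) (h' : y.move τ = z)
    (h'' : x.move (τ * σ) = z) (φ : Module.Dual k ((A.bar l).obj x)) :
    A.fmap τ hn h' (A.fmap σ hm h φ) = A.fmap (τ * σ) hl h'' φ := by
  subst hm; subst hn
  ext v
  rw [A.fmap_apply, A.fmap_apply, A.fmap_apply]
  have gen : ∀ (ρ : Equiv.Perm ℕ) (_ : ρ = σ⁻¹ * τ⁻¹) (e : z.move ρ = x),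
      (A.bar l).map σ⁻¹ (move_symm h) ((A.bar l).map τ⁻¹ (move_symm h') v) =
        (A.bar l).map ρ e v := by
    intro ρ hρ e
    subst hρ
    exact (A.bar l).map_comp _ _ _ _ _ _
  rw [gen _ (mul_inv_rev τ σ)]

theorem TwAlg.fmap_fprod (A : TwAlg k) (σ : Equiv.Perm ℕ) {p q n p' q' n' : ℕ} (h : q + p = n)
    (h' : q' + p' = n') (hp : p = p') (hq : q = q') (hn : n = n')
    {z x y z' x' y' : Lab} (s : Splits z x y) (s' : Splits z' x' y') (hx : x.move σ = x')
    (hy : y.move σ = y') (hz : z.move σ = z')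
    (φ : Module.Dual k ((A.bar p).obj x)) (ψ : Module.Dual k ((A.bar q).obj y)) :
    A.fmap σ hn hz (A.fprod h s φ ψ) = A.fprod h' s' (A.fmap σ hp hx φ) (A.fmap σ hq hy ψ) := by
  subst hp; subst hq; subst hn
  apply A.conc_ext h
  intro u v r a b
  rw [A.fmap_apply]
  have r' : Splits z (u.move σ⁻¹) (v.move σ⁻¹) := by
    have := r.move σ⁻¹
    rwa [move_symm hz] at this
  rw [A.map_conc σ⁻¹ h r r' rfl rfl (move_symm hz)]
  by_cases e : (u, v) = (x', y')
  · obtain ⟨e₁, e₂⟩ := Prod.mk.inj e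
    subst e₁; subst e₂
    rw [A.fprod_same, A.fmap_apply, A.fmap_apply]
    have gen : ∀ (i j : Lab) (hi : u.move σ⁻¹ = i) (hj : v.move σ⁻¹ = j) (_ : i = x) (_ : j = y)
        (t : Splits z i j), A.fprod h s φ ψ (A.conc h t ((A.bar p).map σ⁻¹ hi a)
          ((A.bar q).map σ⁻¹ hj b)) =
        φ ((A.bar p).map σ⁻¹ (move_symm hx) a) * ψ ((A.bar q).map σ⁻¹ (move_symm hy) b) := by
      intro i j hi hj ei ej t
      subst ei; subst ej
      rw [A.fprod_same]
    exact gen _ _ rfl rfl (move_symm hx) (move_symm hy) r'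
  · rw [A.fprod_ne h' s' r e, A.fprod_ne h s r']
    intro e'
    apply e
    obtain ⟨e₁, e₂⟩ := Prod.mk.inj e'
    have f₁ : (u.move σ⁻¹).move σ = u := by
      have := move_symm (x := u) (σ := σ⁻¹) rfl
      rwa [inv_inv] at this
    have f₂ : (v.move σ⁻¹).move σ = v := by
      have := move_symm (x := v) (σ := σ⁻¹) rfl
      rwa [inv_inv] at this
    rw [← f₁, ← f₂, e₁, e₂, hx, hy]

theorem TwAlg.counit_fprod (A : TwAlg k) {q n : ℕ} (h : q + 0 = n) (hn : q = n) {x z : Lab}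
    (hx : Lab.nil = x) (s : Splits z x z) (ψ : Module.Dual k ((A.bar q).obj z))
    (v : (A.bar n).obj z) :
    A.fprod (p := 0) h s (Species.counit (x := x)) ψ v = ψ (A.castBar hn.symm z v) := by
  subst hn
  cases hx
  have e := A.fprod_same (p := 0) h s s (Species.counit (x := Lab.nil)) ψ A.bone v
  rw [A.conc_bone] at e
  rw [e]
  have : Species.counit (x := Lab.nil) A.bone = (1 : k) := by
    refine (Finsupp.linearCombination_single k (1 : k) _).trans ?_
    simp
  exact (congrArg (· * ψ v) this).trans (_root_.one_mul _)

theorem TwAlg.fprod_counit (A : TwAlg k) {p n : ℕ} (h : 0 + p = n) (hn : p = n) {x z : Lab}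
    (hx : Lab.nil = x) (s : Splits z z x) (φ : Module.Dual k ((A.bar p).obj z))
    (v : (A.bar n).obj z) :
    A.fprod (q := 0) h s φ (Species.counit (x := x)) v = φ (A.castBar hn.symm z v) := by
  subst hn
  cases hx
  have e := A.fprod_same (q := 0) h s s φ (Species.counit (x := Lab.nil)) v A.bone
  rw [A.conc_right_bone] at e
  rw [e]
  have : Species.counit (x := Lab.nil) A.bone = (1 : k) := by
    refine (Finsupp.linearCombination_single k (1 : k) _).trans ?_
    simp
  exact (congrArg (φ v * ·) this).trans (_root_.mul_one _)

theorem nil_eq_dual : Lab.nil = Lab.nil.dual := rfl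

/-- The graded dual of the diagonal part `⨁ₙ (s A₁)^{⊗ n}` of the bar construction (syzygy degree
equal to the weight), with the product dual to the deconcatenation coproduct, including the Koszul
sign `(φ ⊗ ψ)(v ⊗ w) = (-1)^{|ψ| |v|} φ(v) ψ(w)`. -/
noncomputable def TwAlg.barDual (A : TwAlg k) : TwAlg k where
  obj x := Module.Dual k ((A.bar x.wt).obj x.dual)
  map σ _ _ h := A.fmap σ (wt_move h) (dual_move h)
  map_id σ x h hs a := A.fmap_id σ (dual_move h) hs a
  map_comp σ τ x y z h h' h'' a := A.fmap_comp σ τ _ _ _ _ _ _ a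
  mul {z x y} s := sg k ((x.deg : ZMod 2) * (y.deg : ZMod 2)) • A.fprod s.wt' s.dual
  one := Species.counit (k := k) (x := Lab.nil.dual)
  one_mul {x} s a := by
    refine LinearMap.ext fun v => ?_
    have h : sg k ((Lab.nil.deg : ZMod 2) * (x.deg : ZMod 2)) = 1 := by simp [Lab.nil, sg]
    rw [h, one_smul]
    exact A.counit_fprod s.wt' rfl nil_eq_dual s.dual a v
  mul_one {x} s a := by
    refine LinearMap.ext fun v => ?_
    have h : sg k ((x.deg : ZMod 2) * (Lab.nil.deg : ZMod 2)) = 1 := by simp [Lab.nil, sg]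
    rw [h, one_smul]
    exact A.fprod_counit s.wt' rfl nil_eq_dual s.dual a v
  mul_assoc {x y z xy yz t} s₁ s₂ s₃ s₄ a b c := by
    simp only [LinearMap.smul_apply, map_smul, smul_smul, ← sg_add]
    rw [A.fprod_assoc s₁.wt' s₂.wt' s₃.wt' s₄.wt' s₁.dual s₂.dual s₃.dual s₄.dual, ← s₁.deg,
      ← s₃.deg]
    congr 2
    push_cast
    ring
  map_mul σ x y z x' y' z' s s' hx hy hz a b := by
    simp only [LinearMap.smul_apply, map_smul]
    rw [A.fmap_fprod σ s.wt' s'.wt' (wt_move hx) (wt_move hy) (wt_move hz) s.dual s'.dual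
      (dual_move hx) (dual_move hy) (dual_move hz)]
    have e₁ : x.deg = x'.deg := by subst hx; rfl
    have e₂ : y.deg = y'.deg := by subst hy; rfl
    rw [e₁, e₂]

/-- A functional vanishing on cycles factors through the differential. -/
theorem TwAlg.exists_eq_comp_bd (A : TwAlg k) {n : ℕ} {z : Lab}
    {φ : Module.Dual k ((A.bar (n + 1)).obj z)}
    (hφ : φ ∈ (A.cycles (n + 1) z).dualAnnihilator) :
    ∃ φ' : Module.Dual k ((A.bar n).obj z), φ = φ'.comp (A.bd n z) := by
  have h : φ ∈ LinearMap.range (A.bd n z).dualMap := by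
    rw [LinearMap.range_dualMap_eq_dualAnnihilator_ker]
    exact hφ
  obtain ⟨φ', h⟩ := h
  exact ⟨φ', h.symm⟩

theorem TwAlg.fprod_annihilator_left (A : TwAlg k) {p q n : ℕ} (h : q + p = n) {z x y : Lab}
    (s : Splits z x y) (hy : y.wt = q) {φ : Module.Dual k ((A.bar p).obj x)}
    (ψ : Module.Dual k ((A.bar q).obj y)) (hφ : φ ∈ (A.cycles p x).dualAnnihilator) :
    A.fprod h s φ ψ ∈ (A.cycles n z).dualAnnihilator := by
  cases p with
  | zero =>
    have : φ = 0 := by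
      ext v
      exact (Submodule.mem_dualAnnihilator _).1 hφ v trivial
    rw [this, map_zero, LinearMap.zero_apply]
    exact Submodule.zero_mem _
  | succ p =>
    obtain ⟨φ', rfl⟩ := A.exists_eq_comp_bd hφ
    obtain ⟨n, rfl⟩ : ∃ m, n = m + 1 := ⟨q + p, by omega⟩
    rw [A.fprod_bd_left (by omega) h s hy, Submodule.mem_dualAnnihilator]
    intro v hv
    have hv' : A.bd n z v = 0 := hv
    rw [LinearMap.comp_apply, hv', map_zero]

theorem TwAlg.fprod_annihilator_right (A : TwAlg k) {p q n : ℕ} (h : q + p = n) {z x y : Lab}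
    (s : Splits z x y) (hx : x.wt = p) (φ : Module.Dual k ((A.bar p).obj x))
    {ψ : Module.Dual k ((A.bar q).obj y)} (hψ : ψ ∈ (A.cycles q y).dualAnnihilator) :
    A.fprod h s φ ψ ∈ (A.cycles n z).dualAnnihilator := by
  cases q with
  | zero =>
    have : ψ = 0 := by
      ext v
      exact (Submodule.mem_dualAnnihilator _).1 hψ v trivial
    rw [this, map_zero]
    exact Submodule.zero_mem _
  | succ q =>
    obtain ⟨ψ', rfl⟩ := A.exists_eq_comp_bd hψ
    obtain ⟨n, rfl⟩ : ∃ m, n = m + 1 := ⟨q + p, by omega⟩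
    rw [A.fprod_bd_right (by omega) h s hx, Submodule.mem_dualAnnihilator]
    intro v hv
    have hv' : A.bd n z v = 0 := hv
    rw [LinearMap.smul_apply, LinearMap.comp_apply, hv', map_zero, smul_zero]

theorem TwAlg.bd_map (A : TwAlg k) (σ : Equiv.Perm ℕ) : ∀ (n : ℕ) {z z' : Lab}
    (h : z.move σ = z') (v : (A.bar (n + 1)).obj z),
    A.bd n z' ((A.bar (n + 1)).map σ h v) = (A.bar n).map σ h (A.bd n z v)
  | 0, z, z', h, v => (map_zero ((A.bar 0).map σ h)).symm
  | n + 1, z, z', h, v => by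
    subst h
    have key : (A.bd (n + 1) (z.move σ)).comp ((A.bar (n + 2)).map σ rfl) =
        ((A.bar (n + 1)).map σ rfl).comp (A.bd (n + 1) z) := by
      apply A.bar_ext
      intro x y s a v
      simp only [LinearMap.comp_apply]
      rw [A.bar_map_bten (n + 1) σ rfl s (s.move σ) rfl rfl, A.bd_bten, A.bd_bten, map_smul,
        map_sub, A.bd_map σ n rfl v, A.bar_map_bten n σ rfl s (s.move σ) rfl rfl]
      have key₂ : (A.bmerge n (s.move σ) (A.aug.map σ rfl a)).comp
          ((A.bar (n + 1)).map σ rfl) = ((A.bar (n + 1)).map σ rfl).comp (A.bmerge n s a) := by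
        apply A.bar_ext
        intro i j t b w
        simp only [LinearMap.comp_apply]
        rw [A.bar_map_bten n σ rfl t (t.move σ) rfl rfl, A.bmerge_bten, A.bmerge_bten]
        have e : (x.join i).move σ = (x.move σ).join (i.move σ) := by
          ext1
          · exact Finset.map_union _ _
          · rfl
          · rfl
        rw [A.bar_map_bten n σ rfl (s.outer t) ((s.move σ).outer (t.move σ)) e rfl]
        congr 2
        exact Subtype.ext (A.map_mul σ (s.inner t) ((s.move σ).inner (t.move σ)) rfl rfl e
          a.1 b.1).symm
      have := LinearMap.congr_fun key₂ v
      simp only [LinearMap.comp_apply] at this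
      rw [this]
      rfl
    exact LinearMap.congr_fun key v

theorem TwAlg.fmap_annihilator (A : TwAlg k) (σ : Equiv.Perm ℕ) {m n : ℕ} (hn : m = n)
    {x y : Lab} (h : x.move σ = y) {φ : Module.Dual k ((A.bar m).obj x)}
    (hφ : φ ∈ (A.cycles m x).dualAnnihilator) :
    A.fmap σ hn h φ ∈ (A.cycles n y).dualAnnihilator := by
  subst hn
  rw [Submodule.mem_dualAnnihilator] at hφ ⊢
  intro v hv
  rw [A.fmap_apply]
  apply hφ
  cases m with
  | zero => trivial
  | succ m =>
    have hv' : A.bd m y v = 0 := hv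
    change A.bd m x _ = 0
    rw [A.bd_map, hv', map_zero]

/-- The functionals vanishing on the Koszul dual comonoid, i.e. on the diagonal cycles. -/
noncomputable def TwAlg.dualIdeal (A : TwAlg k) : TwIdeal A.barDual where
  carrier x := (A.cycles x.wt x.dual).dualAnnihilator
  map_mem σ _ _ h _ ha := A.fmap_annihilator σ (wt_move h) (dual_move h) ha
  mul_mem_left s a _ hb := Submodule.smul_mem _ _
    (A.fprod_annihilator_right s.wt' s.dual rfl a hb)
  mul_mem_right s _ b ha := Submodule.smul_mem _ _
    (A.fprod_annihilator_left s.wt' s.dual rfl b ha)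

/-- The graded dual `(A^¡)^*` of the Koszul dual comonoid `A^¡`. The comonoid `A^¡` is the
diagonal part of the homology of the bar construction; since there are no diagonal boundaries, it
is the subcomonoid of diagonal cycles, and its dual is the quotient of the dual of the diagonal
part of the bar construction by the functionals vanishing on it (see `dualEquiv`). -/
noncomputable def TwAlg.dualAlg (A : TwAlg k) : TwAlg k := A.barDual.quot A.dualIdeal

theorem TwAlg.boundaries_eq_bot (A : TwAlg k) {n : ℕ} {z : Lab} (h : z.wt ≤ n) :
    A.boundaries n z = ⊥ := by
  rw [TwAlg.boundaries, LinearMap.range_eq_bot]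
  ext v
  rw [A.bar_eq_zero (n + 1) (by omega) v, map_zero, map_zero]

/-- The components of `A.dualAlg` are the duals of the diagonal components of the homology of
the bar construction. -/
noncomputable def TwAlg.dualEquiv (A : TwAlg k) (x : Lab) :
    A.dualAlg.obj x ≃ₗ[k] Module.Dual k (A.barHomology x.wt x.dual) :=
  (Subspace.quotAnnihilatorEquiv (A.cycles x.wt x.dual)).trans
    (Submodule.quotEquivOfEqBot _ (by
      rw [A.boundaries_eq_bot (n := x.wt) (z := x.dual) (le_refl _), Submodule.submoduleOf, Submodule.comap_bot]
      exact Submodule.ker_subtype _)).dualMap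

end

/-! ### Suspension -/

section
variable {k : Type u} [Field k]

/-- Parity of the number of pairs in `I` whose order is reversed by `σ`. -/
def inv (σ : Equiv.Perm ℕ) (I : Finset ℕ) : ZMod 2 :=
  ∑ i ∈ I, ∑ j ∈ I, if i < j ∧ σ j < σ i then 1 else 0

/-- Parity of the number of pairs `(j, i) ∈ J × I` with `i < j`. -/
def cross (J I : Finset ℕ) : ZMod 2 := ∑ j ∈ J, ∑ i ∈ I, if i < j then 1 else 0

theorem cross_union_left {I J K : Finset ℕ} (h : Disjoint I J) :
    cross (I ∪ J) K = cross I K + cross J K := by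
  unfold cross
  rw [Finset.sum_union h]

theorem cross_union_right {I J K : Finset ℕ} (h : Disjoint J K) :
    cross I (J ∪ K) = cross I J + cross I K := by
  unfold cross
  rw [← Finset.sum_add_distrib]
  exact Finset.sum_congr rfl fun i _ => Finset.sum_union h

theorem inv_union (σ : Equiv.Perm ℕ) {I J : Finset ℕ} (h : Disjoint I J) :
    cross (I.map σ.toEmbedding) (J.map σ.toEmbedding) + inv σ I + inv σ J =
      inv σ (I ∪ J) + cross I J := by
  have h1 : inv σ (I ∪ J) = inv σ I + inv σ J +
      ∑ i ∈ I, ∑ j ∈ J, ((if i < j ∧ σ j < σ i then (1 : ZMod 2) else 0) +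
        (if j < i ∧ σ i < σ j then 1 else 0)) := by
    unfold inv
    rw [Finset.sum_union h]
    simp only [Finset.sum_union h, Finset.sum_add_distrib]
    rw [Finset.sum_comm (s := I) (t := J)
      (f := fun i j => if j < i ∧ σ i < σ j then (1 : ZMod 2) else 0)]
    ring
  have h2 : cross (I.map σ.toEmbedding) (J.map σ.toEmbedding) =
      ∑ i ∈ I, ∑ j ∈ J, (((if i < j ∧ σ j < σ i then (1 : ZMod 2) else 0) +
        (if j < i ∧ σ i < σ j then 1 else 0)) + if j < i then 1 else 0) := by
    unfold cross
    simp only [Finset.sum_map]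
    refine Finset.sum_congr rfl fun i hi => Finset.sum_congr rfl fun j hj => ?_
    have hij : i ≠ j := fun e => (Finset.disjoint_left.1 h) hi (e ▸ hj)
    have hσ : σ i ≠ σ j := fun e => hij (σ.injective e)
    simp only [Equiv.coe_toEmbedding]
    rcases lt_or_gt_of_ne hij with h1 | h1 <;> rcases lt_or_gt_of_ne hσ with h2 | h2 <;>
      simp [h1, h2, not_lt_of_gt h1, not_lt_of_gt h2]
    decide
  rw [h1, h2]
  simp only [Finset.sum_add_distrib]
  unfold cross
  ring

theorem inv_comp (σ τ : Equiv.Perm ℕ) (I : Finset ℕ) :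
    inv (τ * σ) I = inv σ I + inv τ (I.map σ.toEmbedding) := by
  induction I using Finset.induction_on with
  | empty => simp [inv]
  | insert a I ha ih =>
    have hd : Disjoint {a} I := Finset.disjoint_singleton_left.2 ha
    have hd' : Disjoint (Finset.map σ.toEmbedding {a}) (Finset.map σ.toEmbedding I) :=
      (Finset.disjoint_map _).2 hd
    have e1 := inv_union σ hd
    have e2 := inv_union (τ * σ) hd
    have e3 := inv_union τ hd'
    have s0 : ∀ (ρ : Equiv.Perm ℕ) (b : ℕ), inv ρ {b} = 0 := by
      intro ρ b
      simp only [inv, Finset.sum_singleton, lt_irrefl, false_and, if_false]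
    have s1 : inv τ (Finset.map σ.toEmbedding {a}) = 0 := by
      rw [Finset.map_singleton]; exact s0 _ _
    have m : ∀ J : Finset ℕ, (J.map σ.toEmbedding).map τ.toEmbedding =
        J.map (τ * σ).toEmbedding := by
      intro J; rw [Finset.map_map]; rfl
    rw [m, m, ← Finset.map_union, s1] at e3
    rw [s0] at e1 e2
    rw [ih] at e2
    rw [Finset.insert_eq]
    linear_combination e1 + e3 - e2

namespace Lab

/-- The label of the elements of `A` giving rise to elements of label `x` of the twist. -/
def shift (x : Lab) : Lab := ⟨x.supp, x.deg - x.supp.card, x.wt⟩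

end Lab

theorem Splits.shift {z x y : Lab} (s : Splits z x y) : Splits z.shift x.shift y.shift where
  disj := s.disj
  supp := s.supp
  deg := by
    have h := Finset.card_union_of_disjoint s.disj
    rw [s.supp] at h
    have := s.deg
    simp only [Lab.shift]
    omega
  wt := s.wt

theorem shift_move {x y : Lab} {σ : Equiv.Perm ℕ} (h : x.move σ = y) :
    x.shift.move σ = y.shift := by
  subst h
  ext1
  · rfl
  · simp [Lab.shift, Lab.move]
  · rfl

/-- The twisted associative algebra `I ↦ (k s)^{⊗ I} ⊗ A(I)`, where `s` is a symbol of
degree `1` and the species `I ↦ (k s)^{⊗ I}` is a twisted associative algebra under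
concatenation. An element `a` of `A(I)` stands for `s^I ⊗ a`, where `s^I` is the product of the
symbols `s_i` in increasing order; all signs come from the Koszul rule. -/
def TwAlg.twist (A : TwAlg k) : TwAlg k where
  obj x := A.obj x.shift
  map σ {x _} h := sg k (inv σ x.supp) • A.map σ (shift_move h)
  map_id σ x h hs a := by
    have e : inv σ x.supp = 0 := by
      unfold inv
      refine Finset.sum_eq_zero fun i hi => Finset.sum_eq_zero fun j hj => ?_
      rw [hs i hi, hs j hj, if_neg]
      omega
    rw [e, sg_zero, one_smul, A.map_id σ (shift_move h) hs]
  map_comp σ τ x y z h h' h'' a := by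
    subst h
    simp only [LinearMap.smul_apply, map_smul, smul_smul, ← sg_add]
    rw [A.map_comp σ τ _ _ (shift_move h''), inv_comp]
    congr 2
  mul {z x y} s := sg k ((x.shift.deg : ZMod 2) * (y.supp.card : ZMod 2) + cross x.supp y.supp) •
    A.mul s.shift
  one := A.one
  one_mul {x} s a := by
    have e : sg k ((Lab.nil.shift.deg : ZMod 2) * (x.supp.card : ZMod 2) +
        cross Lab.nil.supp x.supp) = 1 := by
      simp [Lab.nil, Lab.shift, cross, sg]
    rw [e, one_smul]
    exact A.one_mul s.shift a
  mul_one {x} s a := by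
    have e : sg k ((x.shift.deg : ZMod 2) * (Lab.nil.supp.card : ZMod 2) +
        cross x.supp Lab.nil.supp) = 1 := by
      simp [Lab.nil, cross, sg]
    rw [e, one_smul]
    exact A.mul_one s.shift a
  mul_assoc {x y z xy yz t} s₁ s₂ s₃ s₄ a b c := by
    simp only [LinearMap.smul_apply, map_smul, smul_smul, ← sg_add]
    rw [A.mul_assoc s₁.shift s₂.shift s₃.shift s₄.shift, ← s₁.shift.deg,
      ← s₁.supp, ← s₃.supp, cross_union_left s₁.disj, cross_union_right s₃.disj,
      Finset.card_union_of_disjoint s₃.disj]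
    congr 2
    push_cast
    ring
  map_mul σ x y z x' y' z' s s' hx hy hz a b := by
    subst hx; subst hy; subst hz
    simp only [LinearMap.smul_apply, map_smul, smul_smul, ← sg_add]
    rw [A.map_mul σ s.shift s'.shift (shift_move rfl) (shift_move rfl) (shift_move rfl)]
    congr 2
    have e := inv_union σ s.disj
    rw [s.supp] at e
    have c : (y.move σ).supp.card = y.supp.card := Finset.card_map _
    have d : (x.move σ).shift.deg = x.shift.deg := by simp [Lab.shift, Lab.move]
    rw [c, d]
    have e' : cross (x.move σ).supp (y.move σ).supp + inv σ x.supp + inv σ y.supp =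
      inv σ z.supp + cross x.supp y.supp := e
    linear_combination -e'

end

/-! ### Free algebras -/

section

/-- A collection of fully symmetric generators: for each `g : ι` and each arity `n` with
`has g n`, there is a generator of arity `n`, of degree `deg g` and of weight `1`, spanning the
trivial representation of the symmetric group. The corresponding element with set of
arguments `I`, where `has g I.card`, is denoted `(g, I)` below. -/
structure SymGens (ι : Type) where
  has : ι → ℕ → Prop
  deg : ι → ℤ

/-- The monomials `(g₁, I₁) ⋯ (gₙ, Iₙ)` of label `x`, where `I₁ ⊔ ⋯ ⊔ Iₙ = x.supp`. -/
structure IsWord {ι : Type} (G : SymGens ι) (l : List (ι × Finset ℕ)) (x : Lab) : Prop where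
  has : ∀ a ∈ l, G.has a.1 a.2.card
  disj : l.Pairwise (fun a b => Disjoint a.2 b.2)
  supp : ∀ i, i ∈ x.supp ↔ ∃ a ∈ l, i ∈ a.2
  deg : (l.map (fun a => G.deg a.1)).sum = x.deg
  wt : l.length = x.wt

theorem IsWord.nil {ι : Type} (G : SymGens ι) : IsWord G [] Lab.nil where
  has := by simp
  disj := List.Pairwise.nil
  supp := by simp [Lab.nil]
  deg := rfl
  wt := rfl

theorem IsWord.append {ι : Type} {G : SymGens ι} {l m : List (ι × Finset ℕ)} {x y z : Lab}
    (hl : IsWord G l x) (hm : IsWord G m y) (s : Splits z x y) : IsWord G (l ++ m) z where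
  has a ha := (List.mem_append.1 ha).elim (hl.has a) (hm.has a)
  disj := by
    rw [List.pairwise_append]
    refine ⟨hl.disj, hm.disj, fun a ha b hb => ?_⟩
    refine Finset.disjoint_left.2 fun i hi hi' => ?_
    exact Finset.disjoint_left.1 s.disj ((hl.supp i).2 ⟨a, ha, hi⟩) ((hm.supp i).2 ⟨b, hb, hi'⟩)
  supp i := by
    rw [← s.supp, Finset.mem_union, hl.supp, hm.supp]
    constructor
    · rintro (⟨a, ha, hi⟩ | ⟨a, ha, hi⟩)
      · exact ⟨a, List.mem_append_left _ ha, hi⟩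
      · exact ⟨a, List.mem_append_right _ ha, hi⟩
    · rintro ⟨a, ha, hi⟩
      exact (List.mem_append.1 ha).imp (fun h => ⟨a, h, hi⟩) (fun h => ⟨a, h, hi⟩)
  deg := by rw [List.map_append, List.sum_append, hl.deg, hm.deg, s.deg]
  wt := by rw [List.length_append, hl.wt, hm.wt, s.wt]

/-- Relabelling of monomials. -/
def relabel {ι : Type} (σ : Equiv.Perm ℕ) (l : List (ι × Finset ℕ)) :
    List (ι × Finset ℕ) := l.map (fun a => (a.1, a.2.map σ.toEmbedding))

theorem IsWord.relabel {ι : Type} {G : SymGens ι} {l : List (ι × Finset ℕ)} {x y : Lab}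
    (hl : IsWord G l x) {σ : Equiv.Perm ℕ} (h : x.move σ = y) :
    IsWord G (Tw.relabel σ l) y where
  has a ha := by
    obtain ⟨b, hb, rfl⟩ := List.mem_map.1 ha
    simpa using hl.has b hb
  disj := by
    unfold Tw.relabel
    rw [List.pairwise_map]
    exact hl.disj.imp (fun hab => (Finset.disjoint_map _).2 hab)
  supp i := by
    subst h
    simp only [Lab.move, Tw.relabel, Finset.mem_map_equiv, hl.supp, List.mem_map]
    constructor
    · rintro ⟨a, ha, hi⟩
      exact ⟨_, ⟨a, ha, rfl⟩, Finset.mem_map_equiv.2 hi⟩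
    · rintro ⟨_, ⟨a, ha, rfl⟩, hi⟩
      exact ⟨a, ha, Finset.mem_map_equiv.1 hi⟩
  deg := by
    subst h
    rw [Tw.relabel, List.map_map]
    exact hl.deg
  wt := by
    subst h
    rw [Tw.relabel, List.length_map]
    exact hl.wt

/-- The monomials of a given label. -/
abbrev Word {ι : Type} (G : SymGens ι) (x : Lab) : Type := {l : List (ι × Finset ℕ) // IsWord G l x}

/-- Concatenation of monomials. -/
def Word.append {ι : Type} {G : SymGens ι} {x y z : Lab} (s : Splits z x y) (l : Word G x) (m : Word G y) :
    Word G z := ⟨l.1 ++ m.1, l.2.append m.2 s⟩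

/-- Relabelling of monomials. -/
def Word.relabel {ι : Type} {G : SymGens ι} {x y : Lab} (σ : Equiv.Perm ℕ) (h : x.move σ = y) (l : Word G x) :
    Word G y := ⟨Tw.relabel σ l.1, l.2.relabel h⟩

variable (k : Type u) [Field k]

/-- The product of a free algebra: concatenation of monomials. -/
noncomputable def freeMul {ι : Type} (G : SymGens ι) {x y z : Lab} (s : Splits z x y) :
    (Word G x →₀ k) →ₗ[k] (Word G y →₀ k) →ₗ[k] (Word G z →₀ k) :=
  Finsupp.linearCombination k (fun l => Finsupp.lmapDomain k k (Word.append s l))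

theorem freeMul_single {ι : Type} (G : SymGens ι) {x y z : Lab} (s : Splits z x y) (l : Word G x)
    (m : Word G y) :
    freeMul k G s (Finsupp.single l 1) (Finsupp.single m 1) =
      Finsupp.single (Word.append s l m) 1 := by
  simp [freeMul, Finsupp.mapDomain_single]

/-- The free twisted associative algebra on a collection of fully symmetric generators. -/
noncomputable def free {ι : Type} (G : SymGens ι) : TwAlg k where
  obj x := Word G x →₀ k
  map σ x y h := Finsupp.lmapDomain k k (Word.relabel σ h)
  map_id σ x h hs a := by
    have : Word.relabel (G := G) σ h = id := by
      funext l
      apply Subtype.ext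
      change Tw.relabel σ l.1 = l.1
      conv_rhs => rw [← List.map_id l.1]
      refine List.map_congr_left fun a ha => Prod.ext rfl ?_
      change a.2.map σ.toEmbedding = a.2
      have hσ : ∀ i ∈ a.2, σ i = i := fun i hi => hs i ((l.2.supp i).2 ⟨a, ha, hi⟩)
      ext i
      simp only [Finset.mem_map, Equiv.coe_toEmbedding]
      constructor
      · rintro ⟨j, hj, rfl⟩; rwa [hσ j hj]
      · intro hi; exact ⟨i, hi, hσ i hi⟩
    rw [Finsupp.lmapDomain_apply, this, Finsupp.mapDomain_id]
  map_comp σ τ x y z h h' h'' a := by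
    simp only [Finsupp.lmapDomain_apply, ← Finsupp.mapDomain_comp]
    congr 1
    funext l
    apply Subtype.ext
    change Tw.relabel τ (Tw.relabel σ l.1) = Tw.relabel (τ * σ) l.1
    unfold Tw.relabel
    rw [List.map_map]
    refine List.map_congr_left fun a _ => Prod.ext rfl ?_
    exact Finset.map_map _ _ _
  mul s := freeMul k G s
  one := Finsupp.single ⟨[], IsWord.nil G⟩ 1
  one_mul s a := by
    have : freeMul k G s (Finsupp.single ⟨[], IsWord.nil G⟩ 1) = LinearMap.id := by
      ext l : 2
      exact freeMul_single k G s _ _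
    rw [this]; rfl
  mul_one {x} s a := by
    have : (freeMul k G s).flip (Finsupp.single ⟨[], IsWord.nil G⟩ 1) = LinearMap.id := by
      ext l : 2
      refine (freeMul_single k G s _ _).trans ?_
      congr 1
      exact Subtype.ext (List.append_nil l.1)
    exact LinearMap.congr_fun this a
  mul_assoc {x y z xy yz t} s₁ s₂ s₃ s₄ a b c := by
    induction a using Finsupp.induction_linear with
    | zero => simp
    | add a a' ha ha' => simp only [map_add, LinearMap.add_apply, ha, ha']
    | single l r =>
    induction b using Finsupp.induction_linear with
    | zero => simp
    | add a a' ha ha' => simp only [map_add, LinearMap.add_apply, ha, ha']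
    | single m r' =>
    induction c using Finsupp.induction_linear with
    | zero => simp
    | add a a' ha ha' => simp only [map_add, ha, ha']
    | single n r'' =>
    rw [← mul_one r, ← mul_one r', ← mul_one r'', ← smul_eq_mul, ← smul_eq_mul, ← smul_eq_mul,
      ← Finsupp.smul_single, ← Finsupp.smul_single, ← Finsupp.smul_single]
    simp only [map_smul, LinearMap.smul_apply, freeMul_single]
    congr 4
    exact Subtype.ext (List.append_assoc _ _ _)
  map_mul σ x y z x' y' z' s s' hx hy hz a b := by
    induction a using Finsupp.induction_linear with
    | zero => simp
    | add a a' ha ha' => simp only [map_add, LinearMap.add_apply, ha, ha']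
    | single l r =>
    induction b using Finsupp.induction_linear with
    | zero => simp
    | add a a' ha ha' => simp only [map_add, ha, ha']
    | single m r' =>
    rw [← mul_one r, ← mul_one r', ← smul_eq_mul, ← smul_eq_mul,
      ← Finsupp.smul_single, ← Finsupp.smul_single]
    simp only [map_smul, LinearMap.smul_apply, freeMul_single, Finsupp.lmapDomain_apply,
      Finsupp.mapDomain_single]
    congr 3
    exact Subtype.ext (List.map_append (f := fun a : ι × Finset ℕ =>
      (a.1, a.2.map σ.toEmbedding)) (l₁ := l.1) (l₂ := m.1))

open Classical in
/-- The monomial `l` as an element of the component `x` of the free algebra; it is `0` if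
`l` is not a monomial of label `x`. -/
noncomputable def mono {ι : Type} (G : SymGens ι) (l : List (ι × Finset ℕ)) (x : Lab) : (free k G).obj x :=
  if h : IsWord G l x then Finsupp.single (⟨l, h⟩ : Word G x) 1 else 0

/-! ### The algebras -/

/-- The generators `m_t^{2p}`, `t ≥ 1`, `p ≥ 0`, of the extended Losev–Manin algebra; `m_t^{2p}` is
of arity `t` and of degree `2 p`. -/
def lmGens : SymGens ℕ where
  has _ t := 1 ≤ t
  deg p := 2 * p

/-- The relator of degree `2 D`
`∑ (m_I^{2p} m_J^{2q} - m_J^{2q} m_I^{2p})` (sum over `N = I ⊔ J` with `i ∈ I`, `j ∈ J` and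
over `p + q = D`) of the extended Losev–Manin algebra, where `N = x.supp`. -/
noncomputable def lmRel (x : Lab) (i j D : ℕ) : (free k lmGens).obj x :=
  ∑ I ∈ x.supp.powerset with i ∈ I ∧ j ∉ I, ∑ pq ∈ Finset.HasAntidiagonal.antidiagonal D,
    (mono k lmGens [(pq.1, I), (pq.2, x.supp \ I)] x -
      mono k lmGens [(pq.2, x.supp \ I), (pq.1, I)] x)

/-- The extended Losev–Manin algebra `tHC`. -/
noncomputable def tHC : TwAlg k :=
  (free k lmGens).quot (TwIdeal.span _ (fun x =>
    {r | ∃ i ∈ x.supp, ∃ j ∈ x.supp, ∃ D : ℕ, i ≠ j ∧ r = lmRel k x i j D}))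

/-- The generator `m_I^{2p}` of `tHC`, where `I = x.supp`, as an element of the component of
label `x` (it is `0` unless `x = ⟨I, 2 p, 1⟩` with `I` non-empty). -/
noncomputable def tHCgen (p : ℕ) (x : Lab) : (tHC k).obj x :=
  (free k lmGens).toQuot _ x (mono k lmGens [(p, x.supp)] x)

/-- The algebra `tHyperCom_κ`: the quotient of `tHC` by the ideal generated by all `m_t^{2m}` with
`t ≠ 1 + m (κ - 1)`. -/
noncomputable def tHyperCom (κ : ℕ) : TwAlg k :=
  (tHC k).quot (TwIdeal.span _ (fun x =>
    {r | ∃ m : ℕ, x.supp.card ≠ 1 + m * (κ - 1) ∧ r = tHCgen k m x}))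

/-- The generators `g_{1 + m (κ - 1)}`, `m ≥ 0`, of degree `1 + 2 m (κ - 2)`. -/
def gravGens (κ : ℕ) : SymGens ℕ where
  has m t := t = 1 + m * (κ - 1)
  deg m := 1 + 2 * m * ((κ : ℤ) - 2)

/-- The twisted associative algebra with generators `g_{1 + m (κ - 1)}` and the gravity relations:
`∑_{i ∈ I} g_{i} g_{N ∖ i} = g_I g_J` for `N = I ⊔ J` with `|I| = 1 + m (κ - 1)`, `m > 0` and
`|J| = 1 + m' (κ - 1)`, and `∑_{i ∈ N} g_{i} g_{N ∖ i} = 0` for `|N| = 2 + D (κ - 1)`. -/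
noncomputable def tGrav (κ : ℕ) : TwAlg k :=
  (free k (gravGens κ)).quot (TwIdeal.span _ (fun x =>
    {r | ∃ (m m' : ℕ) (I J : Finset ℕ), Disjoint I J ∧ I ∪ J = x.supp ∧ 0 < m ∧
        I.card = 1 + m * (κ - 1) ∧ J.card = 1 + m' * (κ - 1) ∧
        r = ∑ i ∈ I, mono k (gravGens κ) [(0, {i}), (m + m', x.supp \ {i})] x -
          mono k (gravGens κ) [(m, I), (m', J)] x} ∪
    {r | ∃ D : ℕ, x.supp.card = 2 + D * (κ - 1) ∧
        r = ∑ i ∈ x.supp, mono k (gravGens κ) [(0, {i}), (D, x.supp \ {i})] x}))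

/-- The Koszul dual twisted associative algebra `A^! (I) = (k s)^{⊗ I} ⊗ (A^¡(I))^*`. -/
noncomputable def TwAlg.koszulDual {k : Type u} [Field k] (A : TwAlg k) : TwAlg k :=
  A.dualAlg.twist

/-- The value of a twisted associative algebra on a finite set: the sum of its components over all
degrees and weights. -/
abbrev TwAlg.value {k : Type u} [Field k] (A : TwAlg k) (I : Finset ℕ) : Type u :=
  DirectSum (ℤ × ℕ) (fun e => A.obj ⟨I, e.1, e.2⟩)

end

end Tw

/-! Once the generators that it kills are discarded, `tHyperCom k κ` is the quotient of the free
algebra on letters `(p, I)` with `|I| = 1 + p (κ - 1)` by quadratic relations. For two points `i`,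
`j`, the coefficient of `(p, I) (q, J)` in the relator is the determinant `[i ∈ I][j ∈ J] - [j ∈
I][i ∈ J]` (`ofLM_lmRelator`). The relators placed at the letters number `i` and `i + 1` of longer
words span the space `Grav k κ i z` of combinations of words whose coefficients satisfy the gravity
equations at that place (`minor_mem_grav`, `grav_le_span_products`). Thus the relations of the
algebra and the relations of its dual are two descriptions of the same space.

Koszulness comes from a basis of each component of the free algebra that is adapted to all the
spaces `Grav k κ i z` at once, which says that they generate a distributive lattice. A pair of
adjacent letters is bad when the first one is a singleton of index zero whose point exceeds the
minimum of the second one. If all pairs of `U` are bad, take as coefficients of words the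
determinants of their incidence matrices with the minima of the letters of `U`. The determinant is
alternating in its rows and the indicator function of a set is the sum of those of its points, so
the gravity equations hold at every place; and `U` is the leading word. Cutting an arbitrary word
into maximal runs of bad pairs and multiplying these determinants gives the basis
(`exists_leading`). The vectors whose leading word is bad at `i` span `Grav k κ i z`, because an
element of that space is determined by its coefficients at such words (`grav_eq_zero`,
`grav_le_span`).

The part of syzygy degree `n` and weight `w` of the bar construction is the direct sum, over
compositions of `w` with `n` parts, of the words modulo the relations inside the blocks. The
differential merges adjacent blocks. On formal compositions, cutting at a fixed gap is a contracting
homotopy (`merge_split`), but on words it is compatible only with relations at the other gaps. It is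
therefore applied, with the cut at gap `i`, to the basis vectors whose first pair that is not bad is
number `i`. The vectors with no such pair lie in every relation space, so they vanish as soon as
some block has two letters, which is always so off the diagonal
(`GapPres.subsingleton_barHomology`).

On the diagonal all blocks have one letter, and the cycles are the combinations of words satisfying
the gravity equations at all places (`GapPres.diag_mem_cycles`). Dually, the coordinates attached to
words satisfy the gravity relations. These relations express every word through those with all pairs
bad (`GravRel.mem_span`), both in `tGrav` and in the dual; in the dual the determinants above show
that the latter are independent (`linearIndependent_dualCoord`). Hence the natural map from `tGrav`
is an isomorphism. The signs of the two suspensions and of the dual product combine into a sign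
removed by rescaling with `gravSign`.

For `κ > 1`, a word on a non-empty set `N` with all pairs bad is a decreasing sequence of singletons
followed by a letter `J` that contains the minimum of `N`, where `κ - 1` divides `|J| - 1`. It is
determined by `J` without that minimum, which gives the dimensions. -/

namespace Tw

/-! ### Words, their labels and their coefficients. -/

section Words

variable {ι : Type} {G : SymGens ι}

theorem IsWord.label_unique {l : List (ι × Finset ℕ)} {x y : Lab} (hx : IsWord G l x)
    (hy : IsWord G l y) : x = y := by
  ext1
  · ext i; rw [hx.supp, hy.supp]
  · rw [← hx.deg, hy.deg]
  · rw [← hx.wt, hy.wt]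

/-- The label of a list of letters. -/
def labelOf (G : SymGens ι) (l : List (ι × Finset ℕ)) : Lab :=
  ⟨l.foldr (fun a s => a.2 ∪ s) ∅, (l.map (fun a => G.deg a.1)).sum, l.length⟩

theorem mem_labelOf (l : List (ι × Finset ℕ)) (i : ℕ) :
    i ∈ (labelOf G l).supp ↔ ∃ a ∈ l, i ∈ a.2 := by
  simp only [labelOf]
  induction l with
  | nil => simp
  | cons a l ih => simp [ih]

theorem isWord_labelOf {l : List (ι × Finset ℕ)} (h : ∀ a ∈ l, G.has a.1 a.2.card)
    (hd : l.Pairwise (fun a b => Disjoint a.2 b.2)) : IsWord G l (labelOf G l) :=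
  ⟨h, hd, mem_labelOf l, rfl, rfl⟩

theorem IsWord.of_append {l m : List (ι × Finset ℕ)} {z : Lab} (h : IsWord G (l ++ m) z) :
    ∃ x y, Splits z x y ∧ IsWord G l x ∧ IsWord G m y := by
  have hd := List.pairwise_append.1 h.disj
  have hl : IsWord G l (labelOf G l) :=
    isWord_labelOf (fun a ha => h.has a (List.mem_append_left _ ha)) hd.1
  have hm : IsWord G m (labelOf G m) :=
    isWord_labelOf (fun a ha => h.has a (List.mem_append_right _ ha)) hd.2.1
  refine ⟨_, _, ⟨?_, ?_, ?_, ?_⟩, hl, hm⟩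
  · refine Finset.disjoint_left.2 fun i hi hi' => ?_
    obtain ⟨a, ha, hia⟩ := (mem_labelOf l i).1 hi
    obtain ⟨b, hb, hib⟩ := (mem_labelOf m i).1 hi'
    exact Finset.disjoint_left.1 (hd.2.2 a ha b hb) hia hib
  · ext i
    rw [Finset.mem_union, mem_labelOf, mem_labelOf, h.supp]
    simp only [List.mem_append, or_and_right, exists_or]
  · rw [← h.deg]; simp [labelOf]
  · rw [← h.wt]; simp [labelOf]

/-- In a splitting each label is determined by the other two: supports are complements, degrees and
weights can be subtracted. -/
theorem IsWord.left_of_append {l m : List (ι × Finset ℕ)} {x y z : Lab} (s : Splits z x y)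
    (h : IsWord G (l ++ m) z) (hl : IsWord G l x) : IsWord G m y := by
  obtain ⟨x', y', s', hl', hm⟩ := h.of_append
  obtain rfl := hl.label_unique hl'
  have : y' = y := by
    ext1
    · have h1 := s.supp
      rw [← s'.supp] at h1
      ext i
      have := Finset.ext_iff.1 h1 i
      have h2 := s.disj
      have h3 := s'.disj
      rw [Finset.disjoint_left] at h2 h3
      simp only [Finset.mem_union] at this
      have h2 := @h2 i
      have h3 := @h3 i
      tauto
    · have := s.deg; have := s'.deg; omega
    · have := s.wt; have := s'.wt; omega
  rwa [← this]

theorem IsWord.nil_iff {x : Lab} : IsWord G [] x ↔ x = Lab.nil :=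
  ⟨fun h => h.label_unique (IsWord.nil G), fun h => h ▸ IsWord.nil G⟩

variable {k : Type u} [Field k]

open Classical in
/-- The coefficient of a list of letters, which is `0` if it is not a monomial of the label
under consideration. -/
noncomputable def cf {x : Lab} (l : List (ι × Finset ℕ)) : (Word G x →₀ k) →ₗ[k] k :=
  if h : IsWord G l x then Finsupp.lapply ⟨l, h⟩ else 0

theorem cf_of_isWord {x : Lab} {l : List (ι × Finset ℕ)} (h : IsWord G l x)
    (f : Word G x →₀ k) : cf l f = f ⟨l, h⟩ := by
  rw [cf, dif_pos h]; rfl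

theorem cf_of_not_isWord {x : Lab} {l : List (ι × Finset ℕ)} (h : ¬ IsWord G l x)
    (f : Word G x →₀ k) : cf l f = 0 := by
  rw [cf, dif_neg h]; rfl

theorem isWord_of_cf_ne_zero {x : Lab} {l : List (ι × Finset ℕ)} {f : Word G x →₀ k}
    (h : cf l f ≠ 0) : IsWord G l x := by
  by_contra h'
  exact h (cf_of_not_isWord h' f)

theorem cf_word {x : Lab} (W : Word G x) (f : Word G x →₀ k) : cf W.1 f = f W :=
  cf_of_isWord W.2 f

open Classical in
theorem cf_single {x : Lab} (l : List (ι × Finset ℕ)) (W : Word G x) (c : k) :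
    cf l (Finsupp.single W c) = if W.1 = l then c else 0 := by
  by_cases h : IsWord G l x
  · rw [cf_of_isWord h, Finsupp.single_apply]
    simp only [Subtype.ext_iff]
  · rw [cf_of_not_isWord h, if_neg]
    rintro rfl
    exact h W.2

theorem cf_ext {x : Lab} {f g : Word G x →₀ k} (h : ∀ l, cf l f = cf l g) : f = g := by
  ext W
  rw [← cf_word, ← cf_word, h]

theorem cf_of_length_ne {x : Lab} {l : List (ι × Finset ℕ)} (h : l.length ≠ x.wt)
    (f : Word G x →₀ k) : cf l f = 0 :=
  cf_of_not_isWord (fun h' => h h'.wt) f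

theorem word_ext {x : Lab} {M : Type*} [AddCommMonoid M] [Module k M]
    {f g : (Word G x →₀ k) →ₗ[k] M}
    (h : ∀ W : Word G x, f (Finsupp.single W 1) = g (Finsupp.single W 1)) : f = g := by
  ext W : 2
  exact h W

open Classical in
-- All words of label `x` have length `x.wt`, so a concatenation can be cut in only one way. This
-- reduces statements on the coefficients of products to statements on one factor.
theorem cf_freeMul {x y z : Lab} (s : Splits z x y) (f : Word G x →₀ k) (g : Word G y →₀ k)
    (l : List (ι × Finset ℕ)) :
    cf l (freeMul k G s f g) = cf (l.take x.wt) f * cf (l.drop x.wt) g := by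
  have key : (freeMul k G s).compr₂ (cf l) =
      (LinearMap.mul k k).compl₁₂ (cf (l.take x.wt)) (cf (l.drop x.wt)) := by
    apply word_ext
    intro U
    apply word_ext
    intro V
    simp only [LinearMap.compr₂_apply, freeMul_single, LinearMap.compl₁₂_apply,
      LinearMap.mul_apply', cf_single]
    have hU := U.2.wt
    rw [show (Word.append s U V).1 = U.1 ++ V.1 from rfl]
    by_cases h : U.1 ++ V.1 = l
    · subst h
      rw [if_pos rfl, if_pos (by rw [← hU, List.take_left]),
        if_pos (by rw [← hU, List.drop_left]), one_mul]
    · rw [if_neg h]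
      by_cases h1 : U.1 = l.take x.wt
      · by_cases h2 : V.1 = l.drop x.wt
        · exact absurd (by rw [h1, h2, List.take_append_drop]) h
        · rw [if_neg h2, mul_zero]
      · rw [if_neg h1, zero_mul]
  exact LinearMap.congr_fun (LinearMap.congr_fun key f) g

theorem freeMul_assoc {x y z xy yz t : Lab} (s₁ : Splits xy x y)
    (s₂ : Splits t xy z) (s₃ : Splits yz y z) (s₄ : Splits t x yz) (a : Word G x →₀ k)
    (b : Word G y →₀ k) (c : Word G z →₀ k) :
    freeMul k G s₂ (freeMul k G s₁ a b) c = freeMul k G s₄ a (freeMul k G s₃ b c) :=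
  (free k G).mul_assoc s₁ s₂ s₃ s₄ a b c

open Classical in
/-- The monomial `l`, or `0` if `l` is not a monomial of label `x`. -/
noncomputable def wmono (k : Type u) [Field k] (G : SymGens ι) (l : List (ι × Finset ℕ)) (x : Lab) :
    Word G x →₀ k :=
  if h : IsWord G l x then Finsupp.single ⟨l, h⟩ 1 else 0

theorem wmono_of_isWord {l : List (ι × Finset ℕ)} {x : Lab} (h : IsWord G l x) :
    wmono k G l x = Finsupp.single ⟨l, h⟩ 1 := dif_pos h

theorem wmono_of_not_isWord {l : List (ι × Finset ℕ)} {x : Lab} (h : ¬ IsWord G l x) :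
    wmono k G l x = 0 := dif_neg h

open Classical in
theorem cf_wmono (l m : List (ι × Finset ℕ)) (x : Lab) :
    cf l (wmono k G m x) = if m = l ∧ IsWord G m x then 1 else 0 := by
  by_cases h : IsWord G m x
  · rw [wmono_of_isWord h, cf_single]
    simp [h]
  · rw [wmono_of_not_isWord h, if_neg (fun h' => h h'.2), map_zero]

/-- Relabelling in a free algebra. -/
noncomputable def freeMap (k : Type u) [Field k] {ι : Type} (G : SymGens ι) (σ : Equiv.Perm ℕ)
    {x y : Lab} (h : x.move σ = y) : (Word G x →₀ k) →ₗ[k] (Word G y →₀ k) :=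
  Finsupp.lmapDomain k k (Word.relabel σ h)

theorem freeMap_single (σ : Equiv.Perm ℕ) {x y : Lab} (h : x.move σ = y) (W : Word G x) (c : k) :
    freeMap k G σ h (Finsupp.single W c) = Finsupp.single (W.relabel σ h) c :=
  Finsupp.mapDomain_single

theorem relabel_injective (σ : Equiv.Perm ℕ) :
    Function.Injective (relabel (ι := ι) σ) := by
  apply List.map_injective_iff.2
  rintro ⟨a, I⟩ ⟨b, J⟩ h
  simp only [Prod.mk.injEq] at h
  rw [h.1, Finset.map_injective _ h.2]

theorem cf_freeMap (σ : Equiv.Perm ℕ) {x y : Lab} (h : x.move σ = y) (l : List (ι × Finset ℕ))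
    (f : Word G x →₀ k) : cf (relabel σ l) (freeMap k G σ h f) = cf l f := by
  classical
  have key : (cf (relabel σ l)).comp (freeMap k G σ h) = cf l := by
    apply word_ext
    intro W
    rw [LinearMap.comp_apply, freeMap_single, cf_single, cf_single]
    congr 1
    exact propext (relabel_injective σ).eq_iff
  exact LinearMap.congr_fun key f

theorem relabel_surjective (σ : Equiv.Perm ℕ) :
    Function.Surjective (relabel (ι := ι) σ) := by
  intro l
  refine ⟨relabel σ⁻¹ l, ?_⟩
  unfold relabel
  rw [List.map_map]
  conv_rhs => rw [← List.map_id l]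
  refine List.map_congr_left fun a _ => Prod.ext rfl ?_
  change (a.2.map _).map _ = a.2
  rw [Finset.map_map]
  ext i
  simp

/-- Splitting a word after a given number of letters. -/
theorem Word.exists_append {z : Lab} (W : Word G z) {n : ℕ} (hn : n ≤ z.wt) :
    ∃ (x y : Lab) (s : Splits z x y) (U : Word G x) (V : Word G y),
      x.wt = n ∧ W = Word.append s U V := by
  have h : IsWord G (W.1.take n ++ W.1.drop n) z := by rw [List.take_append_drop]; exact W.2
  obtain ⟨x, y, s, hx, hy⟩ := h.of_append
  refine ⟨x, y, s, ⟨_, hx⟩, ⟨_, hy⟩, ?_, ?_⟩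
  · rw [← hx.wt, List.length_take, W.2.wt, min_eq_left hn]
  · exact Subtype.ext (List.take_append_drop _ _).symm

/-- Any word of weight at least `n` can be cut after `n` letters; this is the induction principle
used to peel off blocks of prescribed length. -/
theorem freeMul_ext {z : Lab} {n : ℕ} (hn : n ≤ z.wt) {M : Type*} [AddCommMonoid M]
    [Module k M] {f g : (Word G z →₀ k) →ₗ[k] M}
    (h : ∀ {x y : Lab} (s : Splits z x y), x.wt = n → ∀ (U : Word G x) (V : Word G y),
      f (freeMul k G s (Finsupp.single U 1) (Finsupp.single V 1)) =
        g (freeMul k G s (Finsupp.single U 1) (Finsupp.single V 1))) : f = g := by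
  apply word_ext
  intro W
  obtain ⟨x, y, s, U, V, hx, rfl⟩ := W.exists_append hn
  rw [← freeMul_single]
  exact h s hx U V

end Words

/-! ### Bar construction of an algebra with relations between adjacent letters, in terms of words
cut in blocks. -/

section Blocks

variable {ι : Type} {G : SymGens ι} {k : Type u} [Field k]

/-- A presentation of a twisted associative algebra as a quotient of a free algebra by relations
imposed on pairs of adjacent letters: `gap i z` is the space of relations between the letters number
`i` and `i + 1` (counted from zero). -/
structure GapPres (A : TwAlg k) (G : SymGens ι)
    (gap : ℕ → ∀ z, Submodule k (Word G z →₀ k)) where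
  π : ∀ x, (Word G x →₀ k) →ₗ[k] A.obj x
  surj : ∀ x, Function.Surjective (π x)
  mul : ∀ {z x y : Lab} (s : Splits z x y) (f : Word G x →₀ k) (g : Word G y →₀ k),
    A.mul s (π x f) (π y g) = π z (freeMul k G s f g)
  map : ∀ (σ : Equiv.Perm ℕ) {x y : Lab} (h : x.move σ = y) (f : Word G x →₀ k),
    A.map σ h (π x f) = π y (freeMap k G σ h f)
  one : A.one = π Lab.nil (Finsupp.single ⟨[], IsWord.nil G⟩ 1)
  ker : ∀ z, LinearMap.ker (π z) = ⨆ (i : ℕ) (_ : i + 1 < z.wt), gap i z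
  gap_left : ∀ {z x y : Lab} (s : Splits z x y) (i : ℕ) (f : Word G x →₀ k) {g : Word G y →₀ k},
    g ∈ gap i y → freeMul k G s f g ∈ gap (x.wt + i) z
  gap_right : ∀ {z x y : Lab} (s : Splits z x y) (i : ℕ) {f : Word G x →₀ k} (g : Word G y →₀ k),
    i + 1 < x.wt → f ∈ gap i x → freeMul k G s f g ∈ gap i z
  gap_gen : ∀ (i : ℕ) (z : Lab), i + 1 < z.wt → gap i z ≤ Submodule.span k
    {f | ∃ (x y u v : Lab) (s : Splits z x y) (t : Splits y u v) (U : Word G x) (V : Word G v)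
      (r : Word G u →₀ k), x.wt = i ∧ u.wt = 2 ∧ r ∈ gap 0 u ∧
      f = freeMul k G s (Finsupp.single U 1) (freeMul k G t r (Finsupp.single V 1))}
  even : ∀ {x : Lab}, Word G x → (x.deg : ZMod 2) = 0

/-- The projection on the components of positive weight. -/
noncomputable def TwAlg.toAug (A : TwAlg k) (x : Lab) : A.obj x →ₗ[k] A.aug.obj x :=
  if h : x.wt = 0 then 0 else 
    { toFun := fun a => ⟨a, fun h' => absurd h' h⟩
      map_add' := fun _ _ => rfl
      map_smul' := fun _ _ => rfl }

theorem TwAlg.toAug_coe (A : TwAlg k) {x : Lab} (h : x.wt ≠ 0) (a : A.obj x) :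
    (A.toAug x a).1 = a := by
  unfold TwAlg.toAug
  rw [dif_neg h]; rfl

theorem TwAlg.toAug_val (A : TwAlg k) {x : Lab} (a : A.aug.obj x) : A.toAug x a.1 = a := by
  by_cases h : x.wt = 0
  · rw [A.aug_eq_zero h a, A.aug_eq_zero h (A.toAug x _)]
  · exact Subtype.ext (A.toAug_coe h a.1)

variable {A : TwAlg k} {gap : ℕ → ∀ z, Submodule k (Word G z →₀ k)}

open Classical in
/-- The element of the bar construction obtained from a monomial by cutting it in blocks of
given lengths. -/
noncomputable def GapPres.blocks (P : GapPres A G gap) : (n : ℕ) → (L : List ℕ) → (z : Lab) →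
    (Word G z →₀ k) →ₗ[k] (A.bar n).obj z
  | 0, [], z => Finsupp.linearCombination k (fun _ : Word G z =>
      if h : z = Lab.nil then Finsupp.single (PLift.up h) (1 : k) else 0)
  | n + 1, l :: L, z => Finsupp.linearCombination k (fun W : Word G z =>
      if h : l ≤ z.wt then
        A.bten n (W.exists_append h).choose_spec.choose_spec.choose
          (A.toAug _ (P.π _ (Finsupp.single
            (W.exists_append h).choose_spec.choose_spec.choose_spec.choose 1)))
          (P.blocks n L _ (Finsupp.single
            (W.exists_append h).choose_spec.choose_spec.choose_spec.choose_spec.choose 1))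
        else 0)
  | 0, _ :: _, _ => 0
  | _ + 1, [], _ => 0

theorem GapPres.blocks_nil (P : GapPres A G gap) :
    P.blocks 0 [] Lab.nil (Finsupp.single ⟨[], IsWord.nil G⟩ 1) = A.bone := by
  unfold GapPres.blocks
  refine (Finsupp.linearCombination_single k (1 : k) _).trans ?_
  rw [one_smul]
  exact dif_pos rfl

/-- Makes the choice of a factorization in `GapPres.blocks` harmless: once the weight of the first
factor is fixed, there is only one. -/
theorem Word.append_inj {z x y x' y' : Lab} {s : Splits z x y} {s' : Splits z x' y'}
    {U : Word G x} {V : Word G y} {U' : Word G x'} {V' : Word G y'} (h : x'.wt = x.wt)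
    (e : Word.append s U V = Word.append s' U' V') :
    x = x' ∧ y = y' ∧ U.1 = U'.1 ∧ V.1 = V'.1 := by
  have e' : U.1 ++ V.1 = U'.1 ++ V'.1 := congrArg Subtype.val e
  have hl : U.1.length = U'.1.length := by rw [U.2.wt, U'.2.wt, h]
  obtain ⟨h1, h2⟩ := List.append_inj e' hl
  exact ⟨U.2.label_unique (h1 ▸ U'.2), V.2.label_unique (h2 ▸ V'.2), h1, h2⟩

theorem GapPres.blocks_single (P : GapPres A G gap) (n l : ℕ) (L : List ℕ) {z x y : Lab} (s : Splits z x y)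
    (hx : x.wt = l) (U : Word G x) (V : Word G y) :
    P.blocks (n + 1) (l :: L) z (freeMul k G s (Finsupp.single U 1) (Finsupp.single V 1)) =
      A.bten n s (A.toAug x (P.π x (Finsupp.single U 1)))
        (P.blocks n L y (Finsupp.single V 1)) := by
  rw [freeMul_single]
  conv_lhs => unfold GapPres.blocks
  refine (Finsupp.linearCombination_single k (1 : k) _).trans ?_
  have hl : l ≤ z.wt := by have := s.wt; omega
  rw [one_smul, dif_pos hl]
  have gen : ∀ (x' y' : Lab) (s' : Splits z x' y') (U' : Word G x') (V' : Word G y'),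
      x'.wt = l ∧ Word.append s U V = Word.append s' U' V' →
      A.bten n s' (A.toAug x' (P.π x' (Finsupp.single U' 1)))
        (P.blocks n L y' (Finsupp.single V' 1)) =
      A.bten n s (A.toAug x (P.π x (Finsupp.single U 1)))
        (P.blocks n L y (Finsupp.single V 1)) := by
    rintro x' y' s' U' V' ⟨e1, e2⟩
    obtain ⟨h1, h2, h3, h4⟩ := Word.append_inj (by omega) e2
    subst h1; subst h2
    obtain rfl := Subtype.ext h3
    obtain rfl := Subtype.ext h4
    rfl
  exact gen _ _ _ _ _
    (Word.exists_append _ hl).choose_spec.choose_spec.choose_spec.choose_spec.choose_spec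

theorem GapPres.blocks_cons (P : GapPres A G gap) (n l : ℕ) (L : List ℕ) {z x y : Lab} (s : Splits z x y)
    (hx : x.wt = l) (f : Word G x →₀ k) (g : Word G y →₀ k) :
    P.blocks (n + 1) (l :: L) z (freeMul k G s f g) =
      A.bten n s (A.toAug x (P.π x f)) (P.blocks n L y g) := by
  have key : (freeMul k G s).compr₂ (P.blocks (n + 1) (l :: L) z) =
      (A.bten n s).compl₁₂ ((A.toAug x).comp (P.π x)) (P.blocks n L y) := by
    apply word_ext; intro U; apply word_ext; intro V
    exact P.blocks_single n l L s hx U V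
  exact LinearMap.congr_fun (LinearMap.congr_fun key f) g

/-- The gaps between letters of the same block. -/
def Interior : List ℕ → ℕ → Prop
  | [], _ => False
  | l :: L, i => i + 1 < l ∨ (l ≤ i ∧ Interior L (i - l))

theorem Interior.lt : ∀ {L : List ℕ} {i : ℕ}, Interior L i → i + 1 < L.sum
  | [], _, h => h.elim
  | l :: L, i, h => by
    rw [List.sum_cons]
    rcases h with h | ⟨h1, h2⟩
    · omega
    · have := h2.lt; omega

theorem GapPres.π_gap (P : GapPres A G gap) {i : ℕ} {z : Lab} (h : i + 1 < z.wt) {f : Word G z →₀ k}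
    (hf : f ∈ gap i z) : P.π z f = 0 := by
  have h1 : f ∈ LinearMap.ker (P.π z) := by
    rw [P.ker]
    exact (le_iSup₂_of_le i h (le_refl (gap i z)) :
      gap i z ≤ ⨆ (i : ℕ) (_ : i + 1 < z.wt), gap i z) hf
  exact h1

/-- Relations inside a block are satisfied in the bar construction. -/
theorem GapPres.blocks_gap (P : GapPres A G gap) : ∀ (n : ℕ) (L : List ℕ) (i : ℕ) (z : Lab), Interior L i →
    L.sum = z.wt → ∀ f ∈ gap i z, P.blocks n L z f = 0
  | 0, [], _, _, h, _, _, _ => h.elim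
  | _ + 1, [], _, _, h, _, _, _ => h.elim
  | 0, _ :: _, _, _, _, _, _, _ => rfl
  | n + 1, l :: L, i, z, h, hL, f, hf => by
    have hi := h.lt
    rw [hL] at hi
    rw [List.sum_cons] at hL
    refine (Submodule.span_le (p := LinearMap.ker (P.blocks (n + 1) (l :: L) z))).2 ?_
      (P.gap_gen i z hi hf)
    rintro _ ⟨x, y, u, v, s, t, U, V, r, hx, hu, hr, rfl⟩
    rw [SetLike.mem_coe, LinearMap.mem_ker]
    have hs := s.wt
    have ht := t.wt
    rcases h with h | ⟨h1, h2⟩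
    -- The relator occupies the letters `i` and `i + 1` of the first block, which ends `l - (i + 2)`
    -- letters after it. Cutting `V` there makes the relator part of the first factor, where `π`
    -- kills it.
    · obtain ⟨v₁, v₂, s', V₁, V₂, hv, rfl⟩ := V.exists_append (n := l - (i + 2)) (by omega)
      rw [← freeMul_single, ← freeMul_assoc (t.inner s') (t.outer s') s' t,
        ← freeMul_assoc (s.inner (t.outer s')) (s.outer (t.outer s')) (t.outer s') s,
        P.blocks_cons _ _ _ _ (by simp only [Lab.join]; omega), P.π_gap (i := i), map_zero, map_zero,
        LinearMap.zero_apply]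
      · simp only [Lab.join]; omega
      · have := P.gap_left (s.inner (t.outer s')) 0 (Finsupp.single U 1)
          (P.gap_right (t.inner s') 0 (Finsupp.single V₁ 1) (by omega) hr)
        rwa [hx] at this
    -- The relator now lies beyond the first block, so that block is a prefix of `U` and induction
    -- applies to the rest, with the gap renumbered.
    · obtain ⟨x₁, x₂, s', U₁, U₂, hu', rfl⟩ := U.exists_append (n := l) (by omega)
      have hs' := s'.wt
      rw [← freeMul_single, freeMul_assoc s' s (s.inner' s') (s.outer' s'),
        P.blocks_cons _ _ _ _ hu', P.blocks_gap n L (i - l) _ h2 (by simp only [Lab.join]; omega),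
        map_zero]
      have := P.gap_left (s.inner' s') 0 (Finsupp.single U₂ 1)
        (P.gap_right t 0 (Finsupp.single V 1) (by omega) hr)
      rwa [show x₂.wt + 0 = i - l by omega] at this

/-- The space of relations inside the blocks. -/
noncomputable def blockRel (gap : ℕ → ∀ z, Submodule k (Word G z →₀ k)) (L : List ℕ) (z : Lab) :
    Submodule k (Word G z →₀ k) := ⨆ (i : ℕ) (_ : Interior L i), gap i z

theorem gap_le_blockRel {L : List ℕ} {i : ℕ} (h : Interior L i) (z : Lab) :
    gap i z ≤ blockRel gap L z := le_iSup₂_of_le i h (le_refl (gap i z))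

theorem GapPres.blocks_blockRel (P : GapPres A G gap) (n : ℕ) {L : List ℕ} {z : Lab} (hL : L.sum = z.wt)
    {f : Word G z →₀ k} (hf : f ∈ blockRel gap L z) : P.blocks n L z f = 0 := by
  have : blockRel gap L z ≤ LinearMap.ker (P.blocks n L z) :=
    iSup₂_le fun i hi f hf => P.blocks_gap n L i z hi hL f hf
  exact this hf

/-- A linear section of the projection on the algebra. -/
noncomputable def GapPres.sec (P : GapPres A G gap) (x : Lab) : A.obj x →ₗ[k] (Word G x →₀ k) :=
  ((P.π x).exists_rightInverse_of_surjective (LinearMap.range_eq_top.2 (P.surj x))).choose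

theorem GapPres.π_sec (P : GapPres A G gap) (x : Lab) (a : A.obj x) : P.π x (P.sec x a) = a :=
  LinearMap.congr_fun ((P.π x).exists_rightInverse_of_surjective
    (LinearMap.range_eq_top.2 (P.surj x))).choose_spec a

open Classical in
/-- The part of an element of the bar construction with given lengths of blocks, lifted to the
free algebra. -/
noncomputable def GapPres.unblocks (P : GapPres A G gap) : (n : ℕ) → (L : List ℕ) → (z : Lab) →
    (A.bar n).obj z →ₗ[k] (Word G z →₀ k)
  | 0, [], z => Finsupp.linearCombination k (fun h : PLift (z = Lab.nil) =>
      Finsupp.single ⟨[], IsWord.nil_iff.2 h.down⟩ (1 : k))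
  | n + 1, l :: L, _ => A.blift n (fun {x y} s =>
      if x.wt = l then
        (freeMul k G s).compl₁₂ ((P.sec x).comp (Submodule.subtype _))
          (P.unblocks n L y) else 0)
  | 0, _ :: _, _ => 0
  | _ + 1, [], _ => 0

theorem GapPres.unblocks_bten (P : GapPres A G gap) (n l : ℕ) (L : List ℕ) {z x y : Lab} (s : Splits z x y)
    (hx : x.wt = l) (a : A.aug.obj x) (v : (A.bar n).obj y) :
    P.unblocks (n + 1) (l :: L) z (A.bten n s a v) =
      freeMul k G s (P.sec x a.1) (P.unblocks n L y v) := by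
  conv_lhs => unfold GapPres.unblocks
  rw [A.blift_bten, if_pos hx]
  rfl

theorem GapPres.unblocks_bten_ne (P : GapPres A G gap) (n l : ℕ) (L : List ℕ) {z x y : Lab} (s : Splits z x y)
    (hx : x.wt ≠ l) (a : A.aug.obj x) (v : (A.bar n).obj y) :
    P.unblocks (n + 1) (l :: L) z (A.bten n s a v) = 0 := by
  conv_lhs => unfold GapPres.unblocks
  rw [A.blift_bten, if_neg hx]
  rfl

/-- The section is only linear. Its error lies in the kernel of `π`, that is in the sum of the
relations at all gaps, and all of these are interior when the whole word is one block. -/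
theorem GapPres.sec_π (P : GapPres A G gap) (x : Lab) (f : Word G x →₀ k) :
    P.sec x (P.π x f) - f ∈ blockRel gap [x.wt] x := by
  have : P.sec x (P.π x f) - f ∈ LinearMap.ker (P.π x) := by
    rw [LinearMap.mem_ker, map_sub, P.π_sec, sub_self]
  rw [P.ker] at this
  exact (iSup₂_le fun i hi => gap_le_blockRel (L := [x.wt]) (Or.inl hi) x :
    (⨆ (i : ℕ) (_ : i + 1 < x.wt), gap i x) ≤ _) this

theorem GapPres.blockRel_left (P : GapPres A G gap) {z x y : Lab} (s : Splits z x y) (L : List ℕ)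
    (f : Word G x →₀ k) {g : Word G y →₀ k} (hg : g ∈ blockRel gap L y) :
    freeMul k G s f g ∈ blockRel gap (x.wt :: L) z := by
  have : blockRel gap L y ≤ (blockRel gap (x.wt :: L) z).comap (freeMul k G s f) :=
    iSup₂_le fun i hi g hg => by
      have h := P.gap_left s i f hg
      exact gap_le_blockRel (L := x.wt :: L) (Or.inr ⟨by omega, by rwa [Nat.add_sub_cancel_left]⟩) z h
  exact this hg

theorem GapPres.blockRel_right (P : GapPres A G gap) {z x y : Lab} (s : Splits z x y) (L : List ℕ)
    {f : Word G x →₀ k} (g : Word G y →₀ k) (hf : f ∈ blockRel gap [x.wt] x) :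
    freeMul k G s f g ∈ blockRel gap (x.wt :: L) z := by
  have : blockRel gap [x.wt] x ≤
      (blockRel gap (x.wt :: L) z).comap ((freeMul k G s).flip g) :=
    iSup₂_le fun i hi f hf => by
      have hi' : i + 1 < x.wt := by simpa using hi.lt
      exact gap_le_blockRel (L := x.wt :: L) (Or.inl hi') z (P.gap_right s i g hi' hf)
  exact this hf

/-- Block by block, lifting back from the algebra costs only relations inside that block, and a
block of unexpected length contributes zero. Positivity of the parts is needed because `toAug` is
zero in weight zero. -/
theorem GapPres.unblocks_blocks (P : GapPres A G gap) : ∀ (n : ℕ) (L L' : List ℕ) (z : Lab), L.length = n →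
    L'.length = n → (∀ l ∈ L, 0 < l) → L.sum = z.wt → ∀ f : Word G z →₀ k,
    P.unblocks n L' z (P.blocks n L z f) - (if L = L' then f else 0) ∈ blockRel gap L' z
  | 0, [], [], z, _, _, _, hz, f => by
    have : (P.unblocks 0 [] z).comp (P.blocks 0 [] z) = LinearMap.id := by
      apply word_ext
      intro W
      have hW : W.1 = [] := List.length_eq_zero_iff.1 (by rw [W.2.wt, ← hz]; rfl)
      have hz' : z = Lab.nil := IsWord.nil_iff.1 (hW ▸ W.2)
      subst hz'
      obtain rfl : W = ⟨[], IsWord.nil G⟩ := Subtype.ext hW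
      rw [LinearMap.comp_apply, P.blocks_nil]
      refine (Finsupp.linearCombination_single k (1 : k) _).trans ?_
      rw [one_smul]; rfl
    rw [if_pos rfl, show P.unblocks 0 [] z (P.blocks 0 [] z f) = f from
      LinearMap.congr_fun this f, sub_self]
    exact Submodule.zero_mem _
  | n + 1, l :: L, l' :: L', z, hn, hn', hp, hz, f => by
    rw [List.sum_cons] at hz
    have key : (blockRel gap (l' :: L') z).mkQ.comp
        ((P.unblocks (n + 1) (l' :: L') z).comp (P.blocks (n + 1) (l :: L) z) -
          (if l :: L = l' :: L' then LinearMap.id else 0)) = 0 := by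
      apply freeMul_ext (n := l) (by omega)
      intro x y s hx U V
      have hs := s.wt
      have hl : 0 < l := hp l List.mem_cons_self
      rw [LinearMap.comp_apply, LinearMap.sub_apply, LinearMap.comp_apply,
        P.blocks_cons n l L s hx, LinearMap.zero_apply]
      refine (Submodule.Quotient.mk_eq_zero _).2 ?_
      by_cases e : l = l'
      · subst e
        rw [P.unblocks_bten n l L' s hx, A.toAug_coe (by omega)]
        have ih := P.unblocks_blocks n L L' y (by simpa using hn) (by simpa using hn')
          (fun m hm => hp m (List.mem_cons_of_mem _ hm)) (by omega) (Finsupp.single V 1)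
        -- `h1` is the error made on the remaining blocks and `h2` the error made on the first
        -- block; their sum telescopes to the required difference.
        have h1 := P.blockRel_left s L' (P.sec x (P.π x (Finsupp.single U 1))) ih
        have h2 := P.blockRel_right s L' (if L = L' then Finsupp.single V 1 else 0)
          (P.sec_π x (Finsupp.single U (1 : k)))
        rw [hx] at h1 h2
        have := Submodule.add_mem _ h1 h2
        rw [map_sub, map_sub, LinearMap.sub_apply, sub_add_sub_cancel] at this
        by_cases e : L = L'
        · rw [if_pos e] at this
          rwa [if_pos (by rw [e])]
        · rw [if_neg e, map_zero] at this
          rwa [if_neg (by simpa using e)]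
      · rw [P.unblocks_bten_ne n l' L' s (by omega), if_neg (by simp [e]),
          LinearMap.zero_apply, sub_zero]
        exact Submodule.zero_mem _
    have h := LinearMap.congr_fun key f
    have h' := (Submodule.Quotient.mk_eq_zero _).1 h
    by_cases e : l :: L = l' :: L'
    · rw [if_pos e] at h' ⊢; exact h'
    · rw [if_neg e] at h' ⊢; exact h'

end Blocks

/-! ### Compositions of an integer: merging parts, cutting at a gap, and the homotopy between them.
-/

section Compositions

/-- `L` is a composition of `w` with `n` parts. -/
structure IsComp (n : ℕ) (L : List ℕ) (w : ℕ) : Prop where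
  length : L.length = n
  pos : ∀ l ∈ L, 0 < l
  sum : L.sum = w

theorem IsComp.cons {n w l v : ℕ} {L : List ℕ} (h : IsComp n L w) (hl : 0 < l) (hv : l + w = v) :
    IsComp (n + 1) (l :: L) v :=
  ⟨by rw [List.length_cons, h.length], by simpa [hl] using h.pos, by rw [List.sum_cons, h.sum, hv]⟩

theorem IsComp.tail {n w l : ℕ} {L : List ℕ} (h : IsComp (n + 1) (l :: L) w) :
    0 < l ∧ IsComp n L (w - l) ∧ l ≤ w := by
  have h1 := h.sum
  rw [List.sum_cons] at h1
  exact ⟨h.pos l List.mem_cons_self, ⟨by simpa using h.length,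
    fun m hm => h.pos m (List.mem_cons_of_mem _ hm), by omega⟩, by omega⟩

variable (k : Type u) [Field k]

/-- The alternating sum of the compositions obtained by merging two adjacent parts. -/
noncomputable def mergeL : List ℕ → (List ℕ →₀ k)
  | [] => 0
  | [_] => 0
  | l :: l' :: L => Finsupp.single ((l + l') :: L) 1 -
      Finsupp.lmapDomain k k (List.cons l) (mergeL (l' :: L))

/-- The composition obtained by cutting at a given gap, with a sign. -/
noncomputable def splitL : List ℕ → ℕ → (List ℕ →₀ k)
  | [], _ => 0
  | l :: L, i => if i + 1 < l then Finsupp.single ((i + 1) :: (l - (i + 1)) :: L) 1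
      else if i + 1 = l then 0 else - Finsupp.lmapDomain k k (List.cons l) (splitL L (i - l))

theorem cons_mem_supported {n w l v : ℕ} {a : List ℕ →₀ k}
    (ha : a ∈ Finsupp.supported k k {L | IsComp n L w}) (hl : 0 < l) (hv : l + w = v) :
    Finsupp.lmapDomain k k (List.cons l) a ∈ Finsupp.supported k k {L | IsComp (n + 1) L v} := by
  classical
  rw [Finsupp.mem_supported] at ha ⊢
  intro L hL
  obtain ⟨M, hM, rfl⟩ := Finset.mem_image.1 (Finsupp.mapDomain_support hL)
  exact (ha hM).cons hl hv

theorem mergeL_mem : ∀ (n w : ℕ) (L : List ℕ), IsComp (n + 1) L w →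
    mergeL k L ∈ Finsupp.supported k k {L | IsComp n L w}
  | _, _, [], _ => Submodule.zero_mem _
  | _, _, [_], _ => Submodule.zero_mem _
  | 0, _, _ :: _ :: _, h => by have := h.length; simp at this
  | n + 1, w, l :: l' :: L, h => by
    obtain ⟨h1, h2, h3⟩ := h.tail
    obtain ⟨h4, h5, h6⟩ := h2.tail
    rw [mergeL]
    refine Submodule.sub_mem _ (Finsupp.single_mem_supported _ _ ?_)
      (cons_mem_supported k (mergeL_mem n (w - l) (l' :: L) h2) h1 (by omega))
    exact h5.cons (by omega) (by omega)

theorem splitL_mem : ∀ (n w : ℕ) (L : List ℕ) (i : ℕ), IsComp n L w → i + 1 < w →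
    splitL k L i ∈ Finsupp.supported k k {L | IsComp (n + 1) L w}
  | _, _, [], _, _, _ => Submodule.zero_mem _
  | 0, _, _ :: _, _, h, _ => by have := h.length; simp at this
  | n + 1, w, l :: L, i, h, hi => by
    obtain ⟨h1, h2, h3⟩ := h.tail
    rw [splitL]
    split_ifs with e1 e2
    · refine Finsupp.single_mem_supported _ _ ?_
      exact (h2.cons (l := l - (i + 1)) (by omega) rfl).cons (by omega) (by omega)
    · exact Submodule.zero_mem _
    · exact Submodule.neg_mem _ (cons_mem_supported k
        (splitL_mem n (w - l) L (i - l) h2 (by omega)) h1 (by omega))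

/-- At most one composition arises, and only the gap `i` stops being inside a block. Hence relations
at the other gaps survive the cut. -/
theorem splitL_spec : ∀ (L : List ℕ) (i : ℕ), splitL k L i = 0 ∨ ∃ (m : ℕ) (M : List ℕ) (c : k),
    splitL k L i = Finsupp.single (m :: M) c ∧
      ∀ j, Interior L j → j ≠ i → Interior (m :: M) j
  | [], _ => Or.inl rfl
  | l :: L, i => by
    rw [splitL]
    split_ifs with e1 e2
    · refine Or.inr ⟨_, _, _, rfl, fun j hj hji => ?_⟩
      rcases hj with hj | ⟨hj, hj'⟩
      · rcases lt_or_gt_of_ne hji with h | h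
        · exact Or.inl (by omega)
        · exact Or.inr ⟨by omega, Or.inl (by omega)⟩
      · refine Or.inr ⟨by omega, Or.inr ⟨by omega, ?_⟩⟩
        rwa [show j - (i + 1) - (l - (i + 1)) = j - l by omega]
    · exact Or.inl rfl
    · rcases splitL_spec L (i - l) with h | ⟨m, M, c, h, h'⟩
      · rw [h, map_zero, neg_zero]; exact Or.inl rfl
      · refine Or.inr ⟨l, m :: M, -c, ?_, fun j hj hji => ?_⟩
        · rw [h, Finsupp.lmapDomain_apply, Finsupp.mapDomain_single, ← Finsupp.single_neg]
        · rcases hj with hj | ⟨hj, hj'⟩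
          · exact Or.inl hj
          · exact Or.inr ⟨hj, h' _ hj' (by omega)⟩

/-- Enlarging the first part. -/
def addHead (l : ℕ) : List ℕ → List ℕ
  | [] => []
  | m :: M => (l + m) :: M

theorem splitL_cons (l : ℕ) (L : List ℕ) (i : ℕ) : splitL k (l :: L) i =
    if i + 1 < l then Finsupp.single ((i + 1) :: (l - (i + 1)) :: L) 1
      else if i + 1 = l then 0 else - Finsupp.lmapDomain k k (List.cons l) (splitL k L (i - l)) :=
  rfl

/-- The gap `i ≥ l` is the gap `i - l` of `l' :: L`, so cutting there commutes with absorbing `l`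
into the first part. -/
theorem splitL_addHead {l i : ℕ} (l' : ℕ) (L : List ℕ) (hi : l ≤ i) :
    splitL k ((l + l') :: L) i =
      Finsupp.lmapDomain k k (addHead l) (splitL k (l' :: L) (i - l)) := by
  rw [splitL_cons, splitL_cons k l']
  by_cases e1 : i + 1 < l + l'
  · rw [if_pos e1, if_pos (show i - l + 1 < l' by omega), Finsupp.lmapDomain_apply, Finsupp.mapDomain_single]
    simp only [addHead]
    rw [show l + (i - l + 1) = i + 1 by omega, show l' - (i - l + 1) = l + l' - (i + 1) by omega]
  · rw [if_neg e1, if_neg (show ¬ i - l + 1 < l' by omega)]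
    by_cases e2 : i + 1 = l + l'
    · rw [if_pos e2, if_pos (show i - l + 1 = l' by omega), map_zero]
    · rw [if_neg e2, if_neg (show ¬ i - l + 1 = l' by omega), map_neg, Finsupp.lmapDomain_apply,
        Finsupp.lmapDomain_apply, Finsupp.lmapDomain_apply, ← Finsupp.mapDomain_comp,
        show i - (l + l') = i - l - l' by omega]
      rfl

/-- Either `l` is merged with the head of what follows, or the merging takes place further on, with
the opposite sign. What follows has to be non-empty, as `[l]` has nothing to merge with. -/
theorem merge_cons (l : ℕ) {a : List ℕ →₀ k} {m : ℕ} {M : List ℕ} {c : k}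
    (ha : a = Finsupp.single (m :: M) c) :
    Finsupp.linearCombination k (mergeL k) (Finsupp.lmapDomain k k (List.cons l) a) =
      Finsupp.lmapDomain k k (addHead l) a -
        Finsupp.lmapDomain k k (List.cons l) (Finsupp.linearCombination k (mergeL k) a) := by
  subst ha
  rw [Finsupp.lmapDomain_apply, Finsupp.mapDomain_single, Finsupp.linearCombination_single,
    Finsupp.linearCombination_single, Finsupp.lmapDomain_apply, Finsupp.mapDomain_single, mergeL,
    map_smul, smul_sub, Finsupp.smul_single, smul_eq_mul, mul_one]
  rfl

theorem split_cons_lt {l i : ℕ} (hi : i + 1 < l) (a : List ℕ →₀ k) :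
    Finsupp.linearCombination k (fun L => splitL k L i) (Finsupp.lmapDomain k k (List.cons l) a) =
      Finsupp.lmapDomain k k (List.cons (i + 1))
        (Finsupp.lmapDomain k k (List.cons (l - (i + 1))) a) := by
  induction a using Finsupp.induction_linear with
  | zero => simp
  | add a b ha hb => simp only [map_add, ha, hb]
  | single L c =>
    simp only [Finsupp.lmapDomain_apply, Finsupp.mapDomain_single,
      Finsupp.linearCombination_single, splitL, if_pos hi, Finsupp.smul_single, smul_eq_mul, mul_one]

theorem split_cons_eq {l i : ℕ} (hi : i + 1 = l) (a : List ℕ →₀ k) :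
    Finsupp.linearCombination k (fun L => splitL k L i) (Finsupp.lmapDomain k k (List.cons l) a) =
      0 := by
  induction a using Finsupp.induction_linear with
  | zero => simp
  | add a b ha hb => simp only [map_add, ha, hb, add_zero]
  | single L c =>
    simp only [Finsupp.lmapDomain_apply, Finsupp.mapDomain_single,
      Finsupp.linearCombination_single, splitL]
    rw [if_neg (by omega), if_pos hi, smul_zero]

theorem split_cons_gt {l i : ℕ} (hi : l ≤ i) (a : List ℕ →₀ k) :
    Finsupp.linearCombination k (fun L => splitL k L i) (Finsupp.lmapDomain k k (List.cons l) a) =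
      - Finsupp.lmapDomain k k (List.cons l)
        (Finsupp.linearCombination k (fun L => splitL k L (i - l)) a) := by
  induction a using Finsupp.induction_linear with
  | zero => simp
  | add a b ha hb => simp only [map_add, ha, hb, neg_add]
  | single L c =>
    rw [Finsupp.lmapDomain_apply, Finsupp.mapDomain_single, Finsupp.linearCombination_single,
      Finsupp.linearCombination_single, splitL, if_neg (by omega), if_neg (by omega), map_smul,
      smul_neg]

/-- Cutting at a fixed gap is a contracting homotopy for the merging differential. -/
theorem merge_split : ∀ (L : List ℕ) (i : ℕ), (∀ l ∈ L, 0 < l) → i + 1 < L.sum →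
    Finsupp.linearCombination k (mergeL k) (splitL k L i) +
      Finsupp.linearCombination k (fun L => splitL k L i) (mergeL k L) = Finsupp.single L 1
  | [], i, _, hi => by simp at hi
  | [l], i, _, hi => by
    have hi' : i + 1 < l := by simpa using hi
    rw [splitL, if_pos hi', Finsupp.linearCombination_single, mergeL, mergeL, mergeL, map_zero,
      map_zero, one_smul, sub_zero, add_zero, show i + 1 + (l - (i + 1)) = l by omega]
  | l :: l' :: L, i, hp, hi => by
    have hl' : 0 < l' := hp l' (by simp)
    rw [show mergeL k (l :: l' :: L) = Finsupp.single ((l + l') :: L) 1 -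
      Finsupp.lmapDomain k k (List.cons l) (mergeL k (l' :: L)) from rfl, map_sub,
      Finsupp.linearCombination_single, one_smul]
    -- The gap is inside the first part, or is the boundary between the first two parts, or lies
    -- further on. In the second case cutting `L` gives zero, and only merging the first two parts
    -- and cutting them again contributes.
    rcases lt_trichotomy (i + 1) l with h | h | h
    · rw [split_cons_lt k h, splitL, if_pos h, splitL, if_pos (by omega),
        Finsupp.linearCombination_single, one_smul, mergeL, mergeL, map_sub,
        Finsupp.lmapDomain_apply _ _ (List.cons (i + 1)), Finsupp.mapDomain_single,
        show i + 1 + (l - (i + 1)) = l by omega,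
        show l - (i + 1) + l' = l + l' - (i + 1) by omega]
      simp only [Finsupp.lmapDomain_apply]
      abel
    · rw [split_cons_eq k h, splitL, if_neg (by omega), if_pos h, map_zero, splitL,
        if_pos (by omega), h, sub_zero, zero_add, show l + l' - l = l' by omega]
    · rw [split_cons_gt k (by omega), splitL_addHead k l' L (by omega : l ≤ i)]
      conv_lhs => rw [splitL, if_neg (by omega), if_neg (by omega)]
      have ih := merge_split (l' :: L) (i - l) (fun m hm => hp m (List.mem_cons_of_mem _ hm))
        (by simp only [List.sum_cons] at hi ⊢; omega)
      have e : Finsupp.linearCombination k (mergeL k)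
          (Finsupp.lmapDomain k k (List.cons l) (splitL k (l' :: L) (i - l))) =
          Finsupp.lmapDomain k k (addHead l) (splitL k (l' :: L) (i - l)) -
          Finsupp.lmapDomain k k (List.cons l)
            (Finsupp.linearCombination k (mergeL k) (splitL k (l' :: L) (i - l))) := by
        rcases splitL_spec k (l' :: L) (i - l) with h0 | ⟨m, M, c, h0, -⟩
        · rw [h0]; simp
        · exact merge_cons k l h0
      rw [map_neg, e]
      have := congrArg (Finsupp.lmapDomain k k (List.cons l)) ih
      rw [map_add, Finsupp.lmapDomain_apply _ _ _ (Finsupp.single _ _),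
        Finsupp.mapDomain_single] at this
      rw [← this]
      abel

end Compositions

/-! ### Acyclicity of the bar construction off the diagonal. -/

section Exactness

variable {ι : Type} {G : SymGens ι} {k : Type u} [Field k] {A : TwAlg k}
  {gap : ℕ → ∀ z, Submodule k (Word G z →₀ k)}

/-- Formal combinations of compositions acting on the free algebra. -/
noncomputable def GapPres.cut (P : GapPres A G gap) (n : ℕ) (z : Lab) :
    (List ℕ →₀ k) →ₗ[k] (Word G z →₀ k) →ₗ[k] (A.bar n).obj z :=
  Finsupp.linearCombination k (fun L => P.blocks n L z)

theorem GapPres.cut_single (P : GapPres A G gap) (n : ℕ) (z : Lab) (L : List ℕ) (c : k)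
    (f : Word G z →₀ k) : P.cut n z (Finsupp.single L c) f = c • P.blocks n L z f := by
  rw [GapPres.cut, Finsupp.linearCombination_single, LinearMap.smul_apply]

theorem GapPres.cut_cons (P : GapPres A G gap) (n l : ℕ) {z x y : Lab} (s : Splits z x y)
    (hx : x.wt = l) (a : List ℕ →₀ k) (f : Word G x →₀ k) (g : Word G y →₀ k) :
    P.cut (n + 1) z (Finsupp.lmapDomain k k (List.cons l) a) (freeMul k G s f g) =
      A.bten n s (A.toAug x (P.π x f)) (P.cut n y a g) := by
  induction a using Finsupp.induction_linear with
  | zero => simp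
  | add a b ha hb => simp only [map_add, LinearMap.add_apply, ha, hb]
  | single L c =>
    rw [Finsupp.lmapDomain_apply, Finsupp.mapDomain_single, P.cut_single, P.cut_single,
      P.blocks_cons n l L s hx, map_smul]

/-- Multiplying adjacent factors means removing the bar between two blocks of the same word. Since
words have even degree, the Koszul signs are trivial and only the alternating signs of `mergeL`
remain. -/
theorem GapPres.bd_blocks (P : GapPres A G gap) : ∀ (n : ℕ) (L : List ℕ) (z : Lab),
    IsComp (n + 1) L z.wt → ∀ f : Word G z →₀ k,
    A.bd n z (P.blocks (n + 1) L z f) = P.cut n z (mergeL k L) f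
  | _, [], _, h, _ => by have := h.length; simp at this
  | 0, [l], z, h, f => by
    rw [mergeL, map_zero]; rfl
  | 0, _ :: _ :: _, _, h, _ => by have := h.length; simp at this
  | n + 1, [l], _, h, _ => by have := h.length; simp at this
  | n + 1, l :: l' :: L, z, h, f => by
    obtain ⟨h1, h2, h3⟩ := h.tail
    obtain ⟨h4, h5, h6⟩ := h2.tail
    have key : (A.bd (n + 1) z).comp (P.blocks (n + 2) (l :: l' :: L) z) =
        P.cut (n + 1) z (mergeL k (l :: l' :: L)) := by
      apply freeMul_ext (n := l) h3
      intro x y s hx U V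
      have hs := s.wt
      obtain ⟨u, v, t, V₁, V₂, hu, rfl⟩ := V.exists_append (n := l') (by omega)
      have h2' : IsComp (n + 1) (l' :: L) y.wt := by rwa [show y.wt = z.wt - l by omega]
      rw [mergeL, map_sub, LinearMap.sub_apply, P.cut_single, one_smul, P.cut_cons n l s hx,
        ← P.bd_blocks n (l' :: L) y h2', LinearMap.comp_apply, P.blocks_cons _ l _ s hx,
        A.bd_bten, P.even U, sg_zero, one_smul]
      congr 1
      rw [← freeMul_single, ← freeMul_assoc (s.inner t) (s.outer t) t s,
        P.blocks_cons n (l + l') L (s.outer t) (by simp only [Lab.join]; omega),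
        P.blocks_cons n l' L t hu, A.bmerge_bten]
      congr 2
      apply Subtype.ext
      rw [A.toAug_coe (by simp only [Lab.join]; omega), ← P.mul]
      change A.mul _ (A.toAug x _).1 (A.toAug u _).1 = _
      rw [A.toAug_coe (by omega), A.toAug_coe (by omega)]
    exact LinearMap.congr_fun key f

theorem GapPres.bd_cut (P : GapPres A G gap) (n : ℕ) (z : Lab) {a : List ℕ →₀ k}
    (ha : a ∈ Finsupp.supported k k {L | IsComp (n + 1) L z.wt}) (f : Word G z →₀ k) :
    A.bd n z (P.cut (n + 1) z a f) =
      P.cut n z (Finsupp.linearCombination k (mergeL k) a) f := by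
  rw [Finsupp.supported_eq_span_single] at ha
  induction ha using Submodule.span_induction with
  | mem a ha =>
    obtain ⟨L, hL, rfl⟩ := ha
    rw [P.cut_single, one_smul, P.bd_blocks n L z hL, Finsupp.linearCombination_single, one_smul]
  | zero => simp
  | add a b _ _ ha hb => simp only [map_add, LinearMap.add_apply, ha, hb]
  | smul c a _ ha => simp only [map_smul, LinearMap.smul_apply, ha]

/-- The sum of the images of elements of the free algebra cut in blocks. -/
noncomputable def GapPres.total (P : GapPres A G gap) (n : ℕ) (z : Lab) :
    (List ℕ →₀ (Word G z →₀ k)) →ₗ[k] (A.bar n).obj z :=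
  Finsupp.lsum k (fun L => P.blocks n L z)

theorem GapPres.total_single (P : GapPres A G gap) (n : ℕ) (z : Lab) (L : List ℕ)
    (f : Word G z →₀ k) : P.total n z (Finsupp.single L f) = P.blocks n L z f :=
  Finsupp.lsum_single _ _ _ _

/-- Factors of weight zero vanish in the augmentation ideal, and every other factor is the image of
a combination of words; so positive parts suffice. -/
theorem GapPres.map_total_eq_top (P : GapPres A G gap) : ∀ (n : ℕ) (z : Lab),
    (Finsupp.supported (Word G z →₀ k) k {L | IsComp n L z.wt}).map (P.total n z) = ⊤
  | 0, z => by
    rw [← Submodule.ker_mkQ (Submodule.map _ _), LinearMap.ker_eq_top]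
    apply A.bar_zero_induction
    intro hz
    cases hz
    refine (Submodule.Quotient.mk_eq_zero _).2 ⟨Finsupp.single []
      (Finsupp.single ⟨[], IsWord.nil G⟩ 1), Finsupp.single_mem_supported _ _
      ⟨rfl, by simp, rfl⟩, ?_⟩
    rw [P.total_single]
    exact P.blocks_nil
  | n + 1, z => by
    rw [← Submodule.ker_mkQ (Submodule.map _ _), LinearMap.ker_eq_top]
    apply A.bar_ext
    intro x y s a v
    refine (Submodule.Quotient.mk_eq_zero _).2 ?_
    by_cases hx : x.wt = 0
    · rw [A.aug_eq_zero hx a, map_zero, LinearMap.zero_apply]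
      exact Submodule.zero_mem _
    · obtain ⟨f, hf⟩ := P.surj x a.1
      have hv : v ∈ (Finsupp.supported (Word G y →₀ k) k {L | IsComp n L y.wt}).map
        (P.total n y) := by rw [P.map_total_eq_top n y]; trivial
      obtain ⟨e, he, rfl⟩ := hv
      have : P.total n y e = ∑ L ∈ e.support, P.blocks n L y (e L) := by
        simp only [GapPres.total, Finsupp.lsum_apply, Finsupp.sum]
      rw [this, map_sum]
      refine Submodule.sum_mem _ fun L hL => ⟨Finsupp.single (x.wt :: L)
        (freeMul k G s f (e L)), Finsupp.single_mem_supported _ _ ?_, ?_⟩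
      · exact ((Finsupp.mem_supported _ _).1 he hL).cons (by omega) s.wt
      · rw [P.total_single, P.blocks_cons n _ L s rfl, hf, A.toAug_val]

/-- Applying `unblocks n L z` to the vanishing sum leaves `e L`, up to relations inside the blocks
of `L`. So different compositions are independent in the bar construction, and each contributes the
words modulo `blockRel`. -/
theorem GapPres.mem_blockRel_of_total_eq_zero (P : GapPres A G gap) {n : ℕ} {z : Lab}
    {e : List ℕ →₀ (Word G z →₀ k)}
    (he : e ∈ Finsupp.supported (Word G z →₀ k) k {L | IsComp n L z.wt})
    (h : P.total n z e = 0) {L : List ℕ} (hL : L.length = n) : e L ∈ blockRel gap L z := by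
  classical
  have h1 : P.total n z e = ∑ M ∈ e.support, P.blocks n M z (e M) := by
    simp only [GapPres.total, Finsupp.lsum_apply, Finsupp.sum]
  have h2 : ∑ M ∈ e.support, (P.unblocks n L z (P.blocks n M z (e M)) -
      (if M = L then e M else 0)) ∈ blockRel gap L z :=
    Submodule.sum_mem _ fun M hM => by
      have hM := (Finsupp.mem_supported _ _).1 he hM
      exact P.unblocks_blocks n M L z hM.length hL hM.pos hM.sum (e M)
  rw [Finset.sum_sub_distrib, ← map_sum, ← h1, h, map_zero, zero_sub,
    Finset.sum_ite_eq' e.support L (fun M => e M)] at h2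
  by_cases hL' : L ∈ e.support
  · rw [if_pos hL'] at h2
    simpa using Submodule.neg_mem _ h2
  · rw [Finsupp.notMem_support_iff.1 hL']
    exact Submodule.zero_mem _

/-- Multiples of an element by a formal combination of compositions. -/
noncomputable def spread {M : Type*} [AddCommGroup M] [Module k M] (a : List ℕ →₀ k) (f : M) :
    List ℕ →₀ M := Finsupp.mapRange.linearMap (LinearMap.toSpanSingleton k M f) a

theorem spread_apply {M : Type*} [AddCommGroup M] [Module k M] (a : List ℕ →₀ k) (f : M)
    (L : List ℕ) : spread a f L = a L • f := rfl

theorem spread_mem {M : Type*} [AddCommGroup M] [Module k M] {s : Set (List ℕ)} {a : List ℕ →₀ k}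
    (ha : a ∈ Finsupp.supported k k s) (f : M) : spread a f ∈ Finsupp.supported M k s := by
  rw [Finsupp.mem_supported'] at ha ⊢
  intro L hL
  rw [spread_apply, ha L hL, zero_smul]

theorem lsum_spread {M N : Type*} [AddCommGroup M] [Module k M] [AddCommGroup N] [Module k N]
    (φ : List ℕ → M →ₗ[k] N) (a : List ℕ →₀ k) (f : M) :
    Finsupp.lsum k φ (spread a f) = Finsupp.linearCombination k φ a f := by
  induction a using Finsupp.induction_linear with
  | zero => simp [spread]
  | add a b ha hb =>
    rw [map_add, LinearMap.add_apply, ← ha, ← hb, ← map_add]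
    congr 1
    exact map_add _ _ _
  | single L c =>
    have : spread (Finsupp.single L c) f = Finsupp.single L (c • f) := by
      simp [spread]
    rw [this, Finsupp.lsum_single, Finsupp.linearCombination_single, LinearMap.smul_apply, map_smul]

/-- Off-diagonal acyclicity of the bar construction, given operators `q i` which are
compatible with the spaces of relations and add up to the identity modulo all relations. -/
theorem GapPres.subsingleton_barHomology (P : GapPres A G gap) (z : Lab)
    (q : ℕ → (Word G z →₀ k) →ₗ[k] (Word G z →₀ k))
    (hq : ∀ i j, i ≠ j → j + 1 < z.wt → ∀ f ∈ gap j z, q i f ∈ gap j z)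
    (hq0 : ∀ i, i + 1 < z.wt → ∀ f ∈ gap i z, q i f = 0)
    (hq1 : ∀ f j, j + 1 < z.wt → f - ∑ i ∈ Finset.range (z.wt - 1), q i f ∈ gap j z)
    (n : ℕ) (hn : z.wt ≠ n) : Subsingleton (A.barHomology n z) := by
  rw [Submodule.Quotient.subsingleton_iff, Submodule.submoduleOf_eq_top]
  intro v hv
  rcases lt_or_gt_of_ne hn with h | h
  · rw [A.bar_eq_zero n h v]; exact Submodule.zero_mem _
  cases n with
  | zero =>
    have : (LinearMap.id : (A.bar 0).obj z →ₗ[k] _) = 0 := by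
      apply A.bar_zero_induction
      intro hz
      cases hz
      simp [Lab.nil] at h
    rw [show v = 0 from LinearMap.congr_fun this v]; exact Submodule.zero_mem _
  | succ m =>
    have hv : A.bd m z v = 0 := hv
    have hv' : v ∈ (Finsupp.supported (Word G z →₀ k) k {L | IsComp (m + 1) L z.wt}).map
      (P.total (m + 1) z) := by rw [P.map_total_eq_top]; trivial
    obtain ⟨x, hx, rfl⟩ := hv'
    have hx' : ∀ L ∈ x.support, IsComp (m + 1) L z.wt := fun L hL =>
      (Finsupp.mem_supported _ _).1 hx hL
    have tot : ∀ n (e : List ℕ →₀ (Word G z →₀ k)),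
        P.total n z e = ∑ M ∈ e.support, P.blocks n M z (e M) := by
      intro n e
      simp only [GapPres.total, Finsupp.lsum_apply, Finsupp.sum]
    -- `y` is the differential of the lift `x`, computed on formal compositions. It need not vanish,
    -- but its image in the bar construction does, so each component `y L` lies in `blockRel gap L
    -- z`.
    let y : List ℕ →₀ (Word G z →₀ k) := ∑ L ∈ x.support, spread (mergeL k L) (x L)
    have hy : y ∈ Finsupp.supported (Word G z →₀ k) k {L | IsComp m L z.wt} :=
      Submodule.sum_mem _ fun L hL => spread_mem (mergeL_mem k m _ L (hx' L hL)) _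
    have hy0 : P.total m z y = 0 := by
      rw [← hv, tot (m + 1) x, map_sum]
      rw [map_sum (A.bd m z)]
      refine Finset.sum_congr rfl fun L hL => ?_
      rw [P.bd_blocks m L z (hx' L hL)]
      exact lsum_spread _ _ _
    -- The primitive: the part `q i` of each component of the lift is cut at the gap `i`.
    refine ⟨∑ L ∈ x.support, ∑ i ∈ Finset.range (z.wt - 1),
      P.cut (m + 2) z (splitL k L i) (q i (x L)), ?_⟩
    have step : ∀ L ∈ x.support, ∀ i ∈ Finset.range (z.wt - 1),
        A.bd (m + 1) z (P.cut (m + 2) z (splitL k L i) (q i (x L))) =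
          P.blocks (m + 1) L z (q i (x L)) - P.cut (m + 1) z
            (Finsupp.linearCombination k (fun L => splitL k L i) (mergeL k L)) (q i (x L)) := by
      intro L hL i hi
      have hi : i + 1 < z.wt := by have := Finset.mem_range.1 hi; omega
      have hL := hx' L hL
      rw [P.bd_cut _ _ (splitL_mem k _ _ L i hL hi),
        eq_sub_of_add_eq (merge_split k L i hL.pos (by rw [hL.sum]; exact hi)), map_sub,
        LinearMap.sub_apply, P.cut_single, one_smul]
    rw [map_sum, tot]
    rw [Finset.sum_congr rfl fun L hL => (map_sum _ _ _).trans
      (Finset.sum_congr rfl fun i hi => step L hL i hi)]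
    simp only [Finset.sum_sub_distrib, ← map_sum]
    -- As there are fewer parts than letters, `L` has an interior gap `j`. The sum of the `q i`
    -- differs from the identity by relations at `j`, which `blocks` kills.
    have first : ∀ L ∈ x.support,
        P.blocks (m + 1) L z (∑ i ∈ Finset.range (z.wt - 1), q i (x L)) =
          P.blocks (m + 1) L z (x L) := by
      intro L hL
      have hL := hx' L hL
      have : ∃ j, Interior L j := by
        have aux : ∀ (n : ℕ) (L : List ℕ) (w : ℕ), IsComp n L w → n < w → ∃ j, Interior L j := by
          intro n
          induction n with
          | zero =>
            intro L w hL hw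
            have h1 := hL.length
            have h2 := hL.sum
            rw [List.length_eq_zero_iff] at h1
            subst h1
            simp at h2; omega
          | succ n ih =>
            intro L w hL hw
            cases L with
            | nil => have := hL.length; simp at this
            | cons l L =>
              obtain ⟨h1, h2, h3⟩ := hL.tail
              by_cases e : l = 1
              · obtain ⟨j, hj⟩ := ih L _ h2 (by omega)
                exact ⟨j + l, Or.inr ⟨by omega, by rwa [Nat.add_sub_cancel]⟩⟩
              · exact ⟨0, Or.inl (by omega)⟩
        exact aux _ L _ hL h
      obtain ⟨j, hj⟩ := this
      have hj' := hj.lt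
      rw [hL.sum] at hj'
      have := P.blocks_gap (m + 1) L j z hj hL.sum _ (hq1 (x L) j hj')
      rw [map_sub, sub_eq_zero] at this
      exact this.symm
    rw [Finset.sum_congr rfl first, sub_eq_self, Finset.sum_comm]
    refine Finset.sum_eq_zero fun i hi => ?_
    have hi : i + 1 < z.wt := by have := Finset.mem_range.1 hi; omega
    -- The terms left over by `merge_split` depend on `x` only through `y`.
    have e1 : ∑ L ∈ x.support, P.cut (m + 1) z
        (Finsupp.linearCombination k (fun L => splitL k L i) (mergeL k L)) (q i (x L)) =
        Finsupp.lsum k (fun L => (P.cut (m + 1) z (splitL k L i)).comp (q i)) y := by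
      rw [map_sum]
      refine Finset.sum_congr rfl fun L _ => ?_
      rw [lsum_spread]
      generalize mergeL k L = a
      induction a using Finsupp.induction_linear with
      | zero => simp
      | add a b ha hb => simp only [map_add, LinearMap.add_apply, ha, hb]
      | single M c => simp
    rw [e1, Finsupp.lsum_apply]
    refine Finset.sum_eq_zero fun L hL => ?_
    have hLc : IsComp m L z.wt := (Finsupp.mem_supported _ _).1 hy hL
    have hyL := P.mem_blockRel_of_total_eq_zero hy hy0 hLc.length
    change P.cut (m + 1) z (splitL k L i) (q i (y L)) = 0
    have hsup := splitL_mem k m z.wt L i hLc hi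
    rcases splitL_spec k L i with e | ⟨l', M, c, e, hM⟩
    · rw [e, map_zero, LinearMap.zero_apply]
    · rw [e, P.cut_single]
      by_cases hc : c = 0
      · rw [hc, zero_smul]
      have hMc : IsComp (m + 1) (l' :: M) z.wt := by
        rw [e, Finsupp.mem_supported] at hsup
        exact hsup (by simp [hc])
      rw [P.blocks_blockRel (m + 1) hMc.sum, smul_zero]
      -- The cut frees only the gap `i`, whose relations `q i` annihilates; relations at any other
      -- interior gap are preserved by `q i` and stay interior.
      have : blockRel gap L z ≤ (blockRel gap (l' :: M) z).comap (q i) := by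
        refine iSup₂_le fun j hj f hf => ?_
        have hj' := hj.lt
        rw [hLc.sum] at hj'
        rw [Submodule.mem_comap]
        by_cases hij : j = i
        · subst hij
          rw [hq0 j hi f hf]
          exact Submodule.zero_mem _
        · exact gap_le_blockRel (hM j hj hij) z (hq i j (Ne.symm hij) hj' f hf)
      exact this hyL

end Exactness

/-- The generators `m_I^{2p}`, `|I| = 1 + p (κ - 1)`, of `tHyperCom_κ`. -/
def hycGens (κ : ℕ) : SymGens ℕ where
  has p t := t = 1 + p * (κ - 1)
  deg p := 2 * p

/-! ### Words in the generators of `tHyperCom`: bad pairs and the lexicographic order of ranks. -/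

section Combinatorics

variable {κ : ℕ}

theorem IsWord.card_eq {l : List (ℕ × Finset ℕ)} {z : Lab} (h : IsWord (hycGens κ) l z)
    {x : ℕ × Finset ℕ} (hx : x ∈ l) : x.2.card = 1 + x.1 * (κ - 1) := h.has x hx

theorem sum_deg_hycGens (l : List (ℕ × Finset ℕ)) :
    (l.map (fun a => (hycGens κ).deg a.1)).sum = 2 * ((l.map Prod.fst).sum : ℕ) := by
  induction l with
  | nil => rfl
  | cons a l ih =>
    rw [List.map_cons, List.sum_cons, ih, List.map_cons, List.sum_cons]
    simp only [hycGens]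
    push_cast
    ring

theorem IsWord.even_deg {l : List (ℕ × Finset ℕ)} {z : Lab} (h : IsWord (hycGens κ) l z) :
    (z.deg : ZMod 2) = 0 := by
  rw [← h.deg, sum_deg_hycGens]
  push_cast
  rw [show (2 : ZMod 2) = 0 from rfl, zero_mul]

/-- Indices are bounded through the degree, which is twice their sum. Cardinalities would not do for
`κ = 1`, where letters of every index are singletons. -/
instance finite_word (z : Lab) : Finite (Word (hycGens κ) z) := by
  let S : Finset (ℕ × Finset ℕ) := Finset.range (z.deg.toNat + 1) ×ˢ z.supp.powerset
  have hS : ∀ W : Word (hycGens κ) z, ∀ a ∈ W.1, a ∈ S := by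
    intro W a ha
    refine Finset.mem_product.2 ⟨?_, ?_⟩
    · have h := W.2.deg
      rw [sum_deg_hycGens] at h
      have : a.1 ≤ (W.1.map Prod.fst).sum := List.le_sum_of_mem (List.mem_map_of_mem ha)
      rw [Finset.mem_range]
      omega
    · exact Finset.mem_powerset.2 fun i hi => (W.2.supp i).2 ⟨a, ha, hi⟩
  have hfin : Finite {l : List S // l.length = z.wt} :=
    (List.finite_length_eq S z.wt).to_subtype
  refine Finite.of_injective (β := {l : List S // l.length = z.wt})
    (fun W => ⟨W.1.attach.map (fun a => ⟨a.1, hS W a.1 a.2⟩), by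
      rw [List.length_map, List.length_attach, W.2.wt]⟩) ?_
  intro W V h
  have h' := congrArg (fun l => l.1.map Subtype.val) h
  simp only [List.map_map] at h'
  apply Subtype.ext
  exact (List.attach_map_subtype_val W.1).symm.trans (h'.trans (List.attach_map_subtype_val V.1))

/-- The smallest argument of a letter. -/
noncomputable def mn (x : ℕ × Finset ℕ) : ℕ := sInf (x.2 : Set ℕ)

theorem mn_mem {x : ℕ × Finset ℕ} (h : x.2.Nonempty) : mn x ∈ x.2 :=
  Nat.sInf_mem (s := (x.2 : Set ℕ)) h

theorem mn_le {x : ℕ × Finset ℕ} {i : ℕ} (h : i ∈ x.2) : mn x ≤ i :=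
  Nat.sInf_le (s := (x.2 : Set ℕ)) h

theorem mn_singleton (p a : ℕ) : mn (p, {a}) = a := by simp [mn]

theorem IsWord.nonempty {l : List (ℕ × Finset ℕ)} {z : Lab} (h : IsWord (hycGens κ) l z)
    {x : ℕ × Finset ℕ} (hx : x ∈ l) : x.2.Nonempty := by
  rw [← Finset.card_pos, h.card_eq hx]; omega

theorem IsWord.eq_singleton {l : List (ℕ × Finset ℕ)} {z : Lab} (h : IsWord (hycGens κ) l z)
    {x : ℕ × Finset ℕ} (hx : x ∈ l) (h0 : x.1 = 0) : x = (0, {mn x}) := by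
  have hc := h.card_eq hx
  rw [h0, zero_mul, add_zero, Finset.card_eq_one] at hc
  obtain ⟨a, ha⟩ := hc
  refine Prod.ext h0 ?_
  simp only [mn, ha]
  simp

/-- The pairs of adjacent letters which are reducible in `tHyperCom_κ`. -/
def Bad (x y : ℕ × Finset ℕ) : Prop := x.1 = 0 ∧ mn y < mn x

/-- The rank of a letter. -/
noncomputable def rk (x : ℕ × Finset ℕ) : ℕ := if x.1 = 0 then mn x + 1 else 0

/-- The pair of letters following the first `i` ones is bad. -/
def BadAt (i : ℕ) (l : List (ℕ × Finset ℕ)) : Prop :=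
  ∃ u x y v, l = u ++ x :: y :: v ∧ u.length = i ∧ Bad x y

/-- Equal lengths matter: a proper prefix is smaller, but what is appended to it could reverse the
order. -/
theorem append_lt_append_of_lt {l₁ l₂ m₁ m₂ : List ℕ} (hl : l₁.length = l₂.length)
    (h : l₁ < l₂) : l₁ ++ m₁ < l₂ ++ m₂ := by
  induction l₁ generalizing l₂ with
  | nil => cases l₂ with
    | nil => exact absurd h (lt_irrefl _)
    | cons => simp at hl
  | cons a l₁ ih => cases l₂ with
    | nil => simp at hl
    | cons b l₂ =>
      rw [List.cons_append, List.cons_append, List.cons_lt_cons_iff]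
      rcases List.cons_lt_cons_iff.1 h with h | ⟨h, h'⟩
      · exact Or.inl h
      · exact Or.inr ⟨h, ih (by simpa using hl) h'⟩

theorem append_lt_append_left {m₁ m₂ : List ℕ} (l : List ℕ) (h : m₁ < m₂) :
    l ++ m₁ < l ++ m₂ := by
  induction l with
  | nil => exact h
  | cons a l ih => exact List.cons_lt_cons_iff.2 (Or.inr ⟨rfl, ih⟩)

theorem IsWord.eq_of_singletons {x y : ℕ × Finset ℕ} {z : Lab}
    (hx : IsWord (hycGens κ) [x] z) (hy : IsWord (hycGens κ) [y] z) : x = y := by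
  have h1 := hx.deg
  rw [← hy.deg] at h1
  simp only [hycGens, List.map_cons, List.map_nil, List.sum_cons, List.sum_nil] at h1
  refine Prod.ext (by omega) ?_
  ext i
  have h2 := hx.supp i
  rw [hy.supp i] at h2
  simpa using h2.symm

theorem mn_le_of_chain {x : ℕ × Finset ℕ} {U : List (ℕ × Finset ℕ)}
    (h : List.IsChain Bad (x :: U)) : ∀ y ∈ x :: U, mn y ≤ mn x := by
  induction U generalizing x with
  | nil => intro y hy; rw [List.mem_singleton.1 hy]
  | cons x' U ih =>
    intro y hy
    rw [List.isChain_cons_cons] at h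
    rcases List.mem_cons.1 hy with rfl | hy
    · exact le_refl _
    · exact (ih h.2 y hy).trans h.1.2.le

/-- The words `V` considered are those whose letters each contain the minimum of a letter of `U`.
The first letter of `U` has the largest of these minima, so the first letter of `V` either has
smaller rank or is the same letter; then both are removed. When `U` has a single letter, the label
determines `V`. -/
theorem eq_or_lt_of_transversal : ∀ (U V : List (ℕ × Finset ℕ)) (z : Lab),
    IsWord (hycGens κ) U z → IsWord (hycGens κ) V z → List.IsChain Bad U →
    (∀ y ∈ V, ∃ x ∈ U, mn x ∈ y.2) → V = U ∨ V.map rk < U.map rk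
  | [], V, z, hU, hV, _, _ => by
    left
    exact List.length_eq_zero_iff.1 (by rw [hV.wt, ← hU.wt]; rfl)
  | [x], V, z, hU, hV, _, _ => by
    left
    obtain ⟨y, rfl⟩ := List.length_eq_one_iff.1 (show V.length = 1 by rw [hV.wt, ← hU.wt]; rfl)
    rw [hU.eq_of_singletons hV]
  | x :: x' :: U, [], z, hU, hV, _, _ => by
    have := hU.wt; rw [← hV.wt] at this; simp at this
  | x :: x' :: U, y :: V, z, hU, hV, hc, ht => by
    have hm := mn_le_of_chain hc
    rw [List.isChain_cons_cons] at hc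
    have hx : x = (0, {mn x}) := hU.eq_singleton List.mem_cons_self hc.1.1
    have hrx : rk x = mn x + 1 := by rw [rk, if_pos hc.1.1]
    by_cases hlt : rk y < rk x
    · right
      rw [List.map_cons, List.map_cons, List.cons_lt_cons_iff]
      exact Or.inl hlt
    -- Here `rk y` is at least `mn x + 1`, hence positive, so `y` is a singleton. Its point is the
    -- minimum of a letter of `U`, therefore at most `mn x`, which forces equality.
    have hy0 : y.1 = 0 := by
      by_contra h
      rw [rk, if_neg h] at hlt
      omega
    have hy : y = (0, {mn y}) := hV.eq_singleton List.mem_cons_self hy0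
    obtain ⟨x₀, hx₀, hx₀'⟩ := ht y List.mem_cons_self
    have hxy : y = x := by
      rw [hy] at hx₀'
      have h1 : mn x₀ = mn y := by simpa using hx₀'
      have h2 := hm x₀ hx₀
      rw [rk, if_pos hy0, hrx] at hlt
      have e : mn y = mn x := by omega
      exact hy.trans ((congrArg (fun a : ℕ => (0, ({a} : Finset ℕ))) e).trans hx.symm)
    subst hxy
    obtain ⟨u, v, s, hu, hv⟩ := IsWord.of_append (l := [y]) (m := x' :: U) hU
    have hv' := IsWord.left_of_append (l := [y]) (m := V) s hV hu
    have hd := hV.disj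
    rw [List.pairwise_cons] at hd
    -- The remaining letters of `V` are disjoint from the common first letter, so the minima that
    -- they contain come from the rest of `U`.
    rcases eq_or_lt_of_transversal (x' :: U) V v hv hv' hc.2 (by
      intro y' hy'
      obtain ⟨x₁, hx₁, hx₁'⟩ := ht y' (List.mem_cons_of_mem _ hy')
      rcases List.mem_cons.1 hx₁ with rfl | hx₁
      · exact absurd hx₁' (Finset.disjoint_left.1 (hd.1 y' hy')
          (mn_mem (hV.nonempty List.mem_cons_self)))
      · exact ⟨x₁, hx₁, hx₁'⟩) with h | h
    · left; rw [h]
    · right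
      rw [List.map_cons, List.map_cons, List.cons_lt_cons_iff]
      exact Or.inr ⟨rfl, h⟩

/-- The decomposition of a word as a maximal run of bad pairs followed by the rest. -/
theorem exists_run : ∀ (x : ℕ × Finset ℕ) (l : List (ℕ × Finset ℕ)), ∃ U l' : List (ℕ × Finset ℕ),
    x :: l = (x :: U) ++ l' ∧ List.IsChain Bad (x :: U) ∧
    ∀ u a b v, x :: U = u ++ [a] → l' = b :: v → ¬ Bad a b
  | x, [] => ⟨[], [], rfl, List.isChain_singleton x, fun _ _ _ _ _ h => by simp at h⟩
  | x, y :: l => by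
    obtain ⟨U, l', h1, h2, h3⟩ := exists_run y l
    by_cases hb : Bad x y
    · refine ⟨y :: U, l', by rw [h1]; rfl, List.isChain_cons_cons.2 ⟨hb, h2⟩, ?_⟩
      intro u a b v hu hl
      cases u with
      | nil => simp at hu
      | cons c u => exact h3 u a b v (List.cons.inj hu).2 hl
    · refine ⟨[], y :: l, rfl, List.isChain_singleton x, ?_⟩
      intro u a b v hu hl
      cases u with
      | nil =>
        simp only [List.nil_append, List.cons.injEq, and_true] at hu hl
        rw [← hu, ← hl.1]; exact hb
      | cons c u => simp at hu

/-- The pair at the junction is not bad, so a bad pair lies on one side. On the left only its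
position is recorded, which is enough when `U` is a run of bad pairs. -/
theorem BadAt.append {U W : List (ℕ × Finset ℕ)} {i : ℕ} (h : BadAt i (U ++ W))
    (hj : ∀ u a b v, U = u ++ [a] → W = b :: v → ¬ Bad a b) :
    i + 1 < U.length ∨ (U.length ≤ i ∧ BadAt (i - U.length) W) := by
  obtain ⟨u, x, y, v, e, hi, hb⟩ := h
  rcases List.append_eq_append_iff.1 e with ⟨c, h1, h2⟩ | ⟨c, h1, h2⟩
  · right
    rw [h1] at hi
    rw [List.length_append] at hi
    exact ⟨by omega, c, x, y, v, h2, by omega, hb⟩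
  · match c, h1, h2 with
    | [], h1, h2 =>
      right
      rw [List.append_nil] at h1
      rw [← h1] at hi
      exact ⟨by omega, [], x, y, v, h2.symm, by simp [hi], hb⟩
    | [a], h1, h2 =>
      simp only [List.cons_append, List.nil_append, List.cons.injEq] at h2
      exact absurd hb (hj u x y v (by rw [h1, h2.1]) h2.2.symm)
    | a :: b :: c, h1, h2 =>
      left
      rw [h1, List.length_append]
      simp only [List.length_cons]
      omega

/-- The label sees two adjacent letters only through their union and the sum of their indices. All
terms of a gravity equation therefore have the same label. -/
theorem IsWord.pair_congr {u v : List (ℕ × Finset ℕ)} {p q p' q' : ℕ} {I J I' J' : Finset ℕ}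
    {z : Lab} (h : IsWord (hycGens κ) (u ++ (p, I) :: (q, J) :: v) z)
    (hI : I'.card = 1 + p' * (κ - 1)) (hJ : J'.card = 1 + q' * (κ - 1)) (hd : Disjoint I' J')
    (hN : I' ∪ J' = I ∪ J) (hp : p' + q' = p + q) :
    IsWord (hycGens κ) (u ++ (p', I') :: (q', J') :: v) z := by
  have hN' : ∀ i, (i ∈ I' ∨ i ∈ J') ↔ (i ∈ I ∨ i ∈ J) := by
    intro i
    rw [← Finset.mem_union, hN, Finset.mem_union]
  refine ⟨?_, ?_, ?_, ?_, ?_⟩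
  · intro a ha
    simp only [List.mem_append, List.mem_cons] at ha
    rcases ha with ha | rfl | rfl | ha
    · exact h.has a (by simp [ha])
    · exact hI
    · exact hJ
    · exact h.has a (by simp [ha])
  · have hd' := h.disj
    simp only [List.pairwise_append, List.pairwise_cons, List.mem_cons, forall_eq_or_imp] at hd' ⊢
    obtain ⟨h1, ⟨⟨_, h2⟩, h3, h4⟩, h5⟩ := hd'
    have dis : ∀ K : Finset ℕ, Disjoint I K → Disjoint J K → Disjoint I' K ∧ Disjoint J' K := by
      intro K hK hK'
      have : Disjoint (I' ∪ J') K := by rw [hN]; exact Finset.disjoint_union_left.2 ⟨hK, hK'⟩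
      exact Finset.disjoint_union_left.1 this
    refine ⟨h1, ⟨⟨hd, fun a ha => (dis _ (h2 a ha) (h3 a ha)).1⟩,
      fun a ha => (dis _ (h2 a ha) (h3 a ha)).2, h4⟩, fun a ha => ?_⟩
    obtain ⟨h6, h7, h8⟩ := h5 a ha
    have := dis a.2 h6.symm h7.symm
    exact ⟨this.1.symm, this.2.symm, h8⟩
  · intro i
    rw [h.supp i]
    simp only [List.mem_append, List.mem_cons, or_and_right, exists_or, exists_eq_left]
    have := hN' i
    rw [← or_assoc (a := i ∈ I), ← this, or_assoc]
  · rw [← h.deg, sum_deg_hycGens, sum_deg_hycGens]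
    simp only [List.map_append, List.map_cons, List.sum_append, List.sum_cons]
    congr 2
    omega
  · rw [← h.wt]; simp

theorem IsWord.pair {u v : List (ℕ × Finset ℕ)} {p q : ℕ} {I J : Finset ℕ}
    {z : Lab} (h : IsWord (hycGens κ) (u ++ (p, I) :: (q, J) :: v) z) :
    I.card = 1 + p * (κ - 1) ∧ J.card = 1 + q * (κ - 1) ∧ Disjoint I J ∧
      (I ∪ J).card = 2 + (p + q) * (κ - 1) := by
  have h1 := h.card_eq (x := (p, I)) (by simp)
  have h2 := h.card_eq (x := (q, J)) (by simp)
  have h3 : Disjoint I J := by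
    have hd := h.disj
    simp only [List.pairwise_append, List.pairwise_cons, List.mem_cons, forall_eq_or_imp] at hd
    exact hd.2.1.1.1
  refine ⟨h1, h2, h3, ?_⟩
  rw [Finset.card_union_of_disjoint h3]
  simp only at h1 h2
  rw [h1, h2]; ring

theorem IsWord.pair_single {u v : List (ℕ × Finset ℕ)} {p q : ℕ} {I J : Finset ℕ}
    {z : Lab} (h : IsWord (hycGens κ) (u ++ (p, I) :: (q, J) :: v) z) {a : ℕ} (ha : a ∈ I ∪ J) :
    IsWord (hycGens κ) (u ++ (0, {a}) :: (p + q, (I ∪ J) \ {a}) :: v) z := by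
  obtain ⟨h1, h2, h3, h4⟩ := h.pair
  have ha' : {a} ⊆ I ∪ J := Finset.singleton_subset_iff.2 ha
  refine h.pair_congr (by simp) ?_ (Finset.disjoint_sdiff) ?_ (zero_add _)
  · rw [Finset.card_sdiff_of_subset ha', h4, Finset.card_singleton]; omega
  · exact Finset.union_sdiff_of_subset ha'

end Combinatorics

/-! ### The gravity equations on coefficients of words. -/

section Gravity

variable {k : Type u} [Field k] {κ : ℕ}

/-- The gravity equations for the letters number `i` and `i + 1` of the arguments of a
function of words. -/
def IsGrav (κ i : ℕ) (F : List (ℕ × Finset ℕ) → k) : Prop :=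
  ∀ u v : List (ℕ × Finset ℕ), u.length = i →
    (∀ (p q : ℕ) (I J : Finset ℕ), 0 < p → I.card = 1 + p * (κ - 1) → J.card = 1 + q * (κ - 1) →
      Disjoint I J → F (u ++ (p, I) :: (q, J) :: v) =
        ∑ a ∈ I, F (u ++ (0, {a}) :: (p + q, (I ∪ J) \ {a}) :: v)) ∧
    ∀ (D : ℕ) (N : Finset ℕ), N.card = 2 + D * (κ - 1) →
      ∑ a ∈ N, F (u ++ (0, {a}) :: (D, N \ {a}) :: v) = 0

/-- The combinations of words whose coefficients satisfy the gravity equations. -/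
def Grav (k : Type u) [Field k] (κ i : ℕ) (z : Lab) : Submodule k (Word (hycGens κ) z →₀ k) where
  carrier := {f | IsGrav κ i (fun l => cf l f)}
  add_mem' := by
    intro f g hf hg u v hu
    refine ⟨fun p q I J h1 h2 h3 h4 => ?_, fun D N h => ?_⟩
    · simp only [map_add, Finset.sum_add_distrib]
      exact congrArg₂ (· + ·) ((hf u v hu).1 p q I J h1 h2 h3 h4) ((hg u v hu).1 p q I J h1 h2 h3 h4)
    · simp only [map_add, Finset.sum_add_distrib]
      exact (congrArg₂ (· + ·) ((hf u v hu).2 D N h) ((hg u v hu).2 D N h)).trans (add_zero _)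
  zero_mem' := by
    intro u v _
    simp
  smul_mem' := by
    intro c f hf u v hu
    refine ⟨fun p q I J h1 h2 h3 h4 => ?_, fun D N h => ?_⟩
    · simp only [map_smul, ← Finset.smul_sum]
      exact congrArg (c • ·) ((hf u v hu).1 p q I J h1 h2 h3 h4)
    · simp only [map_smul, ← Finset.smul_sum]
      exact (congrArg (c • ·) ((hf u v hu).2 D N h)).trans (smul_zero _)

/-- Coefficients of a product factor, and an equation between the letters of the second factor is
multiplied by a coefficient of the first one. -/
theorem grav_left {x y z : Lab} (s : Splits z x y) (i : ℕ) (f : Word (hycGens κ) x →₀ k)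
    {g : Word (hycGens κ) y →₀ k} (hg : g ∈ Grav k κ i y) :
    freeMul k (hycGens κ) s f g ∈ Grav k κ (x.wt + i) z := by
  intro u v hu
  have hu' : (u.drop x.wt).length = i := by rw [List.length_drop]; omega
  have e : ∀ a b : ℕ × Finset ℕ, cf (u ++ a :: b :: v) (freeMul k (hycGens κ) s f g) =
      cf (u.take x.wt) f * cf (u.drop x.wt ++ a :: b :: v) g := by
    intro a b
    rw [cf_freeMul, List.take_append_of_le_length (by omega),
      List.drop_append_of_le_length (by omega)]
  simp only [e, ← Finset.mul_sum]
  refine ⟨fun p q I J h1 h2 h3 h4 => ?_, fun D N h => ?_⟩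
  · exact congrArg (_ * ·) ((hg _ v hu').1 p q I J h1 h2 h3 h4)
  · exact (congrArg (_ * ·) ((hg _ v hu').2 D N h)).trans (mul_zero _)

theorem grav_right {x y z : Lab} (s : Splits z x y) (i : ℕ) {f : Word (hycGens κ) x →₀ k}
    (g : Word (hycGens κ) y →₀ k) (hi : i + 1 < x.wt) (hf : f ∈ Grav k κ i x) :
    freeMul k (hycGens κ) s f g ∈ Grav k κ i z := by
  intro u v hu
  have e : ∀ a b : ℕ × Finset ℕ, cf (u ++ a :: b :: v) (freeMul k (hycGens κ) s f g) =
      cf (u ++ a :: b :: v.take (x.wt - (i + 2))) f * cf (v.drop (x.wt - (i + 2))) g := by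
    intro a b
    rw [cf_freeMul]
    obtain ⟨m, hm⟩ : ∃ m, x.wt = i + (m + 2) := ⟨x.wt - (i + 2), by omega⟩
    rw [hm, ← hu, List.take_length_add_append, List.drop_length_add_append,
      show u.length + (m + 2) - (u.length + 2) = m by omega]
    rfl
  simp only [e, ← Finset.sum_mul]
  refine ⟨fun p q I J h1 h2 h3 h4 => ?_, fun D N h => ?_⟩
  · exact congrArg (· * _) ((hf _ _ hu).1 p q I J h1 h2 h3 h4)
  · exact (congrArg (· * _) ((hf _ _ hu).2 D N h)).trans (zero_mul _)

/-- An element of `Grav` is determined by the coefficients of the words with a bad pair. -/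
theorem grav_eq_zero {z : Lab} {i : ℕ} (hi : i + 1 < z.wt) {f : Word (hycGens κ) z →₀ k}
    (hf : f ∈ Grav k κ i z) (h : ∀ l, BadAt i l → cf l f = 0) : f = 0 := by
  apply cf_ext
  intro l
  rw [map_zero]
  by_cases hl : IsWord (hycGens κ) l z
  swap
  · exact cf_of_not_isWord hl f
  obtain ⟨u, p, I, q, J, v, rfl, hu⟩ : ∃ u p I q J v, l = u ++ (p, I) :: (q, J) :: v ∧
      u.length = i := by
    have hl' := hl.wt
    refine ⟨l.take i, (l[i]'(by omega)).1, (l[i]'(by omega)).2, (l[i + 1]'(by omega)).1,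
      (l[i + 1]'(by omega)).2, l.drop (i + 2), ?_, by rw [List.length_take]; omega⟩
    conv_lhs => rw [← List.take_append_drop i l, List.drop_eq_getElem_cons (by omega),
      List.drop_eq_getElem_cons (by omega)]
  obtain ⟨h1, h2, h3, h4⟩ := hl.pair
  have hne : (I ∪ J).Nonempty := by rw [← Finset.card_pos, h4]; omega
  set m := mn (0, I ∪ J)
  have hm : m ∈ I ∪ J := mn_mem (x := (0, I ∪ J)) hne
  -- Removing a point other than the minimum `m` leaves `m` in the second letter, so the pair is bad
  -- and its coefficient vanishes by hypothesis.
  have key : ∀ a ∈ I ∪ J, a ≠ m → cf (u ++ (0, {a}) :: (p + q, (I ∪ J) \ {a}) :: v) f = 0 := by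
    intro a ha ham
    refine h _ ⟨u, _, _, v, rfl, hu, rfl, ?_⟩
    rw [mn_singleton]
    have h5 : m ≤ a := mn_le (x := (0, I ∪ J)) ha
    have h6 : mn (p + q, (I ∪ J) \ {a}) ≤ m :=
      mn_le (x := (p + q, (I ∪ J) \ {a})) (by simpa using ⟨by simpa using hm, Ne.symm ham⟩)
    omega
  -- The equation for the total set expresses the one remaining coefficient, that of `a = m`,
  -- through those already known to vanish.
  have key' : ∀ a ∈ I ∪ J, cf (u ++ (0, {a}) :: (p + q, (I ∪ J) \ {a}) :: v) f = 0 := by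
    intro a ha
    by_cases ham : a = m
    · subst ham
      have := (hf u v hu).2 (p + q) (I ∪ J) h4
      rwa [Finset.sum_eq_single_of_mem _ hm key] at this
    · exact key a ha ham
  rcases Nat.eq_zero_or_pos p with hp | hp
  · subst hp
    rw [zero_mul, add_zero, Finset.card_eq_one] at h1
    obtain ⟨a, rfl⟩ := h1
    have := key' a (by simp)
    rw [zero_add] at this
    rwa [show J = ({a} ∪ J) \ {a} by rw [Finset.union_sdiff_cancel_left h3]]
  · have := (hf u v hu).1 p q I J hp h1 h2 h3
    simp only at this
    rw [this]
    exact Finset.sum_eq_zero fun a ha => key' a (Finset.mem_union_left _ ha)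

end Gravity

/-! ### Minors of incidence matrices: solutions of all gravity equations with a known leading word.
-/

section Minors

variable {k : Type u} [Field k] {κ : ℕ}

/-- Since `B v v = 0`, each term equals `B (χ a)` at the total sum over `N`. Adding these up over
`I` and discarding the contribution of `I` against itself gives the right-hand side. This is the
first gravity equation; for `I = N` the result is zero, which is the second one. -/
theorem alternating_sum_left {V : Type*} [AddCommGroup V] [Module k V] (B : V →ₗ[k] V →ₗ[k] k)
    (hB : ∀ v, B v v = 0) (χ : ℕ → V) (I N : Finset ℕ) (hIN : I ⊆ N) :
    ∑ a ∈ I, B (∑ i ∈ {a}, χ i) (∑ i ∈ N \ {a}, χ i) = B (∑ i ∈ I, χ i) (∑ i ∈ N \ I, χ i) := by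
  have e : ∀ a ∈ I, B (∑ i ∈ {a}, χ i) (∑ i ∈ N \ {a}, χ i) = B (χ a) (∑ i ∈ N, χ i) := by
    intro a ha
    rw [← Finset.sum_sdiff (Finset.singleton_subset_iff.2 (hIN ha)), map_add,
      Finset.sum_singleton, hB, add_zero]
  rw [Finset.sum_congr rfl e, ← LinearMap.sum_apply, ← map_sum, ← Finset.sum_sdiff hIN, map_add,
    hB, add_zero]

/-- The indicator function of a set, on a sequence of points. -/
def indic (k : Type u) [Field k] (a : ℕ → ℕ) (n : ℕ) (I : Finset ℕ) : Fin n → k :=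
  fun s => if a s ∈ I then 1 else 0

theorem indic_eq_sum (a : ℕ → ℕ) (n : ℕ) (I : Finset ℕ) :
    indic k a n I = ∑ i ∈ I, fun s : Fin n => if a s = i then (1 : k) else 0 := by
  funext s
  rw [Finset.sum_apply, Finset.sum_ite_eq]
  rfl

/-- The incidence matrix of a sequence of points and a sequence of letters. -/
def incidence (k : Type u) [Field k] (a : ℕ → ℕ) (n : ℕ) (l : List (ℕ × Finset ℕ)) :
    Matrix (Fin n) (Fin n) k :=
  Matrix.of fun t => indic k a n (l.getD t (0, ∅)).2

/-- The determinant of a matrix, as a bilinear function of two of its rows. -/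
noncomputable def twoRows {n : ℕ} (M : Matrix (Fin n) (Fin n) k) {i j : Fin n} (h : i ≠ j) :
    (Fin n → k) →ₗ[k] (Fin n → k) →ₗ[k] k :=
  LinearMap.mk₂ k (fun p q => ((M.updateRow i p).updateRow j q).det)
    (fun p p' q => by
      rw [Matrix.updateRow_comm _ h, Matrix.det_updateRow_add, Matrix.updateRow_comm _ h.symm,
        Matrix.updateRow_comm _ h.symm])
    (fun c p q => by
      rw [Matrix.updateRow_comm _ h, Matrix.det_updateRow_smul, Matrix.updateRow_comm _ h.symm]
      rfl)
    (fun p q q' => by rw [Matrix.det_updateRow_add])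
    (fun c p q => by rw [Matrix.det_updateRow_smul]; rfl)

theorem twoRows_self {n : ℕ} (M : Matrix (Fin n) (Fin n) k) {i j : Fin n} (h : i ≠ j)
    (p : Fin n → k) : twoRows M h p p = 0 := by
  refine Matrix.det_zero_of_row_eq h ?_
  rw [Matrix.updateRow_ne h, Matrix.updateRow_self, Matrix.updateRow_self]

/-- Only the rows `i = u.length` and `j = u.length + 1` depend on `x` and `y`; the empty sets on the
right are placeholders that are overwritten. -/
theorem det_incidence (a : ℕ → ℕ) {n : ℕ} (u v : List (ℕ × Finset ℕ)) (i j : Fin n) (h : i ≠ j)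
    (hi : u.length = i) (hj : u.length + 1 = j) (x y : ℕ × Finset ℕ) :
    (incidence k a n (u ++ x :: y :: v)).det =
      twoRows (incidence k a n (u ++ (0, ∅) :: (0, ∅) :: v)) h (indic k a n x.2)
        (indic k a n y.2) := by
  simp only [twoRows, LinearMap.mk₂_apply]
  congr 1
  refine funext fun t => ?_
  by_cases htj : t = j
  · subst htj
    rw [Matrix.updateRow_self]
    change indic k a n ((u ++ x :: y :: v).getD t (0, ∅)).2 = _
    rw [← hj, List.getD_append_right _ _ _ _ (by omega)]
    simp
  rw [Matrix.updateRow_ne htj]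
  by_cases hti : t = i
  · subst hti
    rw [Matrix.updateRow_self]
    change indic k a n ((u ++ x :: y :: v).getD t (0, ∅)).2 = _
    rw [← hi, List.getD_append_right _ _ _ _ (by omega)]
    simp
  rw [Matrix.updateRow_ne hti]
  change indic k a n ((u ++ x :: y :: v).getD t (0, ∅)).2 =
    indic k a n ((u ++ (0, ∅) :: (0, ∅) :: v).getD t (0, ∅)).2
  congr 2
  have h1 : (t : ℕ) ≠ u.length := fun e => hti (Fin.ext (by omega))
  have h2 : (t : ℕ) ≠ u.length + 1 := fun e => htj (Fin.ext (by omega))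
  rcases lt_or_ge (t : ℕ) u.length with h3 | h3
  · rw [List.getD_append _ _ _ _ h3, List.getD_append _ _ _ _ h3]
  · rw [List.getD_append_right _ _ _ _ h3, List.getD_append_right _ _ _ _ h3]
    obtain ⟨m, hm⟩ : ∃ m, (t : ℕ) - u.length = m + 2 := ⟨t - u.length - 2, by omega⟩
    rw [hm]
    rfl

/-- The combination of words whose coefficients are minors of incidence matrices. -/
noncomputable def minor (k : Type u) [Field k] (κ : ℕ) (a : ℕ → ℕ) (z : Lab) :
    Word (hycGens κ) z →₀ k :=
  Finsupp.equivFunOnFinite.symm fun W => (incidence k a z.wt W.1).det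

open Classical in
theorem cf_minor (a : ℕ → ℕ) (z : Lab) (l : List (ℕ × Finset ℕ)) :
    cf l (minor k κ a z) = if IsWord (hycGens κ) l z then (incidence k a z.wt l).det else 0 := by
  by_cases h : IsWord (hycGens κ) l z
  · rw [if_pos h, cf_of_isWord h]; rfl
  · rw [if_neg h, cf_of_not_isWord h]

/-- The determinant is an alternating bilinear function of the indicator functions of two adjacent
letters, and indicator functions are additive in the set; `alternating_sum_left` does the rest. -/
theorem minor_mem_grav (a : ℕ → ℕ) (z : Lab) (i : ℕ) : minor k κ a z ∈ Grav k κ i z := by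
  classical
  intro u v hu
  -- Either all the lists in a gravity equation are words of label `z` or none is, so the case
  -- distinctions in `cf_minor` agree throughout the equation.
  have single : ∀ {D : ℕ} {N : Finset ℕ}, N.card = 2 + D * (κ - 1) → ∀ {a}, a ∈ N →
      ∀ {p q : ℕ} {I J : Finset ℕ}, p + q = D → I ∪ J = N → Disjoint I J →
      I.card = 1 + p * (κ - 1) → J.card = 1 + q * (κ - 1) →
      (IsWord (hycGens κ) (u ++ (0, {a}) :: (D, N \ {a}) :: v) z ↔
        IsWord (hycGens κ) (u ++ (p, I) :: (q, J) :: v) z) := by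
    intro D N hN a ha p q I J hpq hIJ hd h1 h2
    have ha' : {a} ⊆ N := Finset.singleton_subset_iff.2 ha
    constructor
    · intro h
      refine h.pair_congr h1 h2 hd ?_ (by omega)
      rw [hIJ, Finset.union_sdiff_of_subset ha']
    · intro h
      subst hIJ hpq
      exact h.pair_single ha
  have main : ∀ (p q : ℕ) (I J : Finset ℕ), IsWord (hycGens κ) (u ++ (p, I) :: (q, J) :: v) z →
      ∃ B : (Fin z.wt → k) →ₗ[k] (Fin z.wt → k) →ₗ[k] k, (∀ p, B p p = 0) ∧
        ∀ x y, (incidence k a z.wt (u ++ x :: y :: v)).det =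
          B (∑ i ∈ x.2, fun s : Fin z.wt => if a s = i then (1 : k) else 0)
            (∑ i ∈ y.2, fun s : Fin z.wt => if a s = i then (1 : k) else 0) := by
    intro p q I J h
    have hw := h.wt
    simp only [List.length_append, List.length_cons] at hw
    have hne : (⟨u.length, by omega⟩ : Fin z.wt) ≠ ⟨u.length + 1, by omega⟩ := by
      simp [Fin.ext_iff]
    refine ⟨twoRows (incidence k a z.wt (u ++ (0, ∅) :: (0, ∅) :: v)) hne,
      twoRows_self _ hne, fun x y => ?_⟩
    rw [det_incidence a u v _ _ hne rfl rfl, indic_eq_sum, indic_eq_sum]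
  simp only [cf_minor]
  refine ⟨fun p q I J h1 h2 h3 h4 => ?_, fun D N h => ?_⟩
  · have hN : (I ∪ J).card = 2 + (p + q) * (κ - 1) := by
      rw [Finset.card_union_of_disjoint h4, h2, h3]; ring
    by_cases hw : IsWord (hycGens κ) (u ++ (p, I) :: (q, J) :: v) z
    · obtain ⟨B, hB, hB'⟩ := main p q I J hw
      rw [if_pos hw, hB']
      have e : ∀ b ∈ I, (if IsWord (hycGens κ) (u ++ (0, {b}) :: (p + q, (I ∪ J) \ {b}) :: v) z then
          (incidence k a z.wt (u ++ (0, {b}) :: (p + q, (I ∪ J) \ {b}) :: v)).det else 0) = _ :=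
        fun b hb => by
          rw [if_pos ((single hN (Finset.mem_union_left _ hb) rfl rfl h4 h2 h3).2 hw), hB']
      rw [Finset.sum_congr rfl e, alternating_sum_left B hB _ I _ Finset.subset_union_left,
        Finset.union_sdiff_cancel_left h4]
    · rw [if_neg hw]
      refine (Finset.sum_eq_zero fun b hb => if_neg fun hw' => hw ?_).symm
      exact (single hN (Finset.mem_union_left _ hb) rfl rfl h4 h2 h3).1 hw'
  · obtain ⟨b, hb⟩ : N.Nonempty := by rw [← Finset.card_pos, h]; omega
    have hb' : {b} ⊆ N := Finset.singleton_subset_iff.2 hb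
    have e0 : ∀ c ∈ N, (IsWord (hycGens κ) (u ++ (0, {c}) :: (D, N \ {c}) :: v) z ↔
        IsWord (hycGens κ) (u ++ (0, {b}) :: (D, N \ {b}) :: v) z) := fun c hc =>
      single h hc (zero_add _) (Finset.union_sdiff_of_subset hb') Finset.disjoint_sdiff (by simp)
        (by rw [Finset.card_sdiff_of_subset hb', h, Finset.card_singleton]; omega)
    by_cases hw : IsWord (hycGens κ) (u ++ (0, {b}) :: (D, N \ {b}) :: v) z
    · obtain ⟨B, hB, hB'⟩ := main _ _ _ _ hw
      have e : ∀ c ∈ N, (if IsWord (hycGens κ) (u ++ (0, {c}) :: (D, N \ {c}) :: v) z then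
          (incidence k a z.wt (u ++ (0, {c}) :: (D, N \ {c}) :: v)).det else 0) = _ :=
        fun c hc => by rw [if_pos ((e0 c hc).2 hw), hB']
      rw [Finset.sum_congr rfl e, alternating_sum_left B hB _ N _ subset_rfl, Finset.sdiff_self,
        Finset.sum_empty, map_zero]
    · exact Finset.sum_eq_zero fun c hc => if_neg fun hw' => hw ((e0 c hc).1 hw')

/-- The smallest arguments of the letters of a word. -/
noncomputable def mins (U : List (ℕ × Finset ℕ)) (s : ℕ) : ℕ := mn (U.getD s (0, ∅))

/-- The letters are disjoint, so the minimum of one letter lies in no other one and the incidence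
matrix is the identity. -/
theorem cf_minor_self {U : List (ℕ × Finset ℕ)} {z : Lab} (hU : IsWord (hycGens κ) U z) :
    cf U (minor k κ (mins U) z) = 1 := by
  classical
  rw [cf_minor, if_pos hU, ← Matrix.det_one (n := Fin z.wt)]
  congr 1
  ext t s
  have hmem : ∀ s : Fin z.wt, U.getD s (0, ∅) ∈ U := by
    intro s
    rw [List.getD_eq_getElem _ _ (by rw [hU.wt]; exact s.2)]
    exact List.getElem_mem _
  have hm : ∀ s : Fin z.wt, mins U s ∈ (U.getD s (0, ∅)).2 := fun s =>
    mn_mem (hU.nonempty (hmem s))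
  change (if mins U s ∈ (U.getD t (0, ∅)).2 then (1 : k) else 0) = _
  by_cases hts : t = s
  · subst hts
    rw [if_pos (hm t), Matrix.one_apply_eq]
  · rw [Matrix.one_apply_ne hts, if_neg]
    intro h
    have hd := List.pairwise_iff_getElem.1 hU.disj
    have h1 : (t : ℕ) < U.length := by rw [hU.wt]; exact t.2
    have h2 : (s : ℕ) < U.length := by rw [hU.wt]; exact s.2
    have h3 := hm s
    rw [List.getD_eq_getElem _ _ h1] at h
    rw [List.getD_eq_getElem _ _ h2] at h3
    rcases lt_or_gt_of_ne (fun e => hts (Fin.ext e) : (t : ℕ) ≠ s) with h4 | h4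
    · exact Finset.disjoint_left.1 (hd t s h1 h2 h4) h h3
    · exact Finset.disjoint_left.1 (hd s t h2 h1 h4) h3 h

/-- A non-zero determinant has no zero row, so every letter of `V` contains the minimum of some
letter of `U`, as `eq_or_lt_of_transversal` requires. -/
theorem eq_or_lt_of_cf_minor {U V : List (ℕ × Finset ℕ)} {z : Lab}
    (hU : IsWord (hycGens κ) U z) (hc : U.IsChain Bad) (hV : cf V (minor k κ (mins U) z) ≠ 0) :
    V = U ∨ V.map rk < U.map rk := by
  classical
  have hVw := isWord_of_cf_ne_zero hV
  rw [cf_minor, if_pos hVw] at hV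
  refine eq_or_lt_of_transversal U V z hU hVw hc fun y hy => ?_
  obtain ⟨t, ht, rfl⟩ := List.getElem_of_mem hy
  by_contra! hn
  refine hV (Matrix.det_eq_zero_of_row_eq_zero ⟨t, by rw [← hVw.wt]; exact ht⟩ fun s => ?_)
  have h1 : (s : ℕ) < U.length := by rw [hU.wt]; exact s.2
  change (if mins U s ∈ (V.getD t (0, ∅)).2 then (1 : k) else 0) = 0
  rw [if_neg]
  rw [List.getD_eq_getElem _ _ ht, mins, List.getD_eq_getElem _ _ h1]
  exact hn _ (List.getElem_mem h1)

/-- Every word is the leading term of an element satisfying the gravity equations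
for all its bad pairs. -/
theorem exists_leading : ∀ (n : ℕ) (W : List (ℕ × Finset ℕ)) (z : Lab), W.length = n →
    IsWord (hycGens κ) W z → ∃ f : Word (hycGens κ) z →₀ k, cf W f = 1 ∧
      (∀ V, cf V f ≠ 0 → V = W ∨ V.map rk < W.map rk) ∧ ∀ i, BadAt i W → f ∈ Grav k κ i z := by
  classical
  intro n
  induction n using Nat.strong_induction_on with
  | _ n ih =>
  intro W z hn hW
  match W, hn, hW with
  | [], hn, hW =>
    refine ⟨Finsupp.single ⟨[], hW⟩ 1, by rw [cf_single, if_pos rfl], fun V hV => ?_, ?_⟩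
    · rw [cf_single] at hV
      exact Or.inl (of_not_not fun h => hV (if_neg (Ne.symm h)))
    · rintro i ⟨u, x, y, v, h, _⟩
      simp at h
  | x :: l, hn, hW =>
    obtain ⟨U, l', e, hc, hj⟩ := exists_run x l
    rw [e] at hW hn ⊢
    obtain ⟨z₁, z₂, s, h1, h2⟩ := hW.of_append
    obtain ⟨g, hg1, hg2, hg3⟩ := ih l'.length (by
      rw [← hn, List.length_append, List.length_cons]; omega) l' z₂ rfl h2
    have hw := h1.wt
    -- The minor of the first maximal run is multiplied by the element found inductively for the
    -- rest of the word. No equation is needed at the junction, since that pair is not bad.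
    refine ⟨freeMul k _ s (minor k κ (mins (x :: U)) z₁) g, ?_, ?_, ?_⟩
    · rw [cf_freeMul, ← hw, List.take_left, List.drop_left, cf_minor_self h1, hg1, one_mul]
    · intro V hV
      rw [cf_freeMul] at hV
      have hV1 := left_ne_zero_of_mul hV
      have hV2 := right_ne_zero_of_mul hV
      have hl : (V.take z₁.wt).length = (x :: U).length := by
        rw [(isWord_of_cf_ne_zero hV1).wt, hw]
      rw [← List.take_append_drop z₁.wt V]
      rcases eq_or_lt_of_cf_minor h1 hc hV1 with h3 | h3
      · rw [h3]
        rcases hg2 _ hV2 with h4 | h4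
        · rw [h4]; exact Or.inl rfl
        · right
          rw [List.map_append, List.map_append]
          exact append_lt_append_left _ h4
      · right
        rw [List.map_append, List.map_append]
        exact append_lt_append_of_lt (by simpa using hl) h3
    · intro i hi
      rcases hi.append hj with h3 | ⟨h3, h4⟩
      · exact grav_right s i g (by rw [← hw]; exact h3) (minor_mem_grav _ _ _)
      · rw [hw] at h3 h4
        have := grav_left s _ (minor k κ (mins (x :: U)) z₁) (hg3 _ h4)
        rwa [Nat.add_sub_cancel' h3] at this

end Minors

/-! ### A basis adapted to all spaces of relations, and the projections that it defines. -/

section Basis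

/-- Unitriangularity: in a vanishing combination, look at the leading element of greatest rank, to
which no other vector contributes. As `r` need not be injective, each vector must have no second
element of its top rank. -/
theorem linearIndependent_of_leading {k : Type*} [Field k] {α β γ : Type*} [LinearOrder γ]
    (r : β → γ) (w : α → β) (hw : Function.Injective w) (e : α → β →₀ k)
    (h1 : ∀ a, e a (w a) ≠ 0) (h2 : ∀ a c, e a c ≠ 0 → c = w a ∨ r c < r (w a)) :
    LinearIndependent k e := by
  rw [linearIndependent_iff]
  intro l hl
  by_contra hne
  obtain ⟨a, ha, hmax⟩ := l.support.exists_max_image (fun a => r (w a))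
    (Finsupp.support_nonempty_iff.2 hne)
  have h := DFunLike.congr_fun hl (w a)
  rw [Finsupp.linearCombination_apply, Finsupp.sum, Finsupp.finsetSum_apply,
    Finset.sum_eq_single_of_mem a ha] at h
  · exact mul_ne_zero (Finsupp.mem_support_iff.1 ha) (h1 a) h
  · intro b hb hba
    rw [Finsupp.smul_apply]
    by_contra hne'
    rcases h2 b (w a) (right_ne_zero_of_mul hne') with h3 | h3
    · exact hba (hw h3).symm
    · exact absurd h3 (not_lt.2 (hmax b hb))

variable {k : Type u} [Field k] {κ : ℕ}

/-- A dimension count. The leading words make the vectors `e W` independent, one for each word that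
is bad at `i`, and `Grav k κ i z` has no larger dimension. -/
theorem grav_le_span {i : ℕ} {z : Lab} (hi : i + 1 < z.wt)
    (e : {W : Word (hycGens κ) z // BadAt i W.1} → Word (hycGens κ) z →₀ k)
    (he : ∀ W, e W ∈ Grav k κ i z) (h1 : ∀ W, e W W.1 ≠ 0)
    (h2 : ∀ W c, e W c ≠ 0 → c = W.1 ∨ c.1.map rk < W.1.1.map rk) :
    Grav k κ i z ≤ Submodule.span k (Set.range e) := by
  classical
  have := Fintype.ofFinite {W : Word (hycGens κ) z // BadAt i W.1}
  have hli : LinearIndependent k e :=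
    linearIndependent_of_leading (fun c : Word (hycGens κ) z => c.1.map rk) Subtype.val
      Subtype.val_injective e h1 h2
  have hle : Submodule.span k (Set.range e) ≤ Grav k κ i z := by
    rw [Submodule.span_le]
    rintro _ ⟨W, rfl⟩
    exact he W
  -- Restriction to the coefficients of the words that are bad at `i`; it is injective by
  -- `grav_eq_zero`, which bounds the dimension from above.
  let res : Grav k κ i z →ₗ[k] ({W : Word (hycGens κ) z // BadAt i W.1} → k) :=
    LinearMap.pi fun W => (Finsupp.lapply W.1).comp (Grav k κ i z).subtype
  have hres : Function.Injective res := by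
    rintro ⟨f, hf⟩ ⟨g, hg⟩ h
    refine Subtype.ext (sub_eq_zero.1 (grav_eq_zero hi (Submodule.sub_mem _ hf hg) fun l hl => ?_))
    by_cases hlw : IsWord (hycGens κ) l z
    · rw [map_sub, cf_of_isWord hlw, cf_of_isWord hlw]
      exact sub_eq_zero.2 (congrFun h ⟨⟨l, hlw⟩, hl⟩)
    · exact cf_of_not_isWord hlw _
  have hdim := LinearMap.finrank_le_finrank_of_injective hres
  rw [Module.finrank_pi, ← finrank_span_eq_card hli] at hdim
  exact (Submodule.eq_of_le_of_finrank_le hle hdim).ge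

/-- The elements with prescribed leading words satisfying the gravity equations for the bad pairs. -/
noncomputable def leading (k : Type u) [Field k] {κ : ℕ} {z : Lab} (W : Word (hycGens κ) z) :
    Word (hycGens κ) z →₀ k := (exists_leading (k := k) _ W.1 z rfl W.2).choose

theorem leading_self {z : Lab} (W : Word (hycGens κ) z) : leading k W W = 1 := by
  rw [← cf_word]
  exact (exists_leading (k := k) _ W.1 z rfl W.2).choose_spec.1

theorem eq_or_lt_of_leading {z : Lab} (W V : Word (hycGens κ) z) (h : leading k W V ≠ 0) :
    V = W ∨ V.1.map rk < W.1.map rk := by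
  rw [← cf_word] at h
  rcases (exists_leading (k := k) _ W.1 z rfl W.2).choose_spec.2.1 V.1 h with h' | h'
  · exact Or.inl (Subtype.ext h')
  · exact Or.inr h'

theorem leading_mem {z : Lab} (W : Word (hycGens κ) z) {i : ℕ} (h : BadAt i W.1) :
    leading k W ∈ Grav k κ i z :=
  (exists_leading (k := k) _ W.1 z rfl W.2).choose_spec.2.2 i h

theorem linearIndependent_leading (z : Lab) :
    LinearIndependent k (leading k : Word (hycGens κ) z → _) :=
  linearIndependent_of_leading (fun c : Word (hycGens κ) z => c.1.map rk) id
    Function.injective_id _ (fun W => by rw [id, leading_self]; exact one_ne_zero)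
    (fun W V h => eq_or_lt_of_leading W V h)

/-- The basis of the elements `leading`. -/
noncomputable def leadingBasis (k : Type u) [Field k] (κ : ℕ) (z : Lab) :
    Module.Basis (Word (hycGens κ) z) k (Word (hycGens κ) z →₀ k) :=
  Module.Basis.mk (linearIndependent_leading z) (by
    have := Fintype.ofFinite (Word (hycGens κ) z)
    refine (Submodule.eq_top_of_finrank_eq ?_).ge
    rw [finrank_span_eq_card (linearIndependent_leading z), Module.finrank_finsupp_self])

theorem leadingBasis_apply {z : Lab} (W : Word (hycGens κ) z) :
    leadingBasis k κ z W = leading k W := Module.Basis.mk_apply _ _ _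

/-- By the dimension count, each space `Grav k κ i z` is spanned by a subset of the one basis
`leadingBasis`. This is the distributivity on which Koszulness rests. -/
theorem grav_induction {i : ℕ} {z : Lab} (hi : i + 1 < z.wt) {N : Submodule k (Word (hycGens κ) z →₀ k)}
    {φ : (Word (hycGens κ) z →₀ k) →ₗ[k] (Word (hycGens κ) z →₀ k)}
    (h : ∀ W : Word (hycGens κ) z, BadAt i W.1 → φ (leading k W) ∈ N) {f : Word (hycGens κ) z →₀ k}
    (hf : f ∈ Grav k κ i z) : φ f ∈ N := by
  have h1 : Grav k κ i z ≤ N.comap φ := by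
    refine (grav_le_span hi (fun W => leading k W.1) (fun W => leading_mem W.1 W.2)
      (fun W => by rw [leading_self]; exact one_ne_zero)
      (fun W c hc => eq_or_lt_of_leading W.1 c hc)).trans ?_
    rw [Submodule.span_le]
    rintro _ ⟨W, rfl⟩
    exact h W.1 W.2
  exact h1 hf

theorem BadAt.lt {W : List (ℕ × Finset ℕ)} {i : ℕ} (h : BadAt i W) : i + 1 < W.length := by
  obtain ⟨u, x, y, v, rfl, rfl, _⟩ := h
  simp

open Classical in
/-- The projection on the span of the elements of the basis whose first pair which is not bad is
number `i`. -/
noncomputable def firstProj (k : Type u) [Field k] (κ : ℕ) (z : Lab) (i : ℕ) :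
    (Word (hycGens κ) z →₀ k) →ₗ[k] (Word (hycGens κ) z →₀ k) :=
  (leadingBasis k κ z).constr k fun W =>
    if ¬ BadAt i W.1 ∧ ∀ j < i, BadAt j W.1 then leading k W else 0

open Classical in
theorem firstProj_leading {z : Lab} (i : ℕ) (W : Word (hycGens κ) z) :
    firstProj k κ z i (leading k W) =
      if ¬ BadAt i W.1 ∧ ∀ j < i, BadAt j W.1 then leading k W else 0 := by
  rw [← leadingBasis_apply, firstProj, Module.Basis.constr_basis, leadingBasis_apply]

/-- The projection is diagonal in a basis adapted to `Grav k κ j z`, so it preserves this space. -/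
theorem firstProj_mem {z : Lab} {i j : ℕ} (hj : j + 1 < z.wt)
    {f : Word (hycGens κ) z →₀ k} (hf : f ∈ Grav k κ j z) : firstProj k κ z i f ∈ Grav k κ j z := by
  refine grav_induction hj (fun W hW => ?_) hf
  rw [firstProj_leading]
  split_ifs
  · exact leading_mem W hW
  · exact Submodule.zero_mem _

theorem firstProj_eq_zero {z : Lab} {i : ℕ} (hi : i + 1 < z.wt)
    {f : Word (hycGens κ) z →₀ k} (hf : f ∈ Grav k κ i z) : firstProj k κ z i f = 0 := by
  refine (Submodule.mem_bot k).1 (grav_induction hi (fun W hW => ?_) hf)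
  rw [firstProj_leading, if_neg (fun h => h.1 hW)]
  exact Submodule.zero_mem _

/-- The projections account for all basis vectors except those with every pair bad, and the latter
belong to `Grav k κ j z` for every `j`. -/
theorem sub_sum_firstProj_mem {z : Lab} {j : ℕ} (hj : j + 1 < z.wt)
    (f : Word (hycGens κ) z →₀ k) :
    f - ∑ i ∈ Finset.range (z.wt - 1), firstProj k κ z i f ∈ Grav k κ j z := by
  classical
  have key : ∀ W : Word (hycGens κ) z, leading k W -
      ∑ i ∈ Finset.range (z.wt - 1), firstProj k κ z i (leading k W) ∈ Grav k κ j z := by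
    intro W
    simp only [firstProj_leading]
    by_cases h : ∃ i, ¬ BadAt i W.1
    · have hs := Nat.find_spec h
      have hm : ∀ j < Nat.find h, BadAt j W.1 := fun j hj => of_not_not (Nat.find_min h hj)
      have huniq : ∀ i, (¬ BadAt i W.1 ∧ ∀ j < i, BadAt j W.1) ↔ i = Nat.find h := by
        intro i
        constructor
        · rintro ⟨h1, h2⟩
          exact le_antisymm (not_lt.1 fun h3 => hs (h2 _ h3)) (Nat.find_min' h h1)
        · rintro rfl
          exact ⟨hs, hm⟩
      simp only [huniq]
      -- A word of weight `w` has the pairs `0, …, w - 2`. If the first index that is not bad is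
      -- outside this range, all actual pairs are bad.
      by_cases hlt : Nat.find h < z.wt - 1
      · rw [Finset.sum_ite_eq', if_pos (Finset.mem_range.2 hlt), sub_self]
        exact Submodule.zero_mem _
      · rw [Finset.sum_ite_eq', if_neg (fun h' => hlt (Finset.mem_range.1 h')), sub_zero]
        exact leading_mem W (hm j (by omega))
    · push Not at h
      have := (h z.wt).lt
      rw [W.2.wt] at this
      omega
  have hall : ⊤ ≤ (Grav k κ j z).comap (LinearMap.id -
      ∑ i ∈ Finset.range (z.wt - 1), firstProj k κ z i) := by
    rw [← (leadingBasis k κ z).span_eq, Submodule.span_le]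
    rintro _ ⟨W, rfl⟩
    rw [leadingBasis_apply]
    have := key W
    simpa [LinearMap.sum_apply] using this
  have := hall (Submodule.mem_top (x := f))
  simpa [LinearMap.sum_apply] using this

/-- `grav_le_span` applies to a second family with the same leading words, in which the minor
involves only the two letters of the bad pair. It shows that the gravity spaces at all places come
from weight two, as a quadratic presentation requires. -/
theorem grav_le_span_products {i : ℕ} {z : Lab} (hi : i + 1 < z.wt) :
    Grav k κ i z ≤ Submodule.span k {f | ∃ (x y u v : Lab) (s : Splits z x y) (t : Splits y u v)
      (U : Word (hycGens κ) x) (V : Word (hycGens κ) v) (a : ℕ → ℕ),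
      x.wt = i ∧ u.wt = 2 ∧ f = freeMul k _ s (Finsupp.single U 1)
        (freeMul k _ t (minor k κ a u) (Finsupp.single V 1))} := by
  classical
  have hex : ∀ W : {W : Word (hycGens κ) z // BadAt i W.1},
      ∃ e : Word (hycGens κ) z →₀ k, e ∈ Grav k κ i z ∧ e W.1 ≠ 0 ∧
        (∀ c, e c ≠ 0 → c = W.1 ∨ c.1.map rk < W.1.1.map rk) ∧
        ∃ (x y u v : Lab) (s : Splits z x y) (t : Splits y u v)
      (U : Word (hycGens κ) x) (V : Word (hycGens κ) v) (a : ℕ → ℕ),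
      x.wt = i ∧ u.wt = 2 ∧ e = freeMul k _ s (Finsupp.single U 1)
        (freeMul k _ t (minor k κ a u) (Finsupp.single V 1)) := by
    rintro ⟨⟨W, hW⟩, hWb⟩
    obtain ⟨l, a, b, m, e, hl, hb⟩ := id hWb
    obtain rfl : W = _ := e
    obtain ⟨x, y, s, hx, hy⟩ := hW.of_append
    obtain ⟨u, v, t, hu, hv⟩ := IsWord.of_append (l := [a, b]) (m := m) hy
    have hxw : x.wt = i := by rw [← hx.wt, hl]
    have huw : u.wt = 2 := hu.wt.symm
    have hcf : ∀ c : Word (hycGens κ) z, freeMul k _ s (Finsupp.single ⟨l, hx⟩ 1)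
        (freeMul k _ t (minor k κ (mins [a, b]) u) (Finsupp.single ⟨m, hv⟩ 1)) c =
        (if l = c.1.take x.wt then 1 else 0) * (cf ((c.1.drop x.wt).take 2)
          (minor k κ (mins [a, b]) u) * if m = (c.1.drop x.wt).drop 2 then 1 else 0) := by
      intro c
      rw [← cf_word, cf_freeMul, cf_freeMul, cf_single, cf_single, huw]
      congr
    -- For `W = l a b m` the element is the product of `l`, the minor of the pair `a b`, and `m`.
    refine ⟨_, ?_, ?_, ?_, x, y, u, v, s, t, ⟨l, hx⟩, ⟨m, hv⟩, mins [a, b], hxw, huw, rfl⟩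
    · have := grav_left s 0 (Finsupp.single (⟨l, hx⟩ : Word (hycGens κ) x) (1 : k))
        (grav_right t 0 (Finsupp.single (⟨m, hv⟩ : Word (hycGens κ) v) (1 : k)) (by omega)
          (minor_mem_grav (mins [a, b]) u 0))
      rwa [hxw] at this
    · rw [hcf]
      simp only
      have h1 : (l ++ a :: b :: m).take x.wt = l := by rw [← hx.wt, List.take_left]
      have h2 : (l ++ a :: b :: m).drop x.wt = a :: b :: m := by rw [← hx.wt, List.drop_left]
      rw [h1, h2, if_pos rfl, List.take_succ_cons, List.take_succ_cons, List.take_zero,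
        cf_minor_self hu, if_pos (by simp)]
      simp
    · intro c hc
      rw [hcf] at hc
      have h1 := left_ne_zero_of_mul hc
      have h2 := left_ne_zero_of_mul (right_ne_zero_of_mul hc)
      have h3 := right_ne_zero_of_mul (right_ne_zero_of_mul hc)
      have h1 : l = c.1.take x.wt := of_not_not fun h => h1 (if_neg h)
      have h3 : m = (c.1.drop x.wt).drop 2 := of_not_not fun h => h3 (if_neg h)
      have hlen := (isWord_of_cf_ne_zero h2).wt
      have hdec : c.1 = l ++ ((c.1.drop x.wt).take 2 ++ m) := by
        rw [h3, List.take_append_drop, h1, List.take_append_drop]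
      rcases eq_or_lt_of_cf_minor hu (List.isChain_cons_cons.2 ⟨hb, List.isChain_singleton _⟩) h2
        with h4 | h4
      · left
        apply Subtype.ext
        rw [hdec, h4]; rfl
      · right
        rw [hdec, List.map_append, List.map_append, List.map_append]
        refine append_lt_append_left _ ?_
        exact append_lt_append_of_lt (l₂ := [a, b].map rk) (by simpa [huw] using hlen) h4
  choose e he1 he2 he3 he4 using hex
  refine (grav_le_span hi e he1 he2 he3).trans (Submodule.span_mono ?_)
  rintro _ ⟨W, rfl⟩
  exact he4 W

end Basis

/-! ### Ideals generated by relations. -/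

section Ideals

variable {k : Type u} [Field k]

theorem TwIdeal.span_le {A : TwAlg k} {R : ∀ x : Lab, Set (A.obj x)} {N : TwIdeal A}
    (h : ∀ y, R y ⊆ N.carrier y) (x : Lab) : (TwIdeal.span A R).carrier x ≤ N.carrier x :=
  iInf₂_le N h

theorem TwIdeal.subset_span {A : TwAlg k} (R : ∀ x : Lab, Set (A.obj x)) (x : Lab) :
    R x ⊆ (TwIdeal.span A R).carrier x := by
  intro a ha
  change a ∈ ⨅ (N : TwIdeal A) (_ : ∀ y, R y ⊆ N.carrier y), N.carrier x
  simp only [Submodule.mem_iInf]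
  exact fun N hN => hN x ha

theorem TwAlg.toQuot_eq_zero (A : TwAlg k) (N : TwIdeal A) {x : Lab} {a : A.obj x} :
    A.toQuot N x a = 0 ↔ a ∈ N.carrier x := Submodule.Quotient.mk_eq_zero _

end Ideals

/-! ### From the generators of `tHC` to those of `tHyperCom`: the relators become two by two minors.
-/

section Presentation

variable {k : Type u} [Field k] {κ : ℕ}

theorem grav_map (σ : Equiv.Perm ℕ) {x y : Lab} (h : x.move σ = y) {i : ℕ}
    {f : Word (hycGens κ) x →₀ k} (hf : f ∈ Grav k κ i x) :
    freeMap k _ σ h f ∈ Grav k κ i y := by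
  have hmap : ∀ I : Finset ℕ, ∃ I' : Finset ℕ, I = I'.map σ.toEmbedding := by
    intro I
    refine ⟨I.map σ.symm.toEmbedding, ?_⟩
    rw [Finset.map_map]
    ext i
    simp
  have e : ∀ (u v : List (ℕ × Finset ℕ)) (p q : ℕ) (I J : Finset ℕ),
      cf (relabel σ u ++ (p, I.map σ.toEmbedding) :: (q, J.map σ.toEmbedding) :: relabel σ v)
        (freeMap k _ σ h f) = cf (u ++ (p, I) :: (q, J) :: v) f := by
    intro u v p q I J
    rw [← cf_freeMap σ h]
    simp [relabel]
  intro u v hu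
  obtain ⟨u, rfl⟩ := relabel_surjective σ u
  obtain ⟨v, rfl⟩ := relabel_surjective σ v
  have hu' : u.length = i := by simpa [relabel] using hu
  have e1 : ∀ (a p : ℕ) (N : Finset ℕ), cf (relabel σ u ++ (0, {σ a}) ::
      (p, N.map σ.toEmbedding \ {σ a}) :: relabel σ v) (freeMap k _ σ h f) =
      cf (u ++ (0, {a}) :: (p, N \ {a}) :: v) f := by
    intro a p N
    rw [← e, Finset.map_singleton, Finset.map_sdiff, Finset.map_singleton]
    rfl
  refine ⟨fun p q I J h1 h2 h3 h4 => ?_, fun D N h => ?_⟩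
  · obtain ⟨I, rfl⟩ := hmap I
    obtain ⟨J, rfl⟩ := hmap J
    rw [Finset.card_map] at h2 h3
    simp only [Finset.sum_map, ← Finset.map_union]
    refine (e _ _ _ _ _ _).trans (((hf u v hu').1 p q I J h1 h2 h3
      ((Finset.disjoint_map _).1 h4)).trans ?_)
    exact Finset.sum_congr rfl fun a _ => (e1 _ _ _).symm
  · obtain ⟨N, rfl⟩ := hmap N
    rw [Finset.card_map] at h
    simp only [Finset.sum_map]
    refine Eq.trans ?_ ((hf u v hu').2 D N h)
    exact Finset.sum_congr rfl fun a _ => e1 _ _ _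

/-- The sum of the spaces `Grav`, over all pairs of adjacent letters. -/
noncomputable def GravSum (k : Type u) [Field k] (κ : ℕ) (z : Lab) : Submodule k (Word (hycGens κ) z →₀ k) :=
  ⨆ (i : ℕ) (_ : i + 1 < z.wt), Grav k κ i z

theorem mem_gravSum {z : Lab} {i : ℕ} (hi : i + 1 < z.wt) {f : Word (hycGens κ) z →₀ k}
    (hf : f ∈ Grav k κ i z) : f ∈ GravSum k κ z :=
  Submodule.mem_iSup_of_mem i (Submodule.mem_iSup_of_mem hi hf)

theorem gravSum_le {z : Lab} {N : Submodule k (Word (hycGens κ) z →₀ k)}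
    (h : ∀ i, i + 1 < z.wt → ∀ f ∈ Grav k κ i z, f ∈ N) : GravSum k κ z ≤ N :=
  iSup₂_le fun i hi f hf => h i hi f hf

theorem gravSum_map (σ : Equiv.Perm ℕ) {x y : Lab} (h : x.move σ = y)
    {f : Word (hycGens κ) x →₀ k} (hf : f ∈ GravSum k κ x) :
    freeMap k _ σ h f ∈ GravSum k κ y := by
  have : GravSum k κ x ≤ (GravSum k κ y).comap (freeMap k _ σ h) :=
    gravSum_le fun i hi f hf => mem_gravSum (by subst h; exact hi) (grav_map σ h hf)
  exact this hf

theorem gravSum_left {x y z : Lab} (s : Splits z x y) (f : Word (hycGens κ) x →₀ k)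
    {g : Word (hycGens κ) y →₀ k} (hg : g ∈ GravSum k κ y) :
    freeMul k _ s f g ∈ GravSum k κ z := by
  have : GravSum k κ y ≤ (GravSum k κ z).comap (freeMul k _ s f) :=
    gravSum_le fun i hi g hg => mem_gravSum (by have := s.wt; omega) (grav_left s i f hg)
  exact this hg

theorem gravSum_right {x y z : Lab} (s : Splits z x y) {f : Word (hycGens κ) x →₀ k}
    (g : Word (hycGens κ) y →₀ k) (hf : f ∈ GravSum k κ x) :
    freeMul k _ s f g ∈ GravSum k κ z := by
  have : GravSum k κ x ≤ (GravSum k κ z).comap ((freeMul k _ s).flip g) :=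
    gravSum_le fun i hi f hf =>
      mem_gravSum (by have := s.wt; omega) (grav_right s i g hi hf)
  exact this hf

theorem IsWord.toLM {l : List (ℕ × Finset ℕ)} {x : Lab} (h : IsWord (hycGens κ) l x) :
    IsWord lmGens l x :=
  ⟨fun a ha => by have := h.card_eq ha; change 1 ≤ _; omega, h.disj, h.supp, h.deg, h.wt⟩

theorem isWord_hyc_iff {l : List (ℕ × Finset ℕ)} {x : Lab} (h : IsWord lmGens l x) :
    IsWord (hycGens κ) l x ↔ ∀ a ∈ l, a.2.card = 1 + a.1 * (κ - 1) :=
  ⟨fun h' => h'.has, fun h' => ⟨h', h.disj, h.supp, h.deg, h.wt⟩⟩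

/-- The inclusion of free algebras. -/
noncomputable def toLM (k : Type u) [Field k] (κ : ℕ) (x : Lab) :
    (Word (hycGens κ) x →₀ k) →ₗ[k] (Word lmGens x →₀ k) :=
  Finsupp.lmapDomain k k (fun W => ⟨W.1, W.2.toLM⟩)

theorem toLM_single {x : Lab} (W : Word (hycGens κ) x) (c : k) :
    toLM k κ x (Finsupp.single W c) = Finsupp.single ⟨W.1, W.2.toLM⟩ c :=
  Finsupp.mapDomain_single

/-- The projection of free algebras, killing the generators which do not belong to the subalgebra. -/
noncomputable def ofLM (k : Type u) [Field k] (κ : ℕ) (x : Lab) :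
    (Word lmGens x →₀ k) →ₗ[k] (Word (hycGens κ) x →₀ k) :=
  Finsupp.linearCombination k (fun W => wmono k (hycGens κ) W.1 x)

theorem ofLM_single {x : Lab} (W : Word lmGens x) :
    ofLM k κ x (Finsupp.single W 1) = wmono k (hycGens κ) W.1 x := by
  rw [ofLM, Finsupp.linearCombination_single, one_smul]

theorem ofLM_wmono (l : List (ℕ × Finset ℕ)) (x : Lab) :
    ofLM k κ x (wmono k lmGens l x) = wmono k (hycGens κ) l x := by
  by_cases h : IsWord lmGens l x
  · rw [wmono_of_isWord h, ofLM_single]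
  · rw [wmono_of_not_isWord h, wmono_of_not_isWord fun h' => h h'.toLM, map_zero]

theorem ofLM_toLM {x : Lab} (f : Word (hycGens κ) x →₀ k) : ofLM k κ x (toLM k κ x f) = f := by
  have : (ofLM k κ x).comp (toLM k κ x) = LinearMap.id := by
    apply word_ext
    intro W
    rw [LinearMap.comp_apply, toLM_single, ofLM_single, wmono_of_isWord W.2]
    rfl
  exact LinearMap.congr_fun this f

theorem ofLM_freeMul {x y z : Lab} (s : Splits z x y) (f : Word lmGens x →₀ k)
    (g : Word lmGens y →₀ k) :
    ofLM k κ z (freeMul k _ s f g) = freeMul k _ s (ofLM k κ x f) (ofLM k κ y g) := by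
  have : (freeMul k lmGens s).compr₂ (ofLM k κ z) =
      (freeMul k (hycGens κ) s).compl₁₂ (ofLM k κ x) (ofLM k κ y) := by
    apply word_ext
    intro U
    apply word_ext
    intro V
    rw [LinearMap.compr₂_apply, freeMul_single, LinearMap.compl₁₂_apply, ofLM_single, ofLM_single,
      ofLM_single]
    have hUV : IsWord (hycGens κ) (Word.append s U V).1 z ↔
        IsWord (hycGens κ) U.1 x ∧ IsWord (hycGens κ) V.1 y := by
      rw [isWord_hyc_iff (Word.append s U V).2, isWord_hyc_iff U.2, isWord_hyc_iff V.2]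
      exact List.forall_mem_append
    by_cases hU : IsWord (hycGens κ) U.1 x
    · by_cases hV : IsWord (hycGens κ) V.1 y
      · rw [wmono_of_isWord hU, wmono_of_isWord hV, wmono_of_isWord (hUV.2 ⟨hU, hV⟩),
          freeMul_single]
        rfl
      · rw [wmono_of_not_isWord hV, wmono_of_not_isWord fun h => hV (hUV.1 h).2, map_zero]
    · rw [wmono_of_not_isWord hU, wmono_of_not_isWord fun h => hU (hUV.1 h).1, map_zero,
        LinearMap.zero_apply]
  exact LinearMap.congr_fun (LinearMap.congr_fun this f) g

theorem toLM_freeMul {x y z : Lab} (s : Splits z x y) (f : Word (hycGens κ) x →₀ k)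
    (g : Word (hycGens κ) y →₀ k) :
    toLM k κ z (freeMul k _ s f g) = freeMul k _ s (toLM k κ x f) (toLM k κ y g) := by
  have : (freeMul k (hycGens κ) s).compr₂ (toLM k κ z) =
      (freeMul k lmGens s).compl₁₂ (toLM k κ x) (toLM k κ y) := by
    apply word_ext
    intro U
    apply word_ext
    intro V
    rw [LinearMap.compr₂_apply, freeMul_single, LinearMap.compl₁₂_apply, toLM_single, toLM_single,
      toLM_single, freeMul_single]
    rfl
  exact LinearMap.congr_fun (LinearMap.congr_fun this f) g

theorem ofLM_freeMap (σ : Equiv.Perm ℕ) {x y : Lab} (h : x.move σ = y) (f : Word lmGens x →₀ k) :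
    ofLM k κ y (freeMap k _ σ h f) = freeMap k _ σ h (ofLM k κ x f) := by
  have : (ofLM k κ y).comp (freeMap k lmGens σ h) =
      (freeMap k (hycGens κ) σ h).comp (ofLM k κ x) := by
    apply word_ext
    intro W
    rw [LinearMap.comp_apply, freeMap_single, ofLM_single, LinearMap.comp_apply, ofLM_single]
    have hiff : IsWord (hycGens κ) (W.relabel σ h).1 y ↔ IsWord (hycGens κ) W.1 x := by
      rw [isWord_hyc_iff W.2, isWord_hyc_iff (W.relabel σ h).2]
      simp only [Word.relabel, relabel, List.mem_map, forall_exists_index, and_imp,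
        forall_apply_eq_imp_iff₂, Finset.card_map]
    by_cases hW : IsWord (hycGens κ) W.1 x
    · rw [wmono_of_isWord hW, wmono_of_isWord (hiff.2 hW), freeMap_single]
      rfl
    · rw [wmono_of_not_isWord hW, wmono_of_not_isWord fun h => hW (hiff.1 h), map_zero]
  exact LinearMap.congr_fun this f

theorem toLM_freeMap (σ : Equiv.Perm ℕ) {x y : Lab} (h : x.move σ = y)
    (f : Word (hycGens κ) x →₀ k) :
    toLM k κ y (freeMap k _ σ h f) = freeMap k _ σ h (toLM k κ x f) := by
  have : (toLM k κ y).comp (freeMap k (hycGens κ) σ h) =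
      (freeMap k lmGens σ h).comp (toLM k κ x) := by
    apply word_ext
    intro W
    rw [LinearMap.comp_apply, freeMap_single, toLM_single, LinearMap.comp_apply, toLM_single,
      freeMap_single]
    rfl
  exact LinearMap.congr_fun this f

open Classical in
theorem cf_ofLM {x : Lab} (l : List (ℕ × Finset ℕ)) (f : Word lmGens x →₀ k) :
    cf l (ofLM k κ x f) = if IsWord (hycGens κ) l x then cf l f else 0 := by
  split_ifs with h
  · have : (cf l).comp (ofLM k κ x) = cf l := by
      apply word_ext
      intro W
      rw [LinearMap.comp_apply, ofLM_single, cf_wmono, cf_single]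
      by_cases e : W.1 = l
      · rw [if_pos e, if_pos ⟨e, e ▸ h⟩]
      · rw [if_neg e, if_neg fun h' => e h'.1]
    exact LinearMap.congr_fun this f
  · exact cf_of_not_isWord h _

/-- The pair of points `i`, `j` as a sequence. -/
def twoPoints (i j : ℕ) : ℕ → ℕ := fun s => if s = 0 then i else j

theorem det_incidence_twoPoints (i j : ℕ) (x y : ℕ × Finset ℕ) (n : ℕ) (hn : n = 2) :
    (incidence k (twoPoints i j) n [x, y]).det =
      (if i ∈ x.2 then 1 else 0) * (if j ∈ y.2 then 1 else 0) -
        (if j ∈ x.2 then 1 else 0) * (if i ∈ y.2 then 1 else 0) := by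
  subst hn
  rw [Matrix.det_fin_two]
  rfl

theorem isWord_of_mono {x : Lab} {a b : ℕ × Finset ℕ}
    (h : wmono k lmGens [a, b] x ≠ 0) : x.wt = 2 ∧ x.deg = 2 * (a.1 + b.1 : ℕ) := by
  have hw : IsWord lmGens [a, b] x := by
    by_contra hw
    exact h (wmono_of_not_isWord hw)
  refine ⟨hw.wt.symm, ?_⟩
  rw [← hw.deg]
  simp [lmGens]
  ring

/-- The relator `lmRel` as a combination of words. -/
noncomputable def lmRelator (k : Type u) [Field k] (x : Lab) (i j D : ℕ) : Word lmGens x →₀ k :=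
  ∑ I ∈ x.supp.powerset with i ∈ I ∧ j ∉ I, ∑ pq ∈ Finset.HasAntidiagonal.antidiagonal D,
    (wmono k lmGens [(pq.1, I), (pq.2, x.supp \ I)] x -
      wmono k lmGens [(pq.2, x.supp \ I), (pq.1, I)] x)

/-- A relator can be non-zero only in weight two and degree `2 D`. There its coefficient at `(p, K)
(q, K')` is `[i ∈ K, j ∉ K] - [i ∈ K', j ∉ K']`, and `K'` is the complement of `K`, so this is the
minor for the points `i` and `j`. -/
theorem ofLM_lmRelator {x : Lab} {i j : ℕ} (hi : i ∈ x.supp) (hj : j ∈ x.supp) (D : ℕ) :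
    ofLM k κ x (lmRelator k x i j D) =
      if x.wt = 2 ∧ x.deg = 2 * D then minor k κ (twoPoints i j) x else 0 := by
  classical
  split_ifs with hx
  swap
  · rw [lmRelator, Finset.sum_eq_zero, map_zero]
    intro I _
    refine Finset.sum_eq_zero fun pq hpq => ?_
    rw [Finset.HasAntidiagonal.mem_antidiagonal] at hpq
    have h1 : wmono k lmGens [(pq.1, I), (pq.2, x.supp \ I)] x = 0 := by
      by_contra h
      have := isWord_of_mono h
      exact hx ⟨this.1, by rw [this.2, ← hpq]⟩
    have h2 : wmono k lmGens [(pq.2, x.supp \ I), (pq.1, I)] x = 0 := by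
      by_contra h
      have := isWord_of_mono h
      exact hx ⟨this.1, by rw [this.2, ← hpq, add_comm]⟩
    rw [h1, h2, sub_zero]
  apply cf_ext
  intro l
  rw [cf_ofLM, cf_minor]
  split_ifs with hl
  swap
  · rfl
  obtain ⟨⟨p, K⟩, ⟨q, K'⟩, rfl⟩ := List.length_eq_two.1 (hl.wt.trans hx.1)
  obtain ⟨-, -, hd, -⟩ := IsWord.pair (u := []) hl
  have hsupp : x.supp = K ∪ K' := by
    ext a
    rw [hl.supp]
    simp
  have hpq : p + q = D := by
    have h1 := hl.deg
    rw [sum_deg_hycGens, hx.2] at h1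
    simp at h1
    omega
  have hK' : x.supp \ K = K' := by rw [hsupp, Finset.union_sdiff_cancel_left hd]
  have hK : x.supp \ K' = K := by rw [hsupp, Finset.union_sdiff_cancel_right hd]
  rw [det_incidence_twoPoints _ _ _ _ _ hx.1, lmRelator]
  -- The given word arises from the first monomial only for `I = K` and indices `(p, q)`; by `hB` it
  -- arises from the second one only for `I = K'` and indices `(q, p)`.
  have hA : ∀ (I : Finset ℕ) (ab : ℕ × ℕ), cf [(p, K), (q, K')]
      (wmono k lmGens [(ab.1, I), (ab.2, x.supp \ I)] x) =
      if I = K then (if ab = (p, q) then 1 else 0) else 0 := by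
    intro I ab
    rw [cf_wmono, ← ite_and]
    by_cases h : I = K ∧ ab = (p, q)
    · rw [if_pos h, if_pos]
      obtain ⟨rfl, rfl⟩ := h
      simp only [hK', true_and]
      exact hl.toLM
    · rw [if_neg h, if_neg]
      rintro ⟨e, -⟩
      refine h ?_
      clear h
      rename' e => h
      simp only [List.cons.injEq, Prod.mk.injEq] at h
      exact ⟨h.1.2, Prod.ext h.1.1 h.2.1.1⟩
  have hB : ∀ I ⊆ x.supp, ∀ ab : ℕ × ℕ, cf [(p, K), (q, K')]
      (wmono k lmGens [(ab.2, x.supp \ I), (ab.1, I)] x) =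
      if I = K' then (if ab = (q, p) then 1 else 0) else 0 := by
    intro I hI ab
    rw [cf_wmono, ← ite_and]
    by_cases h : I = K' ∧ ab = (q, p)
    · rw [if_pos h, if_pos]
      obtain ⟨rfl, rfl⟩ := h
      simp only [hK, true_and]
      exact hl.toLM
    · rw [if_neg h, if_neg]
      rintro ⟨e, -⟩
      refine h ?_
      clear h
      rename' e => h
      simp only [List.cons.injEq, Prod.mk.injEq] at h
      exact ⟨h.2.1.2, Prod.ext h.2.1.1 h.1.1⟩
  have hKs : K ⊆ x.supp := by rw [hsupp]; exact Finset.subset_union_left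
  have hKs' : K' ⊆ x.supp := by rw [hsupp]; exact Finset.subset_union_right
  have e : ∀ I ∈ {I ∈ x.supp.powerset | i ∈ I ∧ j ∉ I},
      cf [(p, K), (q, K')] (∑ pq ∈ Finset.HasAntidiagonal.antidiagonal D,
        (wmono k lmGens [(pq.1, I), (pq.2, x.supp \ I)] x -
          wmono k lmGens [(pq.2, x.supp \ I), (pq.1, I)] x)) =
      (if I = K then 1 else 0) - (if I = K' then 1 else 0) := by
    intro I hI
    rw [Finset.mem_filter, Finset.mem_powerset] at hI
    rw [map_sum]
    simp only [map_sub, hA, hB I hI.1, Finset.sum_sub_distrib]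
    congr 1
    · split_ifs with h
      · rw [Finset.sum_ite_eq', if_pos (Finset.HasAntidiagonal.mem_antidiagonal.2 hpq)]
      · exact Finset.sum_const_zero
    · split_ifs with h
      · rw [Finset.sum_ite_eq', if_pos (Finset.HasAntidiagonal.mem_antidiagonal.2 (by rw [← hpq]; exact add_comm _ _))]
      · exact Finset.sum_const_zero
  rw [map_sum, Finset.sum_congr rfl e, Finset.sum_sub_distrib, Finset.sum_ite_eq',
    Finset.sum_ite_eq']
  simp only [Finset.mem_filter, Finset.mem_powerset, hKs, hKs', true_and]
  rw [hsupp, Finset.mem_union] at hi hj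
  -- The two letters partition the support, so all memberships are expressed through `K` and the
  -- identity is checked in four cases.
  have hiff : ∀ a, (a ∈ K ∨ a ∈ K') → (a ∈ K' ↔ a ∉ K) := fun a ha =>
    ⟨fun h h' => Finset.disjoint_left.1 hd h' h, fun h => ha.resolve_left h⟩
  simp only [hiff i hi, hiff j hj]
  by_cases h1 : i ∈ K <;> by_cases h2 : j ∈ K <;> simp [h1, h2]

end Presentation

/-! ### The quadratic presentation of `tHyperCom` and its Koszulness. -/

section Presentation

variable {k : Type u} [Field k] {κ : ℕ}

theorem ofLM_map_mem (σ : Equiv.Perm ℕ) {x y : Lab} (h : x.move σ = y) {f : Word lmGens x →₀ k}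
    (hf : ofLM k κ x f ∈ GravSum k κ x) : ofLM k κ y (freeMap k _ σ h f) ∈ GravSum k κ y := by
  rw [ofLM_freeMap]
  exact gravSum_map σ h hf

theorem ofLM_left_mem {z x y : Lab} (s : Splits z x y) (f : Word lmGens x →₀ k)
    {g : Word lmGens y →₀ k} (hg : ofLM k κ y g ∈ GravSum k κ y) :
    ofLM k κ z (freeMul k _ s f g) ∈ GravSum k κ z := by
  rw [ofLM_freeMul]
  exact gravSum_left s _ hg

theorem ofLM_right_mem {z x y : Lab} (s : Splits z x y) {f : Word lmGens x →₀ k}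
    (g : Word lmGens y →₀ k) (hf : ofLM k κ x f ∈ GravSum k κ x) :
    ofLM k κ z (freeMul k _ s f g) ∈ GravSum k κ z := by
  rw [ofLM_freeMul]
  exact gravSum_right s _ hf

/-- The ideal of the free algebra on the generators of `tHC` cut out by the gravity equations. -/
noncomputable def lmIdeal (k : Type u) [Field k] (κ : ℕ) : TwIdeal (free k lmGens) where
  carrier x := (GravSum k κ x).comap (ofLM k κ x)
  map_mem σ _ _ h _ ha := ofLM_map_mem σ h ha
  mul_mem_left s a _ hb := ofLM_left_mem s a hb
  mul_mem_right s _ b ha := ofLM_right_mem s b ha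

theorem lmRelator_mem {x : Lab} {i j : ℕ} (hi : i ∈ x.supp) (hj : j ∈ x.supp) (D : ℕ) :
    ofLM k κ x (lmRelator k x i j D) ∈ GravSum k κ x := by
  rw [ofLM_lmRelator hi hj]
  split_ifs with h
  · exact mem_gravSum (i := 0) (by omega) (minor_mem_grav _ _ _)
  · exact Submodule.zero_mem _

/-- The ideal of the relations of `tHC`. -/
noncomputable abbrev tHCIdeal (k : Type u) [Field k] : TwIdeal (free k lmGens) :=
  TwIdeal.span _ (fun x =>
    {r | ∃ i ∈ x.supp, ∃ j ∈ x.supp, ∃ D : ℕ, i ≠ j ∧ r = lmRel k x i j D})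

theorem tHCIdeal_le (x : Lab) : (tHCIdeal k).carrier x ≤ (lmIdeal k κ).carrier x := by
  refine TwIdeal.span_le (fun y => ?_) x
  rintro _ ⟨i, hi, j, hj, D, _, rfl⟩
  exact lmRelator_mem hi hj D

/-- The map induced by `ofLM` on `tHC`. -/
noncomputable def ofTHC (k : Type u) [Field k] (κ : ℕ) (x : Lab) :
    (tHC k).obj x →ₗ[k] ((Word (hycGens κ) x →₀ k) ⧸ GravSum k κ x) :=
  ((tHCIdeal k).carrier x).liftQ ((GravSum k κ x).mkQ.comp (ofLM k κ x)) (by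
    intro a ha
    rw [LinearMap.mem_ker]
    exact (Submodule.Quotient.mk_eq_zero _).2 (tHCIdeal_le x ha))

theorem ofTHC_toQuot (x : Lab) (f : Word lmGens x →₀ k) :
    ofTHC k κ x ((free k lmGens).toQuot (tHCIdeal k) x f) =
      (GravSum k κ x).mkQ (ofLM k κ x f) := rfl

theorem ofTHC_eq_zero (x : Lab) (f : Word lmGens x →₀ k) :
    ofTHC k κ x ((free k lmGens).toQuot (tHCIdeal k) x f) = 0 ↔ f ∈ (lmIdeal k κ).carrier x := by
  rw [ofTHC_toQuot]
  exact Submodule.Quotient.mk_eq_zero _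

theorem toQuot_surjective (A : TwAlg k) (N : TwIdeal A) (x : Lab) :
    Function.Surjective (A.toQuot N x) := Submodule.Quotient.mk_surjective _

/-- The image in `tHC` of the ideal cut out by the gravity equations. -/
noncomputable def thcIdeal (k : Type u) [Field k] (κ : ℕ) : TwIdeal (tHC k) where
  carrier x := LinearMap.ker (ofTHC k κ x)
  map_mem σ x y h a ha := by
    obtain ⟨f, rfl⟩ := toQuot_surjective _ (tHCIdeal k) x a
    exact (ofTHC_eq_zero y _).2 ((lmIdeal k κ).map_mem σ h ((ofTHC_eq_zero x f).1 ha))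
  mul_mem_left {z x y} s a b hb := by
    obtain ⟨f, rfl⟩ := toQuot_surjective _ (tHCIdeal k) x a
    obtain ⟨g, rfl⟩ := toQuot_surjective _ (tHCIdeal k) y b
    exact (ofTHC_eq_zero z _).2 ((lmIdeal k κ).mul_mem_left s f ((ofTHC_eq_zero y g).1 hb))
  mul_mem_right {z x y} s a b ha := by
    obtain ⟨f, rfl⟩ := toQuot_surjective _ (tHCIdeal k) x a
    obtain ⟨g, rfl⟩ := toQuot_surjective _ (tHCIdeal k) y b
    exact (ofTHC_eq_zero z _).2 ((lmIdeal k κ).mul_mem_right s g ((ofTHC_eq_zero x f).1 ha))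

/-- The ideal of the additional relations of `tHyperCom`. -/
noncomputable abbrev tHyperComIdeal (k : Type u) [Field k] (κ : ℕ) : TwIdeal (tHC k) :=
  TwIdeal.span _ (fun x =>
    {r | ∃ m : ℕ, x.supp.card ≠ 1 + m * (κ - 1) ∧ r = tHCgen k m x})

theorem tHyperComIdeal_le (x : Lab) :
    (tHyperComIdeal k κ).carrier x ≤ (thcIdeal k κ).carrier x := by
  refine TwIdeal.span_le (fun y => ?_) x
  rintro _ ⟨m, hm, rfl⟩
  change ofTHC k κ y ((free k lmGens).toQuot (tHCIdeal k) y (wmono k lmGens [(m, y.supp)] y)) = 0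
  rw [ofTHC_toQuot, ofLM_wmono, wmono_of_not_isWord, map_zero]
  intro h
  exact hm (h.card_eq List.mem_cons_self)

/-- The projection of a free algebra on `tHyperCom`. -/
noncomputable def hycProj (k : Type u) [Field k] (κ : ℕ) (x : Lab) :
    (Word lmGens x →₀ k) →ₗ[k] (tHyperCom k κ).obj x :=
  ((tHC k).toQuot (tHyperComIdeal k κ) x).comp ((free k lmGens).toQuot (tHCIdeal k) x)

theorem hycProj_surjective (x : Lab) : Function.Surjective (hycProj k κ x) :=
  (toQuot_surjective _ _ _).comp (toQuot_surjective _ _ _)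

theorem hycProj_mul {z x y : Lab} (s : Splits z x y) (f : Word lmGens x →₀ k)
    (g : Word lmGens y →₀ k) :
    (tHyperCom k κ).mul s (hycProj k κ x f) (hycProj k κ y g) =
      hycProj k κ z (freeMul k _ s f g) := rfl

theorem hycProj_map (σ : Equiv.Perm ℕ) {x y : Lab} (h : x.move σ = y) (f : Word lmGens x →₀ k) :
    (tHyperCom k κ).map σ h (hycProj k κ x f) = hycProj k κ y (freeMap k _ σ h f) := rfl

/-- The upper bound for the relations: the gravity spaces pull back to an ideal containing the
relators of `tHC`, whose images are minors, and the forbidden generators, whose images are zero. -/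
theorem hycProj_eq_zero {x : Lab} {f : Word lmGens x →₀ k} (h : hycProj k κ x f = 0) :
    ofLM k κ x f ∈ GravSum k κ x := by
  have h1 := (TwAlg.toQuot_eq_zero _ _).1 h
  exact (ofTHC_eq_zero x f).1 (tHyperComIdeal_le x h1)

theorem hycProj_lmRelator {x : Lab} {i j : ℕ} (hi : i ∈ x.supp) (hj : j ∈ x.supp) (hij : i ≠ j)
    (D : ℕ) : hycProj k κ x (lmRelator k x i j D) = 0 := by
  have : (free k lmGens).toQuot (tHCIdeal k) x (lmRelator k x i j D) = 0 :=
    (TwAlg.toQuot_eq_zero _ _).2 (TwIdeal.subset_span _ x ⟨i, hi, j, hj, D, hij, rfl⟩)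
  exact (congrArg _ this).trans (map_zero ((tHC k).toQuot (tHyperComIdeal k κ) x))

theorem hycProj_letter {x : Lab} (m : ℕ) (hm : x.supp.card ≠ 1 + m * (κ - 1)) :
    hycProj k κ x (wmono k lmGens [(m, x.supp)] x) = 0 :=
  (TwAlg.toQuot_eq_zero _ _).2 (TwIdeal.subset_span _ x ⟨m, hm, rfl⟩)

/-- Some letter of the word has an arity that does not match its index; it is a forbidden generator,
and it stays zero after multiplication by the other letters. -/
theorem hycProj_word {x : Lab} (W : Word lmGens x) (hW : ¬ IsWord (hycGens κ) W.1 x) :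
    hycProj k κ x (Finsupp.single W 1) = 0 := by
  rw [isWord_hyc_iff W.2] at hW
  push Not at hW
  obtain ⟨⟨p, I⟩, ha, hm⟩ := hW
  obtain ⟨u, v, e⟩ := List.append_of_mem ha
  obtain ⟨W, hW⟩ := W
  obtain rfl : W = _ := e
  obtain ⟨y, z, s, hu, hy⟩ := hW.of_append
  obtain ⟨b, c, t, hb, hc⟩ := IsWord.of_append (l := [(p, I)]) (m := v) hy
  have hbs : b.supp = I := by
    ext i
    rw [hb.supp]
    simp
  have e : Finsupp.single (⟨_, hW⟩ : Word lmGens x) (1 : k) =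
      freeMul k _ s (Finsupp.single ⟨u, hu⟩ 1) (freeMul k _ t (wmono k lmGens [(p, b.supp)] b)
        (Finsupp.single ⟨v, hc⟩ 1)) := by
    subst hbs
    rw [wmono_of_isWord hb, freeMul_single, freeMul_single]
    rfl
  rw [e, ← hycProj_mul, ← hycProj_mul, hycProj_letter _ (by rw [hbs]; exact hm), map_zero,
    LinearMap.zero_apply, map_zero]

theorem hycProj_toLM_ofLM {x : Lab} (f : Word lmGens x →₀ k) :
    hycProj k κ x (toLM k κ x (ofLM k κ x f)) = hycProj k κ x f := by
  have : (hycProj k κ x).comp ((toLM k κ x).comp (ofLM k κ x)) = hycProj k κ x := by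
    apply word_ext
    intro W
    rw [LinearMap.comp_apply, LinearMap.comp_apply, ofLM_single]
    by_cases hW : IsWord (hycGens κ) W.1 x
    · rw [wmono_of_isWord hW, toLM_single]
    · rw [wmono_of_not_isWord hW, map_zero, map_zero, hycProj_word W hW]
  exact LinearMap.congr_fun this f

/-- For two distinct points of the support the minor is the image of a relator of `tHC`. In all
other cases it vanishes: a point outside the support gives a zero column, and coinciding points give
equal columns. -/
theorem hycProj_minor {u : Lab} (hu : u.wt = 2) (a : ℕ → ℕ) :
    hycProj k κ u (toLM k κ u (minor k κ a u)) = 0 := by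
  classical
  have hzero : (∀ l, IsWord (hycGens κ) l u → (incidence k a u.wt l).det = 0) →
      hycProj k κ u (toLM k κ u (minor k κ a u)) = 0 := by
    intro h
    have : minor k κ a u = 0 := by
      apply cf_ext
      intro l
      rw [cf_minor, map_zero]
      split_ifs with hl
      · exact h l hl
      · rfl
    rw [this, map_zero, map_zero]
  by_cases hex : ∃ l, IsWord (hycGens κ) l u
  swap
  · exact hzero fun l hl => absurd ⟨l, hl⟩ hex
  obtain ⟨l, hl⟩ := hex
  have hdeg := hl.deg
  rw [sum_deg_hycGens] at hdeg
  have h0 : 0 < u.wt := by omega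
  have h1 : 1 < u.wt := by omega
  have col : ∀ s : Fin u.wt, a s ∉ u.supp → hycProj k κ u (toLM k κ u (minor k κ a u)) = 0 := by
    intro s hs
    refine hzero fun l hl => Matrix.det_eq_zero_of_column_eq_zero s fun t => if_neg fun h => hs ?_
    rw [hl.supp]
    have ht : (t : ℕ) < l.length := by rw [hl.wt]; exact t.2
    rw [List.getD_eq_getElem _ _ ht] at h
    exact ⟨_, List.getElem_mem ht, h⟩
  by_cases hi : a 0 ∈ u.supp
  swap
  · exact col ⟨0, h0⟩ hi
  by_cases hj : a 1 ∈ u.supp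
  swap
  · exact col ⟨1, h1⟩ hj
  by_cases hij : a 0 = a 1
  · refine hzero fun l hl => Matrix.det_zero_of_column_eq
      (i := ⟨0, h0⟩) (j := ⟨1, h1⟩) (by simp [Fin.ext_iff]) fun t => ?_
    change (if a 0 ∈ _ then (1 : k) else 0) = if a 1 ∈ _ then 1 else 0
    rw [hij]
  have e : minor k κ a u = ofLM k κ u (lmRelator k u (a 0) (a 1) (l.map Prod.fst).sum) := by
    rw [ofLM_lmRelator hi hj, if_pos ⟨hu, hdeg.symm⟩]
    unfold minor incidence indic
    congr 1
    funext W
    congr 2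
    funext t s
    have : a s = twoPoints (a 0) (a 1) s := by
      obtain ⟨s, hs⟩ := s
      have : s = 0 ∨ s = 1 := by omega
      rcases this with rfl | rfl <;> rfl
    rw [this]
  rw [e, hycProj_toLM_ofLM, hycProj_lmRelator hi hj hij]

/-- One inclusion is `hycProj_eq_zero`. For the other one, each gravity space is spanned by
multiples of minors in weight two, and these are zero in the algebra. -/
theorem ker_hycProj_toLM (z : Lab) :
    LinearMap.ker ((hycProj k κ z).comp (toLM k κ z)) = GravSum k κ z := by
  apply le_antisymm
  · intro f hf
    have := hycProj_eq_zero hf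
    rwa [ofLM_toLM] at this
  · refine gravSum_le fun i hi f hf => ?_
    refine (grav_le_span_products hi).trans (Submodule.span_le.2 ?_) hf
    rintro _ ⟨x, y, u, v, s, t, U, V, a, _, hu, rfl⟩
    change hycProj k κ z (toLM k κ z _) = 0
    rw [toLM_freeMul, toLM_freeMul, ← hycProj_mul, ← hycProj_mul, hycProj_minor hu, map_zero,
      LinearMap.zero_apply, map_zero]

/-- The presentation of `tHyperCom` by the generators of non-zero image. -/
noncomputable def hycPres (k : Type u) [Field k] (κ : ℕ) :
    GapPres (tHyperCom k κ) (hycGens κ) (Grav k κ) where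
  π x := (hycProj k κ x).comp (toLM k κ x)
  surj x := by
    intro a
    obtain ⟨f, rfl⟩ := hycProj_surjective x a
    exact ⟨ofLM k κ x f, hycProj_toLM_ofLM f⟩
  mul s f g := by
    rw [LinearMap.comp_apply, LinearMap.comp_apply, LinearMap.comp_apply, hycProj_mul, toLM_freeMul]
  map σ x y h f := by
    rw [LinearMap.comp_apply, LinearMap.comp_apply, hycProj_map, toLM_freeMap]
  one := by
    rw [LinearMap.comp_apply, toLM_single]
    rfl
  ker := ker_hycProj_toLM
  gap_left s i f := grav_left s i f
  gap_right s i _ g := grav_right s i g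
  gap_gen i z hi := by
    refine (grav_le_span_products hi).trans (Submodule.span_mono ?_)
    rintro _ ⟨x, y, u, v, s, t, U, V, a, hx, hu, rfl⟩
    exact ⟨x, y, u, v, s, t, U, V, _, hx, hu, minor_mem_grav _ _ _, rfl⟩
  even W := W.2.even_deg

/-- In weight zero there are no gaps, hence no relations, and the only word is the empty one. -/
theorem isConnected_tHyperCom : (tHyperCom k κ).IsConnected := by
  intro x hx
  have hker : LinearMap.ker ((hycPres k κ).π x) = ⊥ := by
    rw [(hycPres k κ).ker, eq_bot_iff]
    exact iSup₂_le fun i hi => by omega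
  by_cases hnil : x = Lab.nil
  swap
  · have h1 : IsEmpty (Word (hycGens κ) x) :=
      ⟨fun W => hnil (IsWord.nil_iff.1 (List.length_eq_zero_iff.1 (W.2.wt.trans hx) ▸ W.2))⟩
    have h2 : IsEmpty (PLift (x = Lab.nil)) := ⟨fun h => hnil h.down⟩
    refine ⟨fun a b _ => ?_, fun a => ⟨0, ?_⟩⟩
    · change (PLift (x = Lab.nil) →₀ k) at a b
      exact Subsingleton.elim a b
    · obtain ⟨f, rfl⟩ := (hycPres k κ).surj x a
      rw [Subsingleton.elim f 0, map_zero, map_zero]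
  · subst hnil
    have key : ∀ c : k, (tHyperCom k κ).unitMap Lab.nil (Finsupp.single (PLift.up rfl) c) =
        (hycPres k κ).π Lab.nil (Finsupp.single ⟨[], IsWord.nil _⟩ c) := by
      intro c
      refine (Finsupp.linearCombination_single k c _).trans ?_
      rw [Species.map_one, (hycPres k κ).one, ← map_smul, Finsupp.smul_single, smul_eq_mul, mul_one]
    refine ⟨(injective_iff_map_eq_zero _).2 fun a ha => ?_, fun a => ?_⟩
    · change (PLift (Lab.nil = Lab.nil) →₀ k) at a
      obtain ⟨c, rfl⟩ : ∃ c, a = Finsupp.single (PLift.up rfl) c :=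
        ⟨a (PLift.up rfl), by ext ⟨h⟩; simp⟩
      rw [key] at ha
      have := LinearMap.ker_eq_bot'.1 hker _ ha
      rw [Finsupp.single_eq_zero.1 this]
      exact Finsupp.single_zero _
    · obtain ⟨f, rfl⟩ := (hycPres k κ).surj _ a
      refine ⟨Finsupp.single (PLift.up rfl) (f ⟨[], IsWord.nil _⟩), (key _).trans (congrArg _ ?_)⟩
      ext ⟨l, hl⟩
      obtain rfl := List.length_eq_zero_iff.1 hl.wt
      simp

theorem isKoszul_tHyperCom : (tHyperCom k κ).IsKoszul :=
  ⟨isConnected_tHyperCom, fun n z hn => (hycPres k κ).subsingleton_barHomology z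
    (firstProj k κ z) (fun _ _ _ hj _ hf => firstProj_mem hj hf)
    (fun _ hi _ hf => firstProj_eq_zero hi hf) (fun f _ hj => sub_sum_firstProj_mem hj f) n hn⟩

end Presentation

/-! ### The diagonal of the bar construction: chains, cycles and the product of functionals. -/

section Diagonal

variable {ι : Type} {G : SymGens ι} {k : Type u} [Field k] {A : TwAlg k}
  {gap : ℕ → ∀ z, Submodule k (Word G z →₀ k)}

/-- Words as elements of the diagonal part of the bar construction. -/
noncomputable def GapPres.diag (P : GapPres A G gap) (n : ℕ) (z : Lab) :
    (Word G z →₀ k) →ₗ[k] (A.bar n).obj z := P.blocks n (List.replicate n 1) z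

theorem isComp_self_iff {n : ℕ} {L : List ℕ} : IsComp n L n ↔ L = List.replicate n 1 := by
  constructor
  · induction L generalizing n with
    | nil => intro h; rw [← h.length]; rfl
    | cons l L ih =>
      intro h
      obtain ⟨m, rfl⟩ : ∃ m, n = m + 1 := ⟨L.length, by rw [← h.length]; rfl⟩
      obtain ⟨h1, h2, h3⟩ := h.tail
      have h4 : L.length ≤ L.sum := List.length_le_sum_of_one_le L fun i hi => h2.pos i hi
      rw [h2.length, h2.sum] at h4
      obtain rfl : l = 1 := by omega
      rw [List.replicate_succ, ← ih (n := m) (by simpa using h2)]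
  · rintro rfl
    exact ⟨List.length_replicate, fun l hl => by rw [List.eq_of_mem_replicate hl]; exact one_pos,
      by simp⟩

theorem not_interior_replicate (n i : ℕ) : ¬ Interior (List.replicate n 1) i := by
  induction n generalizing i with
  | zero => exact id
  | succ n ih =>
    rw [List.replicate_succ]
    rintro (h | ⟨_, h⟩)
    · omega
    · exact ih _ h

theorem exists_interior : ∀ {n w : ℕ} {L : List ℕ}, IsComp n L w → n < w → ∃ i, Interior L i
  | n, w, [], h, hw => by have := h.sum; simp at this; omega
  | n, w, l :: L, h, hw => by
    obtain ⟨m, rfl⟩ : ∃ m, n = m + 1 := ⟨L.length, by rw [← h.length]; rfl⟩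
    obtain ⟨h1, h2, h3⟩ := h.tail
    by_cases hl : 1 < l
    · exact ⟨0, Or.inl (by omega)⟩
    · obtain ⟨i, hi⟩ := exists_interior h2 (by omega)
      exact ⟨i + l, Or.inr ⟨by omega, by rwa [Nat.add_sub_cancel]⟩⟩

/-- A composition of `n` with `n` positive parts has all parts equal to one, so only one summand of
the bar construction is present. -/
theorem GapPres.diag_surjective (P : GapPres A G gap) {n : ℕ} {z : Lab} (hz : z.wt = n) :
    Function.Surjective (P.diag n z) := by
  intro v
  have hv : v ∈ (Finsupp.supported (Word G z →₀ k) k {L | IsComp n L z.wt}).map (P.total n z) := by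
    rw [P.map_total_eq_top n z]; trivial
  obtain ⟨e, he, rfl⟩ := hv
  refine ⟨e (List.replicate n 1), ?_⟩
  have h1 : e = Finsupp.single (List.replicate n 1) (e (List.replicate n 1)) := by
    ext1 L
    by_cases hL : L = List.replicate n 1
    · rw [hL, Finsupp.single_eq_same]
    · rw [Finsupp.single_eq_of_ne hL]
      by_contra h
      have : IsComp n L z.wt := (Finsupp.mem_supported _ _).1 he (Finsupp.mem_support_iff.2 h)
      rw [hz] at this
      exact hL (isComp_self_iff.1 this)
  conv_rhs => rw [h1, P.total_single]
  rfl

/-- Coordinates on the diagonal part of the bar construction. -/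
noncomputable def GapPres.coord (P : GapPres A G gap) (n : ℕ) (z : Lab) (l : List (ι × Finset ℕ)) :
    Module.Dual k ((A.bar n).obj z) :=
  (cf l).comp (P.unblocks n (List.replicate n 1) z)

/-- Blocks of one letter contain no relations, so lifting back to words is exact. Hence `diag`
identifies words with a basis of the diagonal part. -/
theorem GapPres.coord_diag (P : GapPres A G gap) {n : ℕ} {z : Lab} (hz : z.wt = n)
    (l : List (ι × Finset ℕ)) (f : Word G z →₀ k) : P.coord n z l (P.diag n z f) = cf l f := by
  have hc := isComp_self_iff.2 (rfl : List.replicate n 1 = List.replicate n 1)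
  have h := P.unblocks_blocks n _ _ z hc.length hc.length hc.pos (by rw [hc.sum, hz]) f
  have h0 : blockRel gap (List.replicate n 1) z = ⊥ :=
    eq_bot_iff.2 (iSup₂_le fun i hi => absurd hi (not_interior_replicate n i))
  rw [h0, Submodule.mem_bot, if_pos rfl, sub_eq_zero] at h
  exact congrArg (cf l) h

theorem GapPres.diag_succ (P : GapPres A G gap) (n : ℕ) {z x y : Lab} (s : Splits z x y)
    (hx : x.wt = 1) (f : Word G x →₀ k) (g : Word G y →₀ k) :
    P.diag (n + 1) z (freeMul k G s f g) = A.bten n s (A.toAug x (P.π x f)) (P.diag n y g) :=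
  P.blocks_cons n 1 (List.replicate n 1) s hx f g

theorem GapPres.diag_map (P : GapPres A G gap) (σ : Equiv.Perm ℕ) : ∀ (n : ℕ) {z z' : Lab}
    (_ : z.wt = n) (h : z.move σ = z') (f : Word G z →₀ k),
    (A.bar n).map σ h (P.diag n z f) = P.diag n z' (freeMap k G σ h f)
  | 0, z, z', hz, h, f => by
    have key : ((A.bar 0).map σ h).comp (P.diag 0 z) =
        (P.diag 0 z').comp (freeMap k G σ h) := by
      apply word_ext
      rintro ⟨l, hl⟩
      obtain rfl := List.length_eq_zero_iff.1 (hl.wt.trans hz)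
      obtain rfl := IsWord.nil_iff.1 hl
      have hz' : z' = Lab.nil := by rw [← h]; ext1 <;> simp [Lab.nil, Lab.move]
      subst hz'
      rw [LinearMap.comp_apply, LinearMap.comp_apply, freeMap_single]
      have h1 : P.diag 0 Lab.nil (Finsupp.single ⟨[], hl⟩ 1) = A.bone := P.blocks_nil
      have h2 : P.diag 0 Lab.nil (Finsupp.single (Word.relabel σ h ⟨[], hl⟩) 1) = A.bone :=
        P.blocks_nil
      rw [h1, h2]
      exact (A.bar 0).map_id σ h (by simp [Lab.nil]) _
    exact LinearMap.congr_fun key f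
  | n + 1, z, z', hz, h, f => by
    have key : ((A.bar (n + 1)).map σ h).comp (P.diag (n + 1) z) =
        (P.diag (n + 1) z').comp (freeMap k G σ h) := by
      apply freeMul_ext (n := 1) (by omega)
      intro x y s hx U V
      have hs := s.wt
      subst h
      have e : freeMap k G σ rfl (freeMul k G s (Finsupp.single U 1) (Finsupp.single V 1)) =
          freeMul k G (s.move σ) (freeMap k G σ rfl (Finsupp.single U 1))
            (freeMap k G σ rfl (Finsupp.single V 1)) :=
        (free k G).map_mul σ s (s.move σ) rfl rfl rfl (Finsupp.single U 1) (Finsupp.single V 1)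
      rw [LinearMap.comp_apply, LinearMap.comp_apply, e, P.diag_succ n s hx,
        P.diag_succ n (s.move σ) hx, A.bar_map_bten n σ rfl s (s.move σ) rfl rfl,
        P.diag_map σ n (by omega) rfl]
      congr 2
      apply Subtype.ext
      rw [A.toAug_coe (by change x.wt ≠ 0; omega), ← P.map σ rfl]
      change A.map σ rfl (A.toAug x _).1 = _
      rw [A.toAug_coe (by omega)]
    exact LinearMap.congr_fun key f

theorem GapPres.conc_diag (P : GapPres A G gap) : ∀ (p : ℕ) {q n : ℕ} (h : q + p = n)
    {z x y : Lab} (s : Splits z x y) (_ : x.wt = p) (f : Word G x →₀ k) (g : Word G y →₀ k),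
    A.conc h s (P.diag p x f) (P.diag q y g) = P.diag n z (freeMul k G s f g)
  | 0, q, n, h, z, x, y, s, hx, f, g => by
    have hq : q = n := h
    subst hq
    have key : ((A.conc h s).flip (P.diag q y g)).comp (P.diag 0 x) =
        (P.diag q z).comp ((freeMul k G s).flip g) := by
      apply word_ext
      rintro ⟨l, hl⟩
      obtain rfl := List.length_eq_zero_iff.1 (hl.wt.trans hx)
      obtain rfl := IsWord.nil_iff.1 hl
      obtain rfl := s.nil_left
      have h1 : P.diag 0 Lab.nil (Finsupp.single ⟨[], hl⟩ 1) = A.bone := P.blocks_nil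
      rw [LinearMap.comp_apply, LinearMap.comp_apply, LinearMap.flip_apply, LinearMap.flip_apply,
        h1, A.conc_bone]
      exact congrArg _ ((free k G).one_mul s g).symm
    exact LinearMap.congr_fun key f
  | p + 1, q, n, h, z, x, y, s, hx, f, g => by
    obtain ⟨n, rfl⟩ : ∃ m, n = m + 1 := ⟨q + p, by omega⟩
    have key : ((A.conc h s).flip (P.diag q y g)).comp (P.diag (p + 1) x) =
        (P.diag (n + 1) z).comp ((freeMul k G s).flip g) := by
      apply freeMul_ext (n := 1) (by omega)
      intro u v t hu U V
      have ht := t.wt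
      rw [LinearMap.comp_apply, LinearMap.comp_apply, LinearMap.flip_apply, LinearMap.flip_apply,
        freeMul_assoc t s (s.inner' t) (s.outer' t), P.diag_succ n (s.outer' t) hu,
        P.diag_succ p t hu, A.conc_bten h (by omega) s t (s.outer' t) (s.inner' t),
        P.conc_diag p (by omega) (s.inner' t) (by omega)]
    exact LinearMap.congr_fun key f

/-- The bar construction vanishes where the weight is less than the syzygy degree, so only cuts with
weights exactly `p` and `q` matter. For these, deconcatenation cuts the word after `p` letters. -/
theorem GapPres.fprod_coord (P : GapPres A G gap) {p q n : ℕ} (h : q + p = n)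
    {z x y : Lab} (s : Splits z x y) (hx : x.wt = p) (hy : y.wt = q) {l m : List (ι × Finset ℕ)}
    (hl : IsWord G l x) (hm : IsWord G m y) :
    A.fprod h s (P.coord p x l) (P.coord q y m) = P.coord n z (l ++ m) := by
  have hz : z.wt = n := by have := s.wt; omega
  apply A.conc_ext h
  intro u v s' a b
  have hs' := s'.wt
  rcases lt_trichotomy u.wt p with hu | hu | hu
  · rw [A.bar_eq_zero p hu a]; simp
  swap
  · rw [A.bar_eq_zero q (z := v) (by omega) b]; simp
  have hv : v.wt = q := by omega
  obtain ⟨f, rfl⟩ := P.diag_surjective hu a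
  obtain ⟨g, rfl⟩ := P.diag_surjective hv b
  have e1 : (l ++ m).take p = l := by rw [← hx, ← hl.wt, List.take_left]
  have e2 : (l ++ m).drop p = m := by rw [← hx, ← hl.wt, List.drop_left]
  rw [P.conc_diag p h s' hu, P.coord_diag hz, cf_freeMul, hu, e1, e2]
  by_cases e : (u, v) = (x, y)
  · obtain ⟨rfl, rfl⟩ := Prod.mk.inj e
    have := A.fprod_same h s s' (P.coord p u l) (P.coord q v m) (P.diag p u f) (P.diag q v g)
    rw [P.conc_diag p h s' hu, P.coord_diag hu, P.coord_diag hv] at this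
    exact this
  · have := A.fprod_ne h s s' e (P.coord p x l) (P.coord q y m) (P.diag p u f) (P.diag q v g)
    rw [P.conc_diag p h s' hu] at this
    rw [this]
    by_cases hlu : IsWord G l u
    · by_cases hmv : IsWord G m v
      · exact absurd (Prod.ext (hlu.label_unique hl) (hmv.label_unique hm)) e
      · rw [cf_of_not_isWord hmv, mul_zero]
    · rw [cf_of_not_isWord hlu, zero_mul]

theorem GapPres.fmap_coord (P : GapPres A G gap) (σ : Equiv.Perm ℕ) {m n : ℕ} (hn : m = n)
    {x y : Lab} (h : x.move σ = y) (hx : x.wt = m) (l : List (ι × Finset ℕ)) :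
    A.fmap σ hn h (P.coord m x l) = P.coord n y (relabel σ l) := by
  subst hn
  have hy : y.wt = m := by rw [← hx, ← h]; rfl
  refine LinearMap.ext fun v => ?_
  obtain ⟨f, rfl⟩ := P.diag_surjective hy v
  rw [A.fmap_apply, P.diag_map _ _ hy, P.coord_diag hx, P.coord_diag hy]
  have e : freeMap k G σ h (freeMap k G σ⁻¹ (move_symm h) f) = f := by
    have h1 : y.move (σ * σ⁻¹) = y := by rw [mul_inv_cancel]; exact move_one rfl
    refine ((free k G).map_comp σ⁻¹ σ (move_symm h) h h1 f).trans ?_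
    exact (free k G).map_id _ h1 (fun i _ => by simp) f
  conv_rhs => rw [← e]
  rw [cf_freeMap]

/-- A part equal to `2` in position `j` comes only from merging at that position, so the coefficient
is a sign and nothing cancels it. -/
theorem mergeL_replicate (k : Type u) [Field k] (j m : ℕ) :
    mergeL k (List.replicate (j + (m + 2)) 1) (List.replicate j 1 ++ 2 :: List.replicate m 1) ≠ 0 := by
  induction j with
  | zero =>
    rw [zero_add, List.replicate_succ, List.replicate_succ, mergeL, Finsupp.sub_apply,
      List.replicate_zero, List.nil_append, Finsupp.single_eq_same, Finsupp.lmapDomain_apply,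
      Finsupp.mapDomain_of_notMem_range, sub_zero]
    · exact one_ne_zero
    · rintro ⟨L, hL⟩
      simp at hL
  | succ j ih =>
    rw [show j + 1 + (m + 2) = (j + (m + 1)) + 1 + 1 by omega, List.replicate_succ,
      List.replicate_succ, mergeL, ← List.replicate_succ, Finsupp.sub_apply, List.replicate_succ,
      List.cons_append, Finsupp.lmapDomain_apply, Finsupp.mapDomain_apply (List.cons_injective),
      Finsupp.single_eq_of_ne (by simp), zero_sub, neg_ne_zero]
    exact ih

theorem interior_replicate {j m i : ℕ} (h : Interior (List.replicate j 1 ++ 2 :: List.replicate m 1) i) :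
    i = j := by
  induction j generalizing i with
  | zero =>
    rcases h with h | ⟨_, h⟩
    · omega
    · exact absurd h (not_interior_replicate _ _)
  | succ j ih =>
    rcases h with h | ⟨h1, h⟩
    · omega
    · have := ih h; omega

/-- Diagonal cycles are the elements satisfying the relations of all pairs. -/
theorem GapPres.diag_mem_cycles (P : GapPres A G gap) {n : ℕ} {z : Lab} (hz : z.wt = n)
    (f : Word G z →₀ k) :
    P.diag n z f ∈ A.cycles n z ↔ ∀ i, i + 1 < n → f ∈ gap i z := by
  cases n with
  | zero => exact ⟨fun _ i hi => by omega, fun _ => trivial⟩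
  | succ n =>
    have hc := isComp_self_iff.2 (rfl : List.replicate (n + 1) 1 = List.replicate (n + 1) 1)
    have hm : mergeL k (List.replicate (n + 1) 1) ∈
        Finsupp.supported k k {L | IsComp n L z.wt} := by
      rw [hz]; exact mergeL_mem k n _ _ hc
    have hbd : A.bd n z (P.diag (n + 1) z f) =
        P.cut n z (mergeL k (List.replicate (n + 1) 1)) f :=
      P.bd_blocks n _ z (by rw [hz]; exact hc) f
    constructor
    · intro h i hi
      have h0 : P.cut n z (mergeL k (List.replicate (n + 1) 1)) f = 0 := hbd.symm.trans h
      obtain ⟨m, hn⟩ : ∃ m, n + 1 = i + (m + 2) := ⟨n + 1 - i - 2, by omega⟩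
      -- The composition with one part `2` in position `i` has `i` as its only interior gap, and it
      -- occurs in the differential with non-zero coefficient. So the vanishing of its component is
      -- the relation at `i`.
      have h1 := P.mem_blockRel_of_total_eq_zero (spread_mem hm f) ((lsum_spread _ _ _).trans h0)
        (L := List.replicate i 1 ++ 2 :: List.replicate m 1) (by simp; omega)
      rw [spread_apply, Submodule.smul_mem_iff _ (by rw [hn]; exact mergeL_replicate k i m)] at h1
      exact (iSup₂_le fun j hj => by rw [interior_replicate hj] :
        blockRel gap (List.replicate i 1 ++ 2 :: List.replicate m 1) z ≤ gap i z) h1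
    · intro h
      refine hbd.trans ?_
      rw [GapPres.cut, Finsupp.linearCombination_apply, Finsupp.sum, LinearMap.sum_apply]
      refine Finset.sum_eq_zero fun L hL => ?_
      have hL' : IsComp n L z.wt := (Finsupp.mem_supported _ _).1 hm hL
      -- A composition of `n + 1` with `n` parts has a block with at least two letters, and `f`
      -- satisfies the relation at a gap inside it.
      obtain ⟨i, hi⟩ := exists_interior hL' (by omega)
      have := hi.lt
      rw [hL'.sum, hz] at this
      rw [LinearMap.smul_apply, P.blocks_gap n L i z hi hL'.sum f (h i this), smul_zero]

end Diagonal

/-! ### Straightening of words modulo the gravity relations. -/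

section Straightening

variable {k : Type u} [Field k] {κ : ℕ}

theorem exists_of_not_isChain {α : Type*} {R : α → α → Prop} : ∀ {l : List α}, ¬ l.IsChain R →
    ∃ u x y v, l = u ++ x :: y :: v ∧ ¬ R x y
  | [], h => absurd List.IsChain.nil h
  | [x], h => absurd (List.isChain_singleton x) h
  | x :: y :: l, h => by
    by_cases hxy : R x y
    · obtain ⟨u, a, b, v, e, hab⟩ := exists_of_not_isChain (l := y :: l)
        fun h' => h (List.isChain_cons_cons.2 ⟨hxy, h'⟩)
      exact ⟨x :: u, a, b, v, by rw [e]; rfl, hab⟩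
    · exact ⟨[], x, y, l, rfl, hxy⟩

/-- The gravity relations between the values of a function of words with given label. -/
def GravRel {M : Type*} [AddCommGroup M] (κ : ℕ) (z : Lab) (g : List (ℕ × Finset ℕ) → M) : Prop :=
  ∀ (u v : List (ℕ × Finset ℕ)) (p q : ℕ) (I J : Finset ℕ),
    IsWord (hycGens κ) (u ++ (p, I) :: (q, J) :: v) z →
    (0 < p → g (u ++ (p, I) :: (q, J) :: v) =
      ∑ a ∈ I, g (u ++ (0, {a}) :: (p + q, (I ∪ J) \ {a}) :: v)) ∧
    ∑ a ∈ I ∪ J, g (u ++ (0, {a}) :: (p + q, (I ∪ J) \ {a}) :: v) = 0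

/-- The words all of whose pairs of adjacent letters are bad. -/
abbrev BadWord (κ : ℕ) (z : Lab) : Type := {W : Word (hycGens κ) z // W.1.IsChain Bad}

/-- Every word is a combination of words whose pairs are all bad, modulo the gravity relations. -/
theorem GravRel.mem_span {M : Type*} [AddCommGroup M] [Module k M] {z : Lab}
    {g : List (ℕ × Finset ℕ) → M} (hg : GravRel κ z g) (W : Word (hycGens κ) z) :
    g W.1 ∈ Submodule.span k (Set.range fun V : BadWord κ z => g V.1.1) := by
  classical
  have := Fintype.ofFinite (Word (hycGens κ) z)
  set S := Submodule.span k (Set.range fun V : BadWord κ z => g V.1.1)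
  by_contra hW
  -- There are finitely many words of label `z`, so a counterexample of greatest rank can be chosen.
  -- The relations will rewrite it through words of strictly greater rank.
  obtain ⟨⟨l, hl⟩, hlS, hmax⟩ := (Finset.univ.filter fun W : Word (hycGens κ) z =>
    g W.1 ∉ S).exists_max_image (fun W => W.1.map rk) ⟨W, by simpa using hW⟩
  rw [Finset.mem_filter] at hlS
  have hgt : ∀ l', IsWord (hycGens κ) l' z → l.map rk < l'.map rk → g l' ∈ S := by
    intro l' hl' hlt
    by_contra h
    exact absurd (hmax ⟨l', hl'⟩ (by simpa using h)) (not_le.2 hlt)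
  have hnc : ¬ l.IsChain Bad := fun h => hlS.2 (Submodule.subset_span ⟨⟨⟨l, hl⟩, h⟩, rfl⟩)
  obtain ⟨u, ⟨p, I⟩, ⟨q, J⟩, v, rfl, hb⟩ := exists_of_not_isChain hnc
  -- The letter `(0, {a})` has rank `a + 1`. The letters before it are unchanged, so a larger rank
  -- there raises the whole word, whatever follows.
  have hstep : ∀ a ∈ I ∪ J, rk (p, I) < a + 1 →
      g (u ++ (0, {a}) :: (p + q, (I ∪ J) \ {a}) :: v) ∈ S := by
    intro a ha hlt
    refine hgt _ (hl.pair_single ha) ?_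
    rw [List.map_append, List.map_append]
    refine append_lt_append_left _ (List.cons_lt_cons_iff.2 (Or.inl ?_))
    rwa [rk.eq_1 (0, {a}), if_pos rfl, mn_singleton]
  obtain ⟨h1, h2⟩ := hg u v p q I J hl
  obtain ⟨hI, -, hd, -⟩ := hl.pair
  apply hlS.2
  -- For `p = 0` the letter is a singleton `{a}`, and the failure of badness means that `a` is
  -- smaller than all points of `J`; the second relation moves these points to the front. For `p >
  -- 0` the rank is zero, and every term of the first relation has greater rank.
  rcases Nat.eq_zero_or_pos p with rfl | hp
  · rw [zero_mul, add_zero, Finset.card_eq_one] at hI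
    obtain ⟨a, rfl⟩ := hI
    rw [← Finset.insert_eq, Finset.sum_insert (Finset.disjoint_singleton_left.1 hd),
      Finset.insert_eq, Finset.union_sdiff_cancel_left hd, zero_add] at h2
    change g (u ++ (0, {a}) :: (q, J) :: v) ∈ S
    rw [eq_neg_of_add_eq_zero_left h2]
    refine Submodule.neg_mem _ (Submodule.sum_mem _ fun b hb' => ?_)
    have := hstep b (Finset.mem_union_right _ hb') (by
      rw [rk, if_pos rfl, mn_singleton]
      have h3 : ¬ mn (q, J) < a := fun h => hb ⟨rfl, by rwa [mn_singleton]⟩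
      have h4 : mn (q, J) ≤ b := mn_le hb'
      have h5 : a ≠ b := fun e => Finset.disjoint_left.1 hd (Finset.mem_singleton_self a) (e ▸ hb')
      omega)
    rwa [zero_add] at this
  · change g (u ++ (p, I) :: (q, J) :: v) ∈ S
    rw [h1 hp]
    refine Submodule.sum_mem _ fun b hb' => hstep b (Finset.mem_union_left _ hb') ?_
    rw [rk, if_neg (show p ≠ 0 by omega)]
    omega

end Straightening

/-! ### The dual of the Koszul dual comonoid: coordinates, relations and a basis. -/

section DualCoordinates

variable {k : Type u} [Field k] {κ : ℕ}

/-- The classes of the coordinates in the dual of the Koszul dual comonoid. -/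
noncomputable def dualCoord (k : Type u) [Field k] (κ : ℕ) (y : Lab) (l : List (ℕ × Finset ℕ)) :
    (tHyperCom k κ).dualAlg.obj y :=
  (tHyperCom k κ).barDual.toQuot (tHyperCom k κ).dualIdeal y ((hycPres k κ).coord y.wt y.dual l)

/-- Evaluation at a diagonal cycle. -/
noncomputable def evalCycle {y : Lab} {f : Word (hycGens κ) y.dual →₀ k}
    (hf : ∀ i, i + 1 < y.wt → f ∈ Grav k κ i y.dual) : (tHyperCom k κ).dualAlg.obj y →ₗ[k] k :=
  (((tHyperCom k κ).cycles y.wt y.dual).dualAnnihilator).liftQ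
    (Module.Dual.eval k _ ((hycPres k κ).diag y.wt y.dual f))
    (fun φ hφ => (Submodule.mem_dualAnnihilator φ).1 hφ _
      (((hycPres k κ).diag_mem_cycles rfl f).2 hf))

theorem evalCycle_dualCoord {y : Lab} {f : Word (hycGens κ) y.dual →₀ k}
    (hf : ∀ i, i + 1 < y.wt → f ∈ Grav k κ i y.dual) (l : List (ℕ × Finset ℕ)) :
    evalCycle hf (dualCoord k κ y l) = cf l f :=
  (hycPres k κ).coord_diag rfl l f

/-- Elements of the quotient are functionals on the diagonal cycles, and these cycles are exactly
the combinations of words that satisfy the gravity equations at all places. -/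
theorem dualAlg_eq_zero {y : Lab} (a : (tHyperCom k κ).dualAlg.obj y)
    (h : ∀ (f : Word (hycGens κ) y.dual →₀ k) (hf : ∀ i, i + 1 < y.wt → f ∈ Grav k κ i y.dual),
      evalCycle hf a = 0) : a = 0 := by
  obtain ⟨φ, rfl⟩ := toQuot_surjective _ (tHyperCom k κ).dualIdeal y a
  refine (TwAlg.toQuot_eq_zero _ _).2 ((Submodule.mem_dualAnnihilator φ).2 fun v hv => ?_)
  obtain ⟨f, rfl⟩ := (hycPres k κ).diag_surjective (n := y.wt) (z := y.dual) rfl v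
  exact h f (((hycPres k κ).diag_mem_cycles rfl f).1 hv)

/-- Evaluated at a cycle, a relation between coordinates becomes the gravity equation for its
coefficients, and evaluations separate elements. -/
theorem dualCoord_gravRel (y : Lab) : GravRel κ y.dual (dualCoord k κ y) := by
  intro u v p q I J hw
  have hlen := hw.wt
  simp only [List.length_append, List.length_cons] at hlen
  obtain ⟨h1, h2, h3, h4⟩ := hw.pair
  have hi : u.length + 1 < y.wt := by change _ < y.dual.wt; omega
  refine ⟨fun hp => ?_, ?_⟩
  · refine sub_eq_zero.1 (dualAlg_eq_zero _ fun f hf => ?_)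
    rw [map_sub, map_sum, sub_eq_zero, evalCycle_dualCoord]
    simp only [evalCycle_dualCoord]
    exact (hf _ hi u v rfl).1 p q I J hp h1 h2 h3
  · refine dualAlg_eq_zero _ fun f hf => ?_
    rw [map_sum]
    simp only [evalCycle_dualCoord]
    exact (hf _ hi u v rfl).2 (p + q) (I ∪ J) h4

/-- In a vanishing combination take a word `V` of least rank and evaluate at the minor of `V`, which
is a cycle. This minor involves, besides `V`, only words of smaller rank, so only the coefficient of
`V` is left. -/
theorem linearIndependent_dualCoord (y : Lab) :
    LinearIndependent k (fun V : BadWord κ y.dual => dualCoord k κ y V.1.1) := by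
  rw [linearIndependent_iff]
  intro c hc
  by_contra hne
  obtain ⟨V, hV, hmin⟩ := c.support.exists_min_image (fun V => V.1.1.map rk)
    (Finsupp.support_nonempty_iff.2 hne)
  have h := congrArg (evalCycle (k := k) (f := minor k κ (mins V.1.1) y.dual)
    fun i _ => minor_mem_grav _ _ _) hc
  rw [Finsupp.linearCombination_apply, Finsupp.sum, map_sum, map_zero,
    Finset.sum_eq_single_of_mem V hV, map_smul, evalCycle_dualCoord, cf_minor_self V.1.2,
    smul_eq_mul, mul_one] at h
  · exact Finsupp.mem_support_iff.1 hV h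
  · intro W hW hWV
    rw [map_smul, evalCycle_dualCoord]
    by_contra hne'
    rcases eq_or_lt_of_cf_minor V.1.2 V.2 (right_ne_zero_of_mul hne') with h1 | h1
    · exact hWV (Subtype.ext (Subtype.ext h1))
    · exact absurd h1 (not_lt.2 (hmin W hW))

/-- Words of a given label are finite in number, so every functional on the diagonal part is a
combination of coordinates. -/
theorem span_coord (y : Lab) :
    Submodule.span k (Set.range fun W : Word (hycGens κ) y.dual => dualCoord k κ y W.1) = ⊤ := by
  classical
  rw [eq_top_iff]
  intro a _
  obtain ⟨φ, rfl⟩ := toQuot_surjective _ (tHyperCom k κ).dualIdeal y a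
  have := Fintype.ofFinite (Word (hycGens κ) y.dual)
  have e : ∀ φ : Module.Dual k (((tHyperCom k κ).bar y.wt).obj y.dual),
      φ = ∑ W : Word (hycGens κ) y.dual,
        (φ ((hycPres k κ).diag y.wt y.dual (Finsupp.single W 1))) •
          (hycPres k κ).coord y.wt y.dual W.1 := by
    intro φ
    refine LinearMap.ext fun v => ?_
    obtain ⟨f, rfl⟩ := (hycPres k κ).diag_surjective (n := y.wt) (z := y.dual) rfl v
    rw [LinearMap.sum_apply]
    simp only [LinearMap.smul_apply, (hycPres k κ).coord_diag (n := y.wt) (z := y.dual) rfl, cf_word, smul_eq_mul]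
    conv_lhs => rw [← Finsupp.univ_sum_single f, map_sum, map_sum]
    refine Finset.sum_congr rfl fun W _ => ?_
    rw [← mul_one (f W), ← smul_eq_mul, ← Finsupp.smul_single, map_smul, map_smul, smul_eq_mul,
      mul_comm, smul_eq_mul, mul_one]
  let T : Module.Dual k (((tHyperCom k κ).bar y.wt).obj y.dual) →ₗ[k]
    (tHyperCom k κ).dualAlg.obj y := (tHyperCom k κ).barDual.toQuot (tHyperCom k κ).dualIdeal y
  change T φ ∈ _
  rw [e φ, map_sum]
  refine Submodule.sum_mem _ fun W _ => ?_
  rw [map_smul]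
  exact Submodule.smul_mem _ _ (Submodule.subset_span ⟨W, rfl⟩)

theorem span_dualCoord (y : Lab) :
    Submodule.span k (Set.range fun V : BadWord κ y.dual => dualCoord k κ y V.1.1) = ⊤ := by
  rw [eq_top_iff, ← span_coord, Submodule.span_le]
  rintro _ ⟨W, rfl⟩
  exact (dualCoord_gravRel y).mem_span W

/-- The basis of the dual of the Koszul dual comonoid formed by the words whose pairs are
all bad. -/
noncomputable def dualBasis (k : Type u) [Field k] (κ : ℕ) (y : Lab) :
    Module.Basis (BadWord κ y.dual) k ((tHyperCom k κ).dualAlg.obj y) :=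
  Module.Basis.mk (linearIndependent_dualCoord y) (span_dualCoord y).ge

theorem dualCoord_mul {x y z : Lab} (s : Splits z x y) {l m : List (ℕ × Finset ℕ)}
    (hl : IsWord (hycGens κ) l x.dual) (hm : IsWord (hycGens κ) m y.dual) :
    (tHyperCom k κ).dualAlg.mul s (dualCoord k κ x l) (dualCoord k κ y m) =
      sg k ((x.deg : ZMod 2) * (y.deg : ZMod 2)) • dualCoord k κ z (l ++ m) := by
  have h := (hycPres k κ).fprod_coord s.wt' s.dual rfl rfl hl hm
  have h' := congrArg (fun φ => (tHyperCom k κ).barDual.toQuot (tHyperCom k κ).dualIdeal z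
    (sg k ((x.deg : ZMod 2) * (y.deg : ZMod 2)) • φ)) h
  exact h'

theorem dualCoord_map (σ : Equiv.Perm ℕ) {x y : Lab} (h : x.move σ = y)
    (l : List (ℕ × Finset ℕ)) :
    (tHyperCom k κ).dualAlg.map σ h (dualCoord k κ x l) = dualCoord k κ y (relabel σ l) :=
  congrArg ((tHyperCom k κ).barDual.toQuot (tHyperCom k κ).dualIdeal y)
    ((hycPres k κ).fmap_coord σ (wt_move h) (dual_move h) rfl l)

theorem dualCoord_one : (tHyperCom k κ).dualAlg.one = dualCoord k κ Lab.nil [] := by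
  refine congrArg ((tHyperCom k κ).barDual.toQuot (tHyperCom k κ).dualIdeal Lab.nil) ?_
  apply TwAlg.bar_zero_induction
  intro h
  have h1 : (hycPres k κ).diag 0 Lab.nil (Finsupp.single ⟨[], IsWord.nil _⟩ 1) =
    (tHyperCom k κ).bone := (hycPres k κ).blocks_nil
  have h2 := (hycPres k κ).coord_diag (n := 0) (z := Lab.nil) rfl []
    (Finsupp.single ⟨[], IsWord.nil _⟩ 1)
  classical
  rw [h1, cf_single, if_pos rfl] at h2
  refine Eq.trans ?_ h2.symm
  refine (Finsupp.linearCombination_single k (1 : k) _).trans ?_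
  simp

end DualCoordinates

/-! ### The gravity presentation of the double suspension. -/

section GravityAlgebra

variable {k : Type u} [Field k] {κ : ℕ}

theorem card_eq_sum_of_disjoint {ι : Type} {l : List (ι × Finset ℕ)}
    (hd : l.Pairwise (fun a b => Disjoint a.2 b.2)) {S : Finset ℕ}
    (hS : ∀ i, i ∈ S ↔ ∃ a ∈ l, i ∈ a.2) : S.card = (l.map (fun a => a.2.card)).sum := by
  induction l generalizing S with
  | nil =>
    rw [List.map_nil, List.sum_nil, Finset.card_eq_zero]
    ext i
    rw [hS]
    simp
  | cons a l ih =>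
    rw [List.pairwise_cons] at hd
    have hsub : a.2 ⊆ S := fun i hi => (hS i).2 ⟨a, List.mem_cons_self, hi⟩
    rw [List.map_cons, List.sum_cons, ← ih hd.2 (S := S \ a.2), Finset.card_sdiff_of_subset hsub,
      Nat.add_sub_cancel' (Finset.card_le_card hsub)]
    intro i
    rw [Finset.mem_sdiff, hS]
    constructor
    · rintro ⟨⟨b, hb, hib⟩, hia⟩
      rcases List.mem_cons.1 hb with rfl | hb
      · exact absurd hib hia
      · exact ⟨b, hb, hib⟩
    · rintro ⟨b, hb, hib⟩
      exact ⟨⟨b, List.mem_cons_of_mem _ hb, hib⟩,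
        fun hia => Finset.disjoint_left.1 (hd.1 b hb) hia hib⟩

theorem sum_card_eq {l : List (ℕ × Finset ℕ)} (h : ∀ a ∈ l, a.2.card = 1 + a.1 * (κ - 1)) :
    (l.map (fun a => a.2.card)).sum = l.length + (l.map Prod.fst).sum * (κ - 1) := by
  induction l with
  | nil => simp
  | cons a l ih =>
    rw [List.map_cons, List.sum_cons, ih fun b hb => h b (List.mem_cons_of_mem _ hb),
      h a List.mem_cons_self, List.map_cons, List.sum_cons, List.length_cons]
    ring

theorem sum_deg_gravGens (l : List (ℕ × Finset ℕ)) :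
    (l.map (fun a => (gravGens κ).deg a.1)).sum =
      l.length + 2 * ((l.map Prod.fst).sum : ℕ) * ((κ : ℤ) - 2) := by
  induction l with
  | nil => simp
  | cons a l ih =>
    rw [List.map_cons, List.sum_cons, ih, List.map_cons, List.sum_cons, List.length_cons]
    simp only [gravGens]
    push_cast
    ring

/-- Only degrees are at stake. With `P` the sum of the indices and `w` the weight, the support has
`w + P (κ - 1)` points. Thus `d = w + 2 P (κ - 2)` amounts to `-(d - 2 |N|) - w = 2 P`, which is the
degree condition for `hycGens`. The bound on `κ` makes the truncated `κ - 1` the true difference. -/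
theorem isWord_grav_iff (hκ : 1 ≤ κ) {l : List (ℕ × Finset ℕ)} {x : Lab} :
    IsWord (gravGens κ) l x ↔ IsWord (hycGens κ) l x.shift.shift.dual := by
  have key : (∀ a ∈ l, a.2.card = 1 + a.1 * (κ - 1)) →
      l.Pairwise (fun a b => Disjoint a.2 b.2) →
      (∀ i, i ∈ x.supp ↔ ∃ a ∈ l, i ∈ a.2) → l.length = x.wt →
      ((l.map (fun a => (gravGens κ).deg a.1)).sum = x.deg ↔
        (l.map (fun a => (hycGens κ).deg a.1)).sum = x.shift.shift.dual.deg) := by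
    intro h1 h2 h3 h4
    have h5 := card_eq_sum_of_disjoint h2 h3
    rw [sum_card_eq h1] at h5
    rw [sum_deg_gravGens, sum_deg_hycGens]
    simp only [Lab.shift, Lab.dual]
    rw [h5, ← h4]
    push_cast [hκ]
    constructor <;> intro h <;> linarith
  constructor
  · intro h
    exact ⟨h.has, h.disj, h.supp, (key h.has h.disj h.supp h.wt).1 h.deg, h.wt⟩
  · intro h
    exact ⟨h.has, h.disj, h.supp, (key h.has h.disj h.supp h.wt).2 h.deg, h.wt⟩

theorem choose_two_add (m n : ℕ) :
    (m + n).choose 2 = m.choose 2 + n.choose 2 + m * n := by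
  induction n with
  | zero => simp
  | succ n ih =>
    rw [← add_assoc, Nat.choose_succ_succ' (m + n) 1, ih, Nat.choose_succ_succ' n 1,
      Nat.choose_one_right, Nat.choose_one_right]
    ring

/-- The double suspension of the dual of the Koszul dual comonoid of `tHyperCom`. -/
noncomputable abbrev gravDual (k : Type u) [Field k] (κ : ℕ) : TwAlg k :=
  (tHyperCom k κ).koszulDual.twist

/-- The sign making the double suspension a sign-free concatenation. -/
def gravSign (k : Type u) [Field k] (x : Lab) : k :=
  sg k ((x.supp.card.choose 2 + x.wt.choose 2 : ℕ) : ZMod 2)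

/-- The coordinates, as elements of the double suspension. -/
noncomputable def gravCoord (k : Type u) [Field k] (κ : ℕ) (x : Lab) (l : List (ℕ × Finset ℕ)) :
    (gravDual k κ).obj x := gravSign k x • dualCoord k κ x.shift.shift l

theorem sg_mul_self (e : ZMod 2) : sg k e * sg k e = 1 := by
  rw [← sg_add, CharTwo.add_self_eq_zero, sg_zero]

theorem gravDual_mul {x y z : Lab} (s : Splits z x y)
    (a : (tHyperCom k κ).dualAlg.obj x.shift.shift) (b : (tHyperCom k κ).dualAlg.obj y.shift.shift) :
    (gravDual k κ).mul s a b =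
      (sg k ((x.shift.deg : ZMod 2) * (y.supp.card : ZMod 2) + cross x.supp y.supp) *
        sg k ((x.shift.shift.deg : ZMod 2) * (y.supp.card : ZMod 2) + cross x.supp y.supp)) •
        (tHyperCom k κ).dualAlg.mul s.shift.shift a b := by
  rw [mul_smul]
  rfl

theorem TwAlg.mul_smul_smul (A : TwAlg k) {x y z : Lab} (s : Splits z x y) (c d : k)
    (a : A.obj x) (b : A.obj y) :
    A.mul s (c • a) (d • b) = (c * d) • A.mul s a b := by
  rw [map_smul, map_smul, LinearMap.smul_apply, smul_smul, mul_comm]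

theorem smul_smul_smul_eq {M : Type*} [AddCommGroup M] [Module k M] {c d e f : k} (v : M)
    (h : c * (d * e) = f) : c • d • e • v = f • v := by
  rw [smul_smul, smul_smul, mul_assoc, h]

/-- Modulo two, the two suspensions together contribute `|x| |y|`, as the crossings cancel, and the
product of functionals contributes the product of the weights, because the dual labels have even
degree. Both are removed by the binomials in `gravSign`, in view of `choose_two_add`. -/
theorem gravCoord_mul (hκ : 1 ≤ κ) {x y z : Lab} (s : Splits z x y) {l m : List (ℕ × Finset ℕ)}
    (hl : IsWord (gravGens κ) l x) (hm : IsWord (gravGens κ) m y) :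
    (gravDual k κ).mul s (gravCoord k κ x l) (gravCoord k κ y m) = gravCoord k κ z (l ++ m) := by
  have hl' := (isWord_grav_iff hκ).1 hl
  have hm' := (isWord_grav_iff hκ).1 hm
  refine (TwAlg.mul_smul_smul _ s _ _ _ _).trans ?_
  rw [gravDual_mul, dualCoord_mul _ hl' hm']
  refine smul_smul_smul_eq _ ?_
  simp only [gravSign, ← sg_add]
  congr 1
  have e1 : (x.shift.deg : ZMod 2) = x.shift.shift.deg + x.supp.card := by
    simp [Lab.shift]
  have e2 : (x.shift.shift.deg : ZMod 2) = x.wt := by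
    have := hl'.even_deg
    simp only [Lab.dual] at this
    push_cast at this
    have h2 : (2 : ZMod 2) = 0 := rfl
    have e : (x.shift.shift.wt : ZMod 2) = x.wt := rfl
    linear_combination -this - (x.wt : ZMod 2) * h2 - e
  have e3 : (y.shift.shift.deg : ZMod 2) = y.wt := by
    have := hm'.even_deg
    simp only [Lab.dual] at this
    push_cast at this
    have h2 : (2 : ZMod 2) = 0 := rfl
    have e : (y.shift.shift.wt : ZMod 2) = y.wt := rfl
    linear_combination -this - (y.wt : ZMod 2) * h2 - e
  have e4 := Finset.card_union_of_disjoint s.disj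
  rw [s.supp] at e4
  rw [e1, e2, e3, e4, ← s.wt, choose_two_add, choose_two_add]
  push_cast
  have h2 : (2 : ZMod 2) = 0 := rfl
  linear_combination ((x.wt : ZMod 2) * y.supp.card + cross x.supp y.supp) * h2

/-- Each suspension contributes the sign of the permutation on the support; two of them cancel. -/
theorem gravCoord_map (σ : Equiv.Perm ℕ) {x y : Lab} (h : x.move σ = y)
    (l : List (ℕ × Finset ℕ)) :
    (gravDual k κ).map σ h (gravCoord k κ x l) = gravCoord k κ y (relabel σ l) := by
  have h1 : (gravDual k κ).map σ h (gravCoord k κ x l) = gravSign k x •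
      (sg k (inv σ x.supp) • sg k (inv σ x.supp) •
        (tHyperCom k κ).dualAlg.map σ (shift_move (shift_move h)) (dualCoord k κ _ l)) :=
    map_smul ((gravDual k κ).map σ h) _ _
  have h2 : gravSign k x = gravSign k y := by
    subst h
    simp [gravSign, Lab.move]
  rw [h1, smul_smul (sg k _), sg_mul_self, one_smul, dualCoord_map, h2]
  rfl

theorem gravCoord_one : (gravDual k κ).one = gravCoord k κ Lab.nil [] := by
  have h1 : gravSign k Lab.nil = 1 := by simp [gravSign, Lab.nil, sg_zero]
  rw [gravCoord, h1, one_smul]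
  exact dualCoord_one

theorem gravSign_ne_zero (x : Lab) : gravSign k x ≠ 0 := by
  intro h
  have := sg_mul_self (k := k) ((x.supp.card.choose 2 + x.wt.choose 2 : ℕ) : ZMod 2)
  rw [show sg k _ = 0 from h, mul_zero] at this
  exact zero_ne_one this

theorem dualCoord_of_not_isWord {y : Lab} {l : List (ℕ × Finset ℕ)}
    (h : ¬ IsWord (hycGens κ) l y.dual) : dualCoord k κ y l = 0 := by
  refine dualAlg_eq_zero _ fun f hf => ?_
  rw [evalCycle_dualCoord, cf_of_not_isWord h]

/-- The morphism from a free algebra to the double suspension. -/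
noncomputable def gravLift (k : Type u) [Field k] (κ : ℕ) (x : Lab) :
    (Word (gravGens κ) x →₀ k) →ₗ[k] (gravDual k κ).obj x :=
  Finsupp.linearCombination k (fun W => gravCoord k κ x W.1)

theorem gravLift_single {x : Lab} (W : Word (gravGens κ) x) :
    gravLift k κ x (Finsupp.single W 1) = gravCoord k κ x W.1 := by
  rw [gravLift, Finsupp.linearCombination_single, one_smul]

theorem gravLift_wmono (hκ : 1 ≤ κ) (x : Lab) (l : List (ℕ × Finset ℕ)) :
    gravLift k κ x (wmono k (gravGens κ) l x) = gravCoord k κ x l := by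
  by_cases h : IsWord (gravGens κ) l x
  · rw [wmono_of_isWord h, gravLift_single]
  · rw [wmono_of_not_isWord h, map_zero, gravCoord,
      dualCoord_of_not_isWord fun h' => h ((isWord_grav_iff hκ).2 h'), smul_zero]
    rfl

theorem gravLift_mul (hκ : 1 ≤ κ) {x y z : Lab} (s : Splits z x y)
    (f : Word (gravGens κ) x →₀ k) (g : Word (gravGens κ) y →₀ k) :
    gravLift k κ z (freeMul k _ s f g) =
      (gravDual k κ).mul s (gravLift k κ x f) (gravLift k κ y g) := by
  have : (freeMul k (gravGens κ) s).compr₂ (gravLift k κ z) =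
      ((gravDual k κ).mul s).compl₁₂ (gravLift k κ x) (gravLift k κ y) := by
    apply word_ext
    intro U
    apply word_ext
    intro V
    rw [LinearMap.compr₂_apply, freeMul_single, LinearMap.compl₁₂_apply, gravLift_single,
      gravLift_single, gravLift_single, gravCoord_mul hκ s U.2 V.2]
    rfl
  exact LinearMap.congr_fun (LinearMap.congr_fun this f) g

theorem gravLift_map (σ : Equiv.Perm ℕ) {x y : Lab} (h : x.move σ = y)
    (f : Word (gravGens κ) x →₀ k) :
    gravLift k κ y (freeMap k _ σ h f) = (gravDual k κ).map σ h (gravLift k κ x f) := by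
  have : (gravLift k κ y).comp (freeMap k (gravGens κ) σ h) =
      ((gravDual k κ).map σ h).comp (gravLift k κ x) := by
    apply word_ext
    intro W
    rw [LinearMap.comp_apply, freeMap_single, gravLift_single, LinearMap.comp_apply,
      gravLift_single, gravCoord_map]
    rfl
  exact LinearMap.congr_fun this f

/-- The kernel of the morphism from a free algebra to the double suspension. -/
noncomputable def gravKer (k : Type u) [Field k] {κ : ℕ} (hκ : 1 ≤ κ) :
    TwIdeal (free k (gravGens κ)) where
  carrier x := LinearMap.ker (gravLift k κ x)
  map_mem {σ x y} h {a} ha := by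
    refine LinearMap.mem_ker.2 ((gravLift_map σ h a).trans ?_)
    exact (congrArg _ (LinearMap.mem_ker.1 ha)).trans (map_zero _)
  mul_mem_left {z x y} s a b hb := by
    refine LinearMap.mem_ker.2 ((gravLift_mul hκ s a b).trans ?_)
    exact (congrArg _ (LinearMap.mem_ker.1 hb)).trans (map_zero _)
  mul_mem_right {z x y} s a b ha := by
    refine LinearMap.mem_ker.2 ((gravLift_mul hκ s a b).trans ?_)
    rw [show gravLift k κ x a = 0 from ha, map_zero, LinearMap.zero_apply]

/-- The ideal of relations of `tGrav`. -/
noncomputable abbrev tGravIdeal (k : Type u) [Field k] (κ : ℕ) : TwIdeal (free k (gravGens κ)) :=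
  TwIdeal.span _ (fun x =>
    {r | ∃ (m m' : ℕ) (I J : Finset ℕ), Disjoint I J ∧ I ∪ J = x.supp ∧ 0 < m ∧
        I.card = 1 + m * (κ - 1) ∧ J.card = 1 + m' * (κ - 1) ∧
        r = ∑ i ∈ I, mono k (gravGens κ) [(0, {i}), (m + m', x.supp \ {i})] x -
          mono k (gravGens κ) [(m, I), (m', J)] x} ∪
    {r | ∃ D : ℕ, x.supp.card = 2 + D * (κ - 1) ∧
        r = ∑ i ∈ x.supp, mono k (gravGens κ) [(0, {i}), (D, x.supp \ {i})] x})

/-- The rescaling sign depends on the label only, so it factors out of each relator and leaves a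
gravity relation between coordinates. In weights other than two, all terms vanish. -/
theorem tGravIdeal_le (hκ : 1 ≤ κ) (x : Lab) :
    (tGravIdeal k κ).carrier x ≤ (gravKer k hκ).carrier x := by
  refine TwIdeal.span_le (fun y => ?_) x
  have hlin : ∀ (I : Finset ℕ) (a : ℕ → List (ℕ × Finset ℕ)),
      ∑ i ∈ I, dualCoord k κ y.shift.shift (a i) = 0 → ∑ i ∈ I, gravCoord k κ y (a i) = 0 := by
    intro I a h
    refine (Finset.smul_sum (M := k) (N := (tHyperCom k κ).dualAlg.obj y.shift.shift)).symm.trans ?_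
    rw [h, smul_zero]
    rfl
  have hlin' : ∀ (I : Finset ℕ) (a : ℕ → List (ℕ × Finset ℕ)) (b : List (ℕ × Finset ℕ)),
      ∑ i ∈ I, dualCoord k κ y.shift.shift (a i) = dualCoord k κ y.shift.shift b →
        ∑ i ∈ I, gravCoord k κ y (a i) = gravCoord k κ y b := by
    intro I a b h
    refine (Finset.smul_sum (M := k) (N := (tHyperCom k κ).dualAlg.obj y.shift.shift)).symm.trans ?_
    rw [h]
    rfl
  rintro _ (⟨m, m', I, J, hd, hs, hm, hI, hJ, rfl⟩ | ⟨D, hD, rfl⟩)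
  · change gravLift k κ y (∑ i ∈ I, wmono k (gravGens κ) [(0, {i}), (m + m', y.supp \ {i})] y -
      wmono k (gravGens κ) [(m, I), (m', J)] y) = 0
    rw [map_sub, map_sum]
    simp only [gravLift_wmono hκ]
    refine sub_eq_zero.2 (hlin' _ _ _ (sub_eq_zero.1 (dualAlg_eq_zero _ fun f hf => ?_)))
    rw [map_sub, map_sum]
    simp only [evalCycle_dualCoord]
    by_cases hy : y.wt = 2
    · have := (hf 0 (by change 0 + 1 < y.wt; omega) [] [] rfl).1 m m' I J hm hI hJ hd
      rw [hs] at this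
      exact sub_eq_zero.2 this.symm
    · have hz : ∀ a b : ℕ × Finset ℕ, cf [a, b] f = 0 := fun a b => cf_of_length_ne
        (fun h => hy h.symm) f
      simp [hz]
  · change gravLift k κ y (∑ i ∈ y.supp, wmono k (gravGens κ) [(0, {i}), (D, y.supp \ {i})] y) = 0
    rw [map_sum]
    simp only [gravLift_wmono hκ]
    refine hlin _ _ (dualAlg_eq_zero _ fun f hf => ?_)
    rw [map_sum]
    simp only [evalCycle_dualCoord]
    by_cases hy : y.wt = 2
    · exact (hf 0 (by change 0 + 1 < y.wt; omega) [] [] rfl).2 D y.supp hD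
    · have hz : ∀ a b : ℕ × Finset ℕ, cf [a, b] f = 0 := fun a b => cf_of_length_ne
        (fun h => hy h.symm) f
      simp [hz]

/-- The classes of words in `tGrav`. -/
noncomputable def gravMono (k : Type u) [Field k] (κ : ℕ) (x : Lab) (l : List (ℕ × Finset ℕ)) :
    (tGrav k κ).obj x := (free k (gravGens κ)).toQuot (tGravIdeal k κ) x (wmono k (gravGens κ) l x)

/-- The defining relations concern words of two letters; multiplying them on both sides by the
remaining letters gives the relations inside longer words, to which straightening applies. -/
theorem gravMono_gravRel (hκ : 1 ≤ κ) (x : Lab) :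
    GravRel κ x.shift.shift.dual (gravMono k κ x) := by
  intro u v p q I J hw
  have hw' := (isWord_grav_iff hκ).2 hw
  obtain ⟨x₁, x₂, s, hu, h2⟩ := hw'.of_append
  obtain ⟨x₃, x₄, t, hm, hv⟩ := IsWord.of_append (l := [(p, I), (q, J)]) (m := v) h2
  have hm' := (isWord_grav_iff hκ).1 hm
  obtain ⟨hI, hJ, hd, hN⟩ := IsWord.pair (u := []) hm'
  have hsupp : x₃.supp = I ∪ J := by
    ext i
    rw [hm.supp]
    simp
  -- Multiplication by `u` on the left and by `v` on the right, followed by the projection on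
  -- `tGrav`; it kills the ideal in the label of the two middle letters.
  let T : (Word (gravGens κ) x₃ →₀ k) →ₗ[k] (tGrav k κ).obj x :=
    ((free k (gravGens κ)).toQuot (tGravIdeal k κ) x).comp
      ((freeMul k _ s (Finsupp.single ⟨u, hu⟩ 1)).comp
        ((freeMul k _ t).flip (Finsupp.single ⟨v, hv⟩ 1)))
  have hT : ∀ l, IsWord (gravGens κ) l x₃ → T (wmono k (gravGens κ) l x₃) =
      gravMono k κ x (u ++ (l ++ v)) := by
    intro l hl
    have hw := hu.append (hl.append hv t) s
    have e : freeMul k (gravGens κ) s (Finsupp.single ⟨u, hu⟩ 1) (freeMul k _ t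
        (Finsupp.single ⟨l, hl⟩ 1) (Finsupp.single ⟨v, hv⟩ (1 : k))) =
        Finsupp.single ⟨u ++ (l ++ v), hw⟩ 1 := by
      rw [freeMul_single, freeMul_single]
      rfl
    rw [gravMono, wmono_of_isWord hl, wmono_of_isWord hw, ← e]
    rfl
  have hmem : ∀ r ∈ (tGravIdeal k κ).carrier x₃, T r = 0 := by
    intro r hr
    refine (TwAlg.toQuot_eq_zero _ _).2 ?_
    exact (tGravIdeal k κ).mul_mem_left s _ ((tGravIdeal k κ).mul_mem_right t _ hr)
  have hsingle : ∀ a ∈ I ∪ J, T (wmono k (gravGens κ) [(0, {a}), (p + q, (I ∪ J) \ {a})] x₃) =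
      gravMono k κ x (u ++ (0, {a}) :: (p + q, (I ∪ J) \ {a}) :: v) := by
    intro a ha
    exact hT _ ((isWord_grav_iff hκ).2 (IsWord.pair_single (u := []) hm' ha))
  refine ⟨fun hp => ?_, ?_⟩
  · have h := hmem _ (TwIdeal.subset_span _ x₃
      (Or.inl ⟨p, q, I, J, hd, hsupp.symm, hp, hI, hJ, rfl⟩))
    have h' : T (∑ i ∈ I, wmono k (gravGens κ) [(0, {i}), (p + q, x₃.supp \ {i})] x₃ -
      wmono k (gravGens κ) [(p, I), (q, J)] x₃) = 0 := h
    rw [map_sub, map_sum, hT _ hm, sub_eq_zero, hsupp] at h'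
    exact h'.symm.trans (Finset.sum_congr rfl fun a ha => hsingle a (Finset.mem_union_left _ ha))
  · have h := hmem _ (TwIdeal.subset_span _ x₃ (Or.inr ⟨p + q, by rw [hsupp, hN], rfl⟩))
    have h' : T (∑ i ∈ x₃.supp, wmono k (gravGens κ) [(0, {i}), (p + q, x₃.supp \ {i})] x₃) = 0 := h
    rw [map_sum, hsupp] at h'
    exact (Finset.sum_congr rfl fun a ha => (hsingle a ha).symm).trans h'

/-- The morphism from `tGrav` to the double suspension. -/
noncomputable def gravHom (k : Type u) [Field k] {κ : ℕ} (hκ : 1 ≤ κ) (x : Lab) :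
    (tGrav k κ).obj x →ₗ[k] (gravDual k κ).obj x :=
  ((tGravIdeal k κ).carrier x).liftQ (gravLift k κ x) (tGravIdeal_le hκ x)

theorem gravHom_gravMono (hκ : 1 ≤ κ) (x : Lab) (l : List (ℕ × Finset ℕ)) :
    gravHom k hκ x (gravMono k κ x l) = gravCoord k κ x l := gravLift_wmono hκ x l

theorem injective_of_span {ι M N : Type*} [AddCommGroup M] [Module k M] [AddCommGroup N]
    [Module k N] {v : ι → M} (hv : Submodule.span k (Set.range v) = ⊤) {T : M →ₗ[k] N}
    (h : LinearIndependent k (T ∘ v)) : Function.Injective T := by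
  refine (injective_iff_map_eq_zero T).2 fun a ha => ?_
  obtain ⟨c, rfl⟩ := Finsupp.mem_span_range_iff_exists_finsupp.1 (hv ▸ Submodule.mem_top : a ∈ _)
  have : Finsupp.linearCombination k (T ∘ v) c = 0 := by
    rw [Finsupp.linearCombination_apply, ← ha, map_finsuppSum]
    simp only [map_smul, Function.comp_apply]
  rw [linearIndependent_iff.1 h c this, Finsupp.sum_zero_index]

theorem span_gravMono (hκ : 1 ≤ κ) (x : Lab) : Submodule.span k
    (Set.range fun V : BadWord κ x.shift.shift.dual => gravMono k κ x V.1.1) = ⊤ := by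
  rw [eq_top_iff]
  intro a _
  obtain ⟨f, rfl⟩ := toQuot_surjective _ (tGravIdeal k κ) x a
  let T : (Word (gravGens κ) x →₀ k) →ₗ[k] (tGrav k κ).obj x :=
    (free k (gravGens κ)).toQuot (tGravIdeal k κ) x
  suffices h : ⊤ ≤ (Submodule.span k (Set.range fun V : BadWord κ x.shift.shift.dual =>
      gravMono k κ x V.1.1)).comap T from h (Submodule.mem_top (x := f))
  rw [← Finsupp.span_single_eq_top, Submodule.span_le]
  rintro _ ⟨W, r, rfl⟩
  have h := (gravMono_gravRel (k := k) hκ x).mem_span (k := k)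
    ⟨W.1, (isWord_grav_iff hκ).1 W.2⟩
  rw [gravMono, wmono_of_isWord W.2] at h
  rw [← mul_one r, ← smul_eq_mul, ← Finsupp.smul_single, SetLike.mem_coe]
  exact Submodule.smul_mem _ r h

/-- The words with all pairs bad span the source by straightening, and their images are independent,
being non-zero multiples of `dualCoord`. -/
theorem gravHom_injective (hκ : 1 ≤ κ) (x : Lab) : Function.Injective (gravHom k hκ x) := by
  let T : (tGrav k κ).obj x →ₗ[k] (tHyperCom k κ).dualAlg.obj x.shift.shift := gravHom k hκ x
  change Function.Injective T
  refine injective_of_span (span_gravMono hκ x) ?_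
  have e : T ∘ (fun V : BadWord κ x.shift.shift.dual => gravMono k κ x V.1.1) =
      (fun _ : BadWord κ x.shift.shift.dual => Units.mk0 _ (gravSign_ne_zero (k := k) x)) •
        (fun V : BadWord κ x.shift.shift.dual => dualCoord k κ x.shift.shift V.1.1) :=
    funext fun V => gravHom_gravMono (k := k) hκ x V.1.1
  rw [e]
  exact (linearIndependent_dualCoord x.shift.shift).units_smul _

theorem gravHom_surjective (hκ : 1 ≤ κ) (x : Lab) : Function.Surjective (gravHom k hκ x) := by
  refine LinearMap.range_eq_top.1 (eq_top_iff.2 ?_)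
  refine (span_coord (k := k) (κ := κ) x.shift.shift).ge.trans (Submodule.span_le.2 ?_)
  rintro _ ⟨W, rfl⟩
  refine ⟨(gravSign k x)⁻¹ • gravMono k κ x W.1, ?_⟩
  rw [map_smul, gravHom_gravMono]
  exact inv_smul_smul₀ (gravSign_ne_zero x) (dualCoord k κ x.shift.shift W.1)

/-- The double suspension is presented by the gravity relations. -/
noncomputable def gravIso (k : Type u) [Field k] {κ : ℕ} (hκ : 1 ≤ κ) :
    TwAlgIso (tGrav k κ) (tHyperCom k κ).koszulDual.twist where
  equiv x := LinearEquiv.ofBijective (gravHom k hκ x)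
    ⟨gravHom_injective hκ x, gravHom_surjective hκ x⟩
  map_equiv σ {x y} h a := by
    obtain ⟨f, rfl⟩ := toQuot_surjective _ (tGravIdeal k κ) x a
    exact gravLift_map σ h f
  equiv_mul {z x y} s a b := by
    obtain ⟨f, rfl⟩ := toQuot_surjective _ (tGravIdeal k κ) x a
    obtain ⟨g, rfl⟩ := toQuot_surjective _ (tGravIdeal k κ) y b
    exact gravLift_mul hκ s f g
  equiv_one := (gravLift_single _).trans gravCoord_one.symm

/-- The inverse of an isomorphism. -/
def TwAlgIso.symm {A B : TwAlg k} (e : TwAlgIso A B) : TwAlgIso B A where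
  equiv x := (e.equiv x).symm
  map_equiv σ {x y} h b := by
    rw [LinearEquiv.symm_apply_eq, e.map_equiv, LinearEquiv.apply_symm_apply]
  equiv_mul {z x y} s a b := by
    rw [LinearEquiv.symm_apply_eq, e.equiv_mul, LinearEquiv.apply_symm_apply,
      LinearEquiv.apply_symm_apply]
  equiv_one := by rw [LinearEquiv.symm_apply_eq, e.equiv_one]

end GravityAlgebra

/-! ### Counting the words with all pairs bad. -/

section Dimensions

variable {k : Type u} [Field k] {κ : ℕ}

/-- The word formed by the singletons of `N \ J` in decreasing order, followed by `J`. -/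
noncomputable def tailWord (κ : ℕ) (N J : Finset ℕ) : List (ℕ × Finset ℕ) :=
  ((N \ J).sort (· ≥ ·)).map (fun a => (0, {a})) ++ [((J.card - 1) / (κ - 1), J)]

theorem mem_tailWord {N J : Finset ℕ} {a : ℕ × Finset ℕ} : a ∈ tailWord κ N J ↔
    (∃ i ∈ N \ J, a = (0, {i})) ∨ a = ((J.card - 1) / (κ - 1), J) := by
  simp only [tailWord, List.mem_append, List.mem_map, Finset.mem_sort, List.mem_singleton,
    eq_comm]

theorem exists_isWord {N : Finset ℕ} {l : List (ℕ × Finset ℕ)}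
    (has : ∀ a ∈ l, a.2.card = 1 + a.1 * (κ - 1)) (disj : l.Pairwise fun a b => Disjoint a.2 b.2)
    (supp : ∀ i, i ∈ N ↔ ∃ a ∈ l, i ∈ a.2) :
    ∃ e : ℤ × ℕ, IsWord (hycGens κ) l (⟨N, e.1, e.2⟩ : Lab).shift.dual := by
  -- The first component is the solution `d` of `-(d - |N|) - w = ∑ deg`, that is, the degree which
  -- becomes that of the word after the shift and the duality.
  refine ⟨(N.card - l.length - (l.map fun a => (hycGens κ).deg a.1).sum, l.length),
    has, disj, supp, ?_, rfl⟩
  simp only [Lab.shift, Lab.dual]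
  ring

theorem isWord_tailWord {N J : Finset ℕ} (hJN : J ⊆ N) (hJ : J.Nonempty)
    (hdvd : κ - 1 ∣ J.card - 1) :
    ∃ e : ℤ × ℕ, IsWord (hycGens κ) (tailWord κ N J) (⟨N, e.1, e.2⟩ : Lab).shift.dual := by
  refine exists_isWord (fun a ha => ?_) ?_ fun i => ?_
  · rcases mem_tailWord.1 ha with ⟨i, -, rfl⟩ | rfl
    · simp
    · have := hJ.card_pos
      rw [Nat.div_mul_cancel hdvd]
      change J.card = _
      omega
  · refine List.pairwise_append.2 ⟨?_, List.pairwise_singleton _ _, ?_⟩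
    · refine List.pairwise_map.2 ((Finset.sort_nodup _ _).imp fun h => ?_)
      exact Finset.disjoint_singleton.2 h
    · intro a ha b hb
      obtain ⟨i, hi, rfl⟩ := List.mem_map.1 ha
      rw [List.mem_singleton.1 hb]
      exact Finset.disjoint_singleton_left.2 (Finset.mem_sdiff.1 ((Finset.mem_sort _).1 hi)).2
  · constructor
    · intro hi
      by_cases hiJ : i ∈ J
      · exact ⟨_, mem_tailWord.2 (Or.inr rfl), hiJ⟩
      · exact ⟨_, mem_tailWord.2 (Or.inl ⟨i, Finset.mem_sdiff.2 ⟨hi, hiJ⟩, rfl⟩),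
          Finset.mem_singleton_self i⟩
    · rintro ⟨a, ha, hi⟩
      rcases mem_tailWord.1 ha with ⟨j, hj, rfl⟩ | rfl
      · rw [Finset.mem_singleton.1 hi]
        exact (Finset.mem_sdiff.1 hj).1
      · exact hJN hi

theorem isChain_tailWord {N J : Finset ℕ} {a : ℕ} (haJ : a ∈ J) (ha : ∀ i ∈ N, a ≤ i) :
    (tailWord κ N J).IsChain Bad := by
  refine List.Pairwise.isChain (List.pairwise_append.2 ⟨?_, List.pairwise_singleton _ _, ?_⟩)
  · refine List.pairwise_map.2 ((Finset.sortedGT_sort _).pairwise.imp fun h => ?_)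
    exact ⟨rfl, by rwa [mn_singleton, mn_singleton]⟩
  · intro x hx y hy
    obtain ⟨i, hi, rfl⟩ := List.mem_map.1 hx
    obtain ⟨hiN, hiJ⟩ := Finset.mem_sdiff.1 ((Finset.mem_sort _).1 hi)
    rw [List.mem_singleton.1 hy]
    refine ⟨rfl, ?_⟩
    rw [mn_singleton]
    exact (mn_le haJ).trans_lt ((ha i hiN).lt_of_ne fun h => hiJ (h ▸ haJ))

/-- All letters but the last are first members of bad pairs, hence singletons in decreasing order.
The minimum of the last letter is below all of them, so that letter contains the minimum of the
support, and the word is determined by its last letter. -/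
theorem eq_tailWord (hκ : 1 < κ) {z : Lab} {l : List (ℕ × Finset ℕ)}
    (h : IsWord (hycGens κ) l z) (hb : l.IsChain Bad) (hz : z.supp.Nonempty) :
    ∃ J ⊆ z.supp, κ - 1 ∣ J.card - 1 ∧ (∃ a ∈ J, ∀ i ∈ z.supp, a ≤ i) ∧
      l = tailWord κ z.supp J := by
  -- By transitivity a condition on adjacent letters holds for all pairs, so every letter can be
  -- compared with the last one.
  have : IsTrans (ℕ × Finset ℕ) Bad := ⟨fun a b c hab hbc => ⟨hab.1, hbc.2.trans hab.2⟩⟩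
  have hp := List.isChain_iff_pairwise.1 hb
  rcases List.eq_nil_or_concat l with rfl | ⟨u, ⟨p, J⟩, rfl⟩
  · obtain ⟨i, hi⟩ := hz
    obtain ⟨a, ha, -⟩ := (h.supp i).1 hi
    exact absurd ha List.not_mem_nil
  rw [List.concat_eq_append] at *
  obtain ⟨hu, -, huJ⟩ := List.pairwise_append.1 hp
  have hd := (List.pairwise_append.1 h.disj).2.2
  have hmemJ : (p, J) ∈ u ++ [(p, J)] := List.mem_append_right _ (List.mem_singleton_self _)
  have hJ : J.card = 1 + p * (κ - 1) := h.has _ hmemJ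
  have hJz : J ⊆ z.supp := fun i hi => (h.supp i).2 ⟨_, hmemJ, hi⟩
  have hmn : mn (p, J) ∈ J := mn_mem (h.nonempty hmemJ)
  have hu1 : ∀ x ∈ u, x = (0, {mn x}) := fun x hx =>
    h.eq_singleton (List.mem_append_left _ hx) (huJ x hx _ (List.mem_singleton_self _)).1
  have hlt : ∀ x ∈ u, mn (p, J) < mn x := fun x hx => (huJ x hx _ (List.mem_singleton_self _)).2
  have hu2 : u = (u.map mn).map fun a => (0, {a}) := by
    rw [List.map_map]
    exact (List.map_id' u).symm.trans (List.map_congr_left hu1)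
  have hpw : (u.map mn).Pairwise (· > ·) := List.pairwise_map.2 (hu.imp fun h => h.2)
  have hset : (u.map mn).toFinset = z.supp \ J := by
    ext i
    rw [List.mem_toFinset, List.mem_map, Finset.mem_sdiff, h.supp]
    constructor
    · rintro ⟨x, hx, rfl⟩
      have hx' : mn x ∈ x.2 := mn_mem (h.nonempty (List.mem_append_left _ hx))
      exact ⟨⟨x, List.mem_append_left _ hx, hx'⟩,
        Finset.disjoint_left.1 (hd x hx _ (List.mem_singleton_self _)) hx'⟩
    · rintro ⟨⟨x, hx, hi⟩, hiJ⟩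
      rcases List.mem_append.1 hx with hx | hx
      · rw [hu1 x hx] at hi
        exact ⟨x, hx, (Finset.mem_singleton.1 hi).symm⟩
      · rw [List.mem_singleton.1 hx] at hi
        exact absurd hi hiJ
  refine ⟨J, hJz, ⟨p, by rw [hJ, Nat.add_sub_cancel_left, mul_comm]⟩, ⟨_, hmn, fun i hi => ?_⟩, ?_⟩
  · by_cases hiJ : i ∈ J
    · exact mn_le hiJ
    · have : i ∈ (u.map mn).toFinset := by rw [hset]; exact Finset.mem_sdiff.2 ⟨hi, hiJ⟩
      obtain ⟨x, hx, rfl⟩ := List.mem_map.1 (List.mem_toFinset.1 this)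
      exact (hlt x hx).le
  · rw [tailWord, ← hset, (List.toFinset_sort (· ≥ ·) (hpw.imp ne_of_gt)).2 (hpw.imp le_of_lt), ← hu2,
      hJ, Nat.add_sub_cancel_left, Nat.mul_div_cancel _ (by omega)]

/-- The words indexing a basis of the value of the Koszul dual on a finite set. -/
abbrev ValueWord (κ : ℕ) (N : Finset ℕ) : Type :=
  Σ e : ℤ × ℕ, BadWord κ (⟨N, e.1, e.2⟩ : Lab).shift.dual

/-- For a fixed support, the degree and the weight are read off from the word. -/
theorem ValueWord.ext {N : Finset ℕ} {V W : ValueWord κ N} (h : V.2.1.1 = W.2.1.1) : V = W := by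
  obtain ⟨⟨d, w⟩, ⟨⟨l, hl⟩, hc⟩⟩ := V
  obtain ⟨⟨d', w'⟩, ⟨⟨l', hl'⟩, hc'⟩⟩ := W
  change l = l' at h
  subst h
  have h1 : w = w' := hl.wt.symm.trans hl'.wt
  have h2 := hl.deg.symm.trans hl'.deg
  simp only [Lab.shift, Lab.dual] at h2
  have h3 : d = d' := by omega
  subst h1 h3
  rfl

/-- The number of words indexing a basis of the value of the Koszul dual. -/
theorem exists_bijective_valueWord (hκ : 1 < κ) (n : ℕ) :
    ∃ F : {S // S ∈ (Finset.Icc 1 (n - 1)).powerset.filter fun S => (κ - 1) ∣ S.card} →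
      ValueWord κ (Finset.Icc 1 n), Function.Bijective F := by
  rcases Nat.eq_zero_or_pos n with rfl | hn
  -- On the empty set there is only the empty word. It corresponds to the empty subset, in agreement
  -- with the truncation of `n - 1` to zero.
  · obtain ⟨e, he⟩ := exists_isWord (κ := κ) (N := Finset.Icc 1 0) (l := []) (by simp) (by simp)
      (by simp)
    refine ⟨fun _ => ⟨e, ⟨⟨[], he⟩, List.IsChain.nil⟩⟩, fun S T _ => ?_, fun V => ?_⟩
    · obtain ⟨S, hS⟩ := S
      obtain ⟨T, hT⟩ := T
      simp only [Finset.mem_filter, Finset.mem_powerset] at hS hT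
      apply Subtype.ext
      exact (Finset.subset_empty.1 hS.1).trans (Finset.subset_empty.1 hT.1).symm
    · refine ⟨⟨∅, by simp⟩, ValueWord.ext ?_⟩
      refine (List.eq_nil_iff_forall_not_mem.2 fun a ha => ?_).symm
      obtain ⟨i, hi⟩ := V.2.1.2.nonempty ha
      exact absurd ((V.2.1.2.supp i).2 ⟨a, ha, hi⟩) (by simp [Lab.dual, Lab.shift])
  -- Shifting `S` by one makes room for the minimum `1`, which the last letter always contains. Then
  -- `|J S| - 1 = |S|`, so the divisibility conditions correspond.
  · let J : Finset ℕ → Finset ℕ := fun S => insert 1 (S.map (addRightEmbedding 1))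
    have hmem : ∀ {S : Finset ℕ} {i : ℕ}, 1 ≤ i → (i + 1 ∈ J S ↔ i ∈ S) := by
      intro S i hi
      simp only [J, Finset.mem_insert, Finset.mem_map, addRightEmbedding_apply]
      constructor
      · rintro (h | ⟨j, hj, h⟩)
        · omega
        · rwa [← Nat.add_right_cancel h]
      · exact fun h => Or.inr ⟨i, h, rfl⟩
    have h1J : ∀ S, 1 ∈ J S := fun S => Finset.mem_insert_self _ _
    have hcard : ∀ S ⊆ Finset.Icc 1 (n - 1), (J S).card = S.card + 1 := by
      intro S hS
      rw [Finset.card_insert_of_notMem, Finset.card_map]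
      intro h
      obtain ⟨j, hj, h⟩ := Finset.mem_map.1 h
      have h1 := Finset.mem_Icc.1 (hS hj)
      rw [addRightEmbedding_apply] at h
      omega
    have hsub : ∀ S ⊆ Finset.Icc 1 (n - 1), J S ⊆ Finset.Icc 1 n := by
      intro S hS
      refine Finset.insert_subset (Finset.mem_Icc.2 ⟨le_rfl, hn⟩) fun i hi => ?_
      obtain ⟨j, hj, rfl⟩ := Finset.mem_map.1 hi
      have h1 := Finset.mem_Icc.1 (hS hj)
      rw [addRightEmbedding_apply, Finset.mem_Icc]
      omega
    have hex : ∀ S : {S // S ∈ (Finset.Icc 1 (n - 1)).powerset.filter fun S => (κ - 1) ∣ S.card},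
        ∃ V : ValueWord κ (Finset.Icc 1 n), V.2.1.1 = tailWord κ (Finset.Icc 1 n) (J S.1) := by
      rintro ⟨S, hS⟩
      rw [Finset.mem_filter, Finset.mem_powerset] at hS
      obtain ⟨e, he⟩ := isWord_tailWord (κ := κ) (hsub S hS.1) ⟨1, h1J S⟩
        (by rw [hcard S hS.1]; exact hS.2)
      exact ⟨⟨e, ⟨⟨_, he⟩, isChain_tailWord (h1J S) fun i hi => (Finset.mem_Icc.1 hi).1⟩⟩, rfl⟩
    choose F hF using hex
    refine ⟨F, fun S T h => ?_, fun V => ?_⟩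
    · obtain ⟨S, hS⟩ := S
      obtain ⟨T, hT⟩ := T
      have h1 := (hF ⟨S, hS⟩).symm.trans ((congrArg (fun V => V.2.1.1) h).trans (hF ⟨T, hT⟩))
      have h2 : J S = J T :=
        congrArg Prod.snd (List.singleton_inj.1 (List.append_inj_right' h1 rfl))
      rw [Finset.mem_filter, Finset.mem_powerset] at hS hT
      refine Subtype.ext (Finset.ext fun i => ⟨fun hi => ?_, fun hi => ?_⟩)
      · have hi1 := (Finset.mem_Icc.1 (hS.1 hi)).1
        rwa [← hmem hi1, ← h2, hmem hi1]
      · have hi1 := (Finset.mem_Icc.1 (hT.1 hi)).1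
        rwa [← hmem hi1, h2, hmem hi1]
    · obtain ⟨J', hJ', hdvd, ⟨a, haJ, ha⟩, hl⟩ := eq_tailWord hκ V.2.1.2 V.2.2
        ⟨1, Finset.mem_Icc.2 ⟨le_rfl, hn⟩⟩
      change J' ⊆ Finset.Icc 1 n at hJ'
      have ha1 : a = 1 := le_antisymm (ha 1 (Finset.mem_Icc.2 ⟨le_rfl, hn⟩))
        (Finset.mem_Icc.1 (hJ' haJ)).1
      subst ha1
      -- The inverse construction: remove the minimum `1` from the last letter and shift back.
      let S := (Finset.Icc 1 (n - 1)).filter fun i => i + 1 ∈ J'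
      have hJS : J S = J' := by
        ext i
        rcases i with _ | _ | i
        · refine iff_of_false (fun h => ?_) fun h => ?_
          · exact absurd (Finset.mem_Icc.1 (hsub S (Finset.filter_subset _ _) h)).1 (by omega)
          · exact absurd (Finset.mem_Icc.1 (hJ' h)).1 (by omega)
        · exact iff_of_true (h1J S) haJ
        · rw [hmem (by omega), Finset.mem_filter, Finset.mem_Icc]
          refine ⟨fun h => h.2, fun h => ⟨?_, h⟩⟩
          have := Finset.mem_Icc.1 (hJ' h)
          omega
      have hS : S ∈ (Finset.Icc 1 (n - 1)).powerset.filter fun S => (κ - 1) ∣ S.card := by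
        rw [Finset.mem_filter, Finset.mem_powerset]
        refine ⟨Finset.filter_subset _ _, ?_⟩
        rwa [← hJS, hcard S (Finset.filter_subset _ _), Nat.add_sub_cancel] at hdvd
      refine ⟨⟨S, hS⟩, ValueWord.ext ((hF _).trans ?_)⟩
      rw [hl, hJS]
      rfl

theorem rank_koszulDual_value (k : Type u) [Field k] (hκ : 1 < κ) (n : ℕ) :
    Module.rank k ((tHyperCom k κ).koszulDual.value (Finset.Icc 1 n)) =
      (((Finset.Icc 1 (n - 1)).powerset.filter (fun S => (κ - 1) ∣ S.card)).card : Cardinal) := by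
  obtain ⟨F, hF⟩ := exists_bijective_valueWord hκ n
  let b : Module.Basis (ValueWord κ (Finset.Icc 1 n)) k
      ((tHyperCom k κ).koszulDual.value (Finset.Icc 1 n)) :=
    DFinsupp.basis fun e => dualBasis k κ (⟨Finset.Icc 1 n, e.1, e.2⟩ : Lab).shift
  rw [rank_eq_card_basis (b.reindex (Equiv.ofBijective F hF).symm), Fintype.card_coe]

/-- Subsets are grouped by their cardinality `p c`. Since `c` is positive, `p ≤ p c`, so all
cardinalities that occur have `p ≤ n`; the remaining terms have vanishing binomials. -/
theorem card_filter_dvd_card {c : ℕ} (hc : 0 < c) (n : ℕ) :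
    ((Finset.Icc 1 (n - 1)).powerset.filter (fun S => c ∣ S.card)).card =
      ∑ p ∈ Finset.range (n + 1), (n - 1).choose (p * c) := by
  classical
  rw [Finset.card_filter, Finset.sum_powerset_apply_card (fun m => if c ∣ m then 1 else 0),
    Nat.card_Icc, Nat.add_sub_cancel]
  simp only [smul_eq_mul, mul_ite, mul_one, mul_zero]
  rw [← Finset.sum_filter, ← Finset.sum_image (f := fun m => (n - 1).choose m) (g := (· * c))
    fun a _ b _ h => Nat.eq_of_mul_eq_mul_right hc h]
  refine Finset.sum_subset (fun m hm => ?_) fun m hm hm' => ?_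
  · obtain ⟨h1, p, rfl⟩ := Finset.mem_filter.1 hm
    refine Finset.mem_image.2 ⟨p, ?_, mul_comm _ _⟩
    rw [Finset.mem_range] at h1 ⊢
    have := Nat.le_mul_of_pos_left p hc
    omega
  · obtain ⟨p, -, rfl⟩ := Finset.mem_image.1 hm
    refine Nat.choose_eq_zero_of_lt ?_
    by_contra h
    exact hm' (Finset.mem_filter.2 ⟨Finset.mem_range.2 (by omega), Dvd.intro_left p rfl⟩)

end Dimensions

end Tw

theorem mainTheorem9 {k : Type u} [Field k] [CharZero k] (κ : ℕ) (hκ : 1 ≤ κ) :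
    (Tw.tHyperCom k κ).IsKoszul ∧
    Nonempty (Tw.TwAlgIso (Tw.tHyperCom k κ).koszulDual.twist (Tw.tGrav k κ)) ∧
    (1 < κ → ∀ n : ℕ,
      Module.rank k ((Tw.tHyperCom k κ).koszulDual.value (Finset.Icc 1 n)) =
        (((Finset.Icc 1 (n - 1)).powerset.filter (fun S => (κ - 1) ∣ S.card)).card : Cardinal) ∧
      Module.rank k ((Tw.tHyperCom k κ).koszulDual.value (Finset.Icc 1 n)) =
        ((∑ p ∈ Finset.range (n + 1), (n - 1).choose (p * (κ - 1)) : ℕ) : Cardinal)) := by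
  refine ⟨Tw.isKoszul_tHyperCom, ⟨(Tw.gravIso k hκ).symm⟩, fun hκ' n => ?_⟩
  have h := Tw.rank_koszulDual_value k hκ' n
  refine ⟨h, h.trans ?_⟩
  rw [Tw.card_filter_dvd_card (by omega)]
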